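/- **Setting.** Let $\mathbb H$ be the category freely generated by the graph with vertices $n$ and $n_t$ ($n\ge 1$) and edges $n\to n+1$, $n\to n_t$. For a presheaf $X\in[\mathbb H^{\mathrm{op}},\mathbf{Set}]$ write $\partial\colon X(n+1)\to X(n)$ and $\partial\colon X(n_t)\to X(n)$ for the reindexing (boundary) maps. *$\{w\}$-GATs.* A $\{w\}$-GAT $\mathbb T$ consists of sets of type-constants and term-constants and a set $\Lambda$ of basic judgements, each of one of the forms $\Gamma\vdash T\ \mathsf{type}$, $\Gamma\vdash t:T$, $\Gamma\vdash T=T'\ \mathsf{type}$, $\Gamma\vdash t=t':T$, over expressions built from variables and the constants. Each type-constant $A$ has a unique basic judgement of the form $x_1:T_1,\dots,x_{m}:T_{m}\vdash A(x_1,\dots,x_{m})\ \mathsf{type}$, each term-constant $f$ a unique one of the form $x_1:T_1,\dots,x_{m}:T_{m}\vdash f(x_1,\dots,x_{m}):T$, all other basic judgements are equality judgements, and every basic judgement is derivable. Here the derivable judgements form the smallest collection which contains a basic judgement whenever it contains the judgements in its boundary, and is closed under $\alpha$-conversion, reflexivity, symmetry and transitivity of type and term equality, the conversion rules (from $\Gamma\vdash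 T_1=T_2\ \mathsf{type}$ and $\Gamma\vdash t:T_1$, resp. $\Gamma\vdash t=t':T_1$, derive $\Gamma\vdash t:T_2$, resp. $\Gamma\vdash t=t':T_2$; and from $\Gamma\vdash T_1=T_2\ \mathsf{type}$ and $\Gamma,x:T_1,\Delta\vdash\mathcal J$ derive $\Gamma,x:T_2,\Delta\vdash\mathcal J$), and the weakening rule (from $\Gamma\vdash T\ \mathsf{type}$ and $\Gamma,\Delta\vdash\mathcal J$ derive $\Gamma,y:T,\Delta\vdash\mathcal J$ for fresh $y$). The boundary of a judgement is the list $()$ for $\vdash T\ \mathsf{type}$; $(\Gamma\vdash T\ \mathsf{type})$ for $\Gamma,x:T\vdash T'\ \mathsf{type}$ and for $\Gamma\vdash t:T$; $(\Gamma\vdash T\ \mathsf{type},\ \Gamma\vdash T'\ \mathsf{type})$ for $\Gamma\vdash T=T'\ \mathsf{type}$; and $(\Gamma\vdash t:T,\ \Gamma\vdash t':T)$ for $\Gamma\vdash t=t':T$. Two derivable type judgements, or two derivable term judgements, are congruent ($\equiv$) if, after renaming variables, their contexts are entrywise derivably equal, their types are derivably equal, and (for term judgements) their terms are derivably equal. A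 morphism $\mathbb T\to\mathbb U$ is an equivalence class of interpretations, that is, of maps from derivable judgements to derivable judgements which preserve kinds, boundaries and all the deduction rules; two interpretations are equivalent if their values at each derivable type or term judgement are congruent. This gives a category $\{w\}\text{-}\mathbf{GAT}$. The forgetful functor $V\colon\{w\}\text{-}\mathbf{GAT}\to[\mathbb H^{\mathrm{op}},\mathbf{Set}]$ sends $\mathbb T$ to the presheaf for which $V\mathbb T(n)$ and $V\mathbb T(n_t)$ are the sets of $\equiv$-classes of derivable type judgements, resp. term judgements, with context of length $n-1$, with maps $\partial$ induced by the boundary, and sends a morphism $[\phi]$ to the map $[\mathcal J]\mapsto[\phi(\mathcal J)]$. The *weakening monad* $W$ is the monad on $[\mathbb H^{\mathrm{op}},\mathbf{Set}]$ induced by $V$ and a left adjoint of it. *Heaps.* $\mathrm{Hp}(n)$ is the set of functions $\phi\colon\{0,\dots,n\}\to\{0,\dots,n\}$ with $\phi(0)=0$ and $\phi(i)<i$ for $1\le i\le n$; the depth of $i$ in $\phi$ is $|\{\phi(i),\phi^2(i),\dots\}|$. For $\phi\in\mathrm{Hp}(n)$ let $[\phi]\in[\mathbb H^{\mathrm{op}},\mathbf{Set}]$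 be given by $[\phi](m)=\{i\in\{1,\dots,n\}: i\text{ has depth }m\}$, $[\phi](m_t)=\emptyset$ and $\partial(i)=\phi(i)$; for $n\ge 1$ let $[\phi]_t$ be obtained from $[\phi]$ by adjoining one term-element with boundary $n$. **Proposition.** The functor $V$ has a left adjoint, and the resulting weakening monad $W$ is strongly cartesian. That is: 1. $W$ is local right adjoint: for every presheaf $X$, the functor $W/X\colon[\mathbb H^{\mathrm{op}},\mathbf{Set}]/X\to[\mathbb H^{\mathrm{op}},\mathbf{Set}]/WX$ is a right adjoint. Moreover, each component of $W$ is a coproduct of representables indexed by heaps: for every $n\ge1$ there are isomorphisms, natural in $X$, $$WX(n)\cong\sum_{\phi\in\mathrm{Hp}(n)}[\mathbb H^{\mathrm{op}},\mathbf{Set}]([\phi],X),\qquad WX(n_t)\cong\sum_{\phi\in\mathrm{Hp}(n)}[\mathbb H^{\mathrm{op}},\mathbf{Set}]([\phi]_t,X).$$ 2. $W$ is cartesian: it preserves pullbacks, and every naturality square of its unit $1\Rightarrow W$ and of its multiplication $WW\Rightarrow W$ is a pullback. -/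

import Mathlib

open CategoryTheory Opposite Limits

universe v₁ v₂ u u₁ u₂

namespace WeakeningMonad

section RawSyntax

/-- Expressions over an alphabet `C`: variables, and a symbol applied to finitely many expressions.
Variables are de Bruijn *levels*: `var i` is the `i`-th variable (from the left, starting with `0`)
declared in the ambient context.  Thus `α`-equivalent judgements are literally equal. -/
inductive Expr (C : Type u) : Type u
  | var (i : ℕ) : Expr C
  | app (c : C) (k : ℕ) (args : Fin k → Expr C) : Expr C

variable {C : Type u}

/-- Renaming of variables. -/
def Expr.rename (f : ℕ → ℕ) : Expr C → Expr C
  | .var i => .var (f i)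
  | .app c k args => .app c k fun j => (args j).rename f

/-- The renaming which makes room for a new variable at level `k`. -/
def skip (k i : ℕ) : ℕ := if i < k then i else i + 1

/-- A context, listed with the *last* declaration first: the context
`x₀ : T₀, …, xₘ : Tₘ` is the list `[Tₘ, …, T₀]`.  Hence `Γ, x : T` is `T :: Γ`
and `Γ, Δ` is `Δ ++ Γ`. -/
abbrev Ctx (C : Type u) : Type u := List (Expr C)

/-- The right-hand side of a judgement: `T type`, or `t : T`, or `T = T' type`, or `t = t' : T`. -/
inductive Body (C : Type u) : Type u
  | ty (T : Expr C) : Body C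
  | tm (t T : Expr C) : Body C
  | tyEq (T T' : Expr C) : Body C
  | tmEq (t t' T : Expr C) : Body C

/-- The four kinds of judgement. -/
inductive Kind : Type
  | ty | tm | tyEq | tmEq

def Body.kind : Body C → Kind
  | .ty _ => .ty
  | .tm _ _ => .tm
  | .tyEq _ _ => .tyEq
  | .tmEq _ _ _ => .tmEq

def Body.rename (f : ℕ → ℕ) : Body C → Body C
  | .ty T => .ty (T.rename f)
  | .tm t T => .tm (t.rename f) (T.rename f)
  | .tyEq T T' => .tyEq (T.rename f) (T'.rename f)
  | .tmEq t t' T => .tmEq (t.rename f) (t'.rename f) (T.rename f)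

/-- A judgement `Γ ⊢ 𝒥`. Its degree is one more than the length of its context. -/
structure Judgement (C : Type u) : Type u where
  ctx : Ctx C
  body : Body C

/-- The boundary of a judgement, a list of length `0`, `1` or `2`. -/
def Judgement.boundary : Judgement C → List (Judgement C)
  | ⟨Γ, .ty _⟩ => match Γ with
    | [] => []
    | T :: Γ' => [⟨Γ', .ty T⟩]
  | ⟨Γ, .tm _ T⟩ => [⟨Γ, .ty T⟩]
  | ⟨Γ, .tyEq T T'⟩ => [⟨Γ, .ty T⟩, ⟨Γ, .ty T'⟩]
  | ⟨Γ, .tmEq t t' T⟩ => [⟨Γ, .tm t T⟩, ⟨Γ, .tm t' T⟩]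

/-- The names of the deduction rules of `{w}`-GATs. -/
inductive RuleName : Type
  | tmRefl | tmSymm | tmTrans | tyRefl | tySymm | tyTrans
  | tmConv | tmEqConv | ctxConv | weakening

/-- `Rule r Js J`: the rule `r` derives the conclusion `J` from the list of hypotheses `Js`.
Given `r` and `Js`, there is at most one such `J`.  There is no rule of `α`-conversion, since
`α`-equivalent judgements are equal. -/
inductive Rule : RuleName → List (Judgement C) → Judgement C → Prop
  | tmRefl (Γ : Ctx C) (t T : Expr C) :
      Rule .tmRefl [⟨Γ, .tm t T⟩] ⟨Γ, .tmEq t t T⟩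
  | tmSymm (Γ : Ctx C) (t₁ t₂ T : Expr C) :
      Rule .tmSymm [⟨Γ, .tmEq t₁ t₂ T⟩] ⟨Γ, .tmEq t₂ t₁ T⟩
  | tmTrans (Γ : Ctx C) (t₁ t₂ t₃ T : Expr C) :
      Rule .tmTrans [⟨Γ, .tmEq t₁ t₂ T⟩, ⟨Γ, .tmEq t₂ t₃ T⟩] ⟨Γ, .tmEq t₁ t₃ T⟩
  | tyRefl (Γ : Ctx C) (T : Expr C) :
      Rule .tyRefl [⟨Γ, .ty T⟩] ⟨Γ, .tyEq T T⟩
  | tySymm (Γ : Ctx C) (T₁ T₂ : Expr C) :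
      Rule .tySymm [⟨Γ, .tyEq T₁ T₂⟩] ⟨Γ, .tyEq T₂ T₁⟩
  | tyTrans (Γ : Ctx C) (T₁ T₂ T₃ : Expr C) :
      Rule .tyTrans [⟨Γ, .tyEq T₁ T₂⟩, ⟨Γ, .tyEq T₂ T₃⟩] ⟨Γ, .tyEq T₁ T₃⟩
  | tmConv (Γ : Ctx C) (T₁ T₂ t : Expr C) :
      Rule .tmConv [⟨Γ, .tyEq T₁ T₂⟩, ⟨Γ, .tm t T₁⟩] ⟨Γ, .tm t T₂⟩
  | tmEqConv (Γ : Ctx C) (T₁ T₂ t₁ t₂ : Expr C) :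
      Rule .tmEqConv [⟨Γ, .tyEq T₁ T₂⟩, ⟨Γ, .tmEq t₁ t₂ T₁⟩] ⟨Γ, .tmEq t₁ t₂ T₂⟩
  /-- Conversion in contexts: from `Γ ⊢ T₁ = T₂ type` and `Γ, x : T₁, Δ ⊢ 𝒥`
  derive `Γ, x : T₂, Δ ⊢ 𝒥`.  In the presence of weakening, projection and substitution this rule
  is derivable from the other ones; here it is what makes `≡` symmetric and transitive. -/
  | ctxConv (Γ Δ : Ctx C) (T₁ T₂ : Expr C) (b : Body C) :
      Rule .ctxConv [⟨Γ, .tyEq T₁ T₂⟩, ⟨Δ ++ T₁ :: Γ, b⟩] ⟨Δ ++ T₂ :: Γ, b⟩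
  /-- From `Γ ⊢ T type` and `Γ, Δ ⊢ 𝒥` derive `Γ, y : T, Δ ⊢ 𝒥`. -/
  | weakening (Γ Δ : Ctx C) (T : Expr C) (b : Body C) :
      Rule .weakening [⟨Γ, .ty T⟩, ⟨Δ ++ Γ, b⟩]
        ⟨Δ.map (Expr.rename (skip Γ.length)) ++ T :: Γ, b.rename (skip Γ.length)⟩

/-- The derived judgements over a collection `Λ` of basic judgements: the smallest collection
closed under the deduction rules and containing `J ∈ Λ` whenever it contains the boundary of `J`. -/
inductive Derivable (Λ : Set (Judgement C)) : Judgement C → Prop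
  | basic {J : Judgement C} (hJ : J ∈ Λ) (h : ∀ K ∈ J.boundary, Derivable Λ K) : Derivable Λ J
  | rule {r : RuleName} {Js : List (Judgement C)} {J : Judgement C} (hr : Rule r Js J)
      (h : ∀ K ∈ Js, Derivable Λ K) : Derivable Λ J

/-- Derivable equality of two contexts (of the same length). -/
def CtxEq (Λ : Set (Judgement C)) : Ctx C → Ctx C → Prop
  | [], [] => True
  | S :: Γ, T :: Δ => CtxEq Λ Γ Δ ∧ Derivable Λ ⟨Γ, .tyEq S T⟩
  | _, _ => False

/-- The congruence `≡` on type judgements and on term judgements. -/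
def Cong (Λ : Set (Judgement C)) : Judgement C → Judgement C → Prop
  | ⟨Γ, .ty S⟩, ⟨Δ, .ty T⟩ => CtxEq Λ (S :: Γ) (T :: Δ)
  | ⟨Γ, .tm s S⟩, ⟨Δ, .tm t T⟩ =>
      CtxEq Λ (S :: Γ) (T :: Δ) ∧ Derivable Λ ⟨Γ, .tmEq s t S⟩
  | _, _ => False

/-! ### Basic facts on derivability -/

section Facts

variable {Λ : Set (Judgement C)}

theorem Derivable.of_rule₁ {r : RuleName} {J₁ J : Judgement C} (hr : Rule r [J₁] J)
    (h₁ : Derivable Λ J₁) : Derivable Λ J :=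
  .rule hr (by simpa using h₁)

theorem Derivable.of_rule₂ {r : RuleName} {J₁ J₂ J : Judgement C} (hr : Rule r [J₁, J₂] J)
    (h₁ : Derivable Λ J₁) (h₂ : Derivable Λ J₂) : Derivable Λ J :=
  .rule hr (by simpa using ⟨h₁, h₂⟩)

/-- The boundary of a derived judgement is derived. -/
theorem Derivable.boundary {J : Judgement C} (hJ : Derivable Λ J) :
    ∀ K ∈ J.boundary, Derivable Λ K := by
  induction hJ with
  | basic _ h _ => exact h
  | rule hr h ih =>
    cases hr with
    | tmRefl Γ t T => simpa [Judgement.boundary] using h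
    | tmSymm Γ t₁ t₂ T =>
      simp [Judgement.boundary] at ih ⊢
      exact ⟨ih.2, ih.1⟩
    | tmTrans Γ t₁ t₂ t₃ T =>
      simp [Judgement.boundary] at ih ⊢
      exact ⟨ih.1.1, ih.2.2⟩
    | tyRefl Γ T => simpa [Judgement.boundary] using h
    | tySymm Γ T₁ T₂ =>
      simp [Judgement.boundary] at ih ⊢
      exact ⟨ih.2, ih.1⟩
    | tyTrans Γ T₁ T₂ T₃ =>
      simp [Judgement.boundary] at ih ⊢
      exact ⟨ih.1.1, ih.2.2⟩
    | tmConv Γ T₁ T₂ t =>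
      simp [Judgement.boundary] at ih ⊢
      exact ih.1.2
    | tmEqConv Γ T₁ T₂ t₁ t₂ =>
      simp [Judgement.boundary] at ih h ⊢
      exact ⟨.of_rule₂ (.tmConv Γ T₁ T₂ t₁) h.1 ih.2.1, .of_rule₂ (.tmConv Γ T₁ T₂ t₂) h.1 ih.2.2⟩
    | ctxConv Γ Δ T₁ T₂ b =>
      have h₁ := h _ (List.mem_cons_self ..)
      have ih₁ := ih _ (List.mem_cons_self ..)
      have ih₂ := ih _ (List.mem_cons_of_mem _ (List.mem_cons_self ..))
      cases b with
      | ty B =>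
        cases Δ with
        | nil =>
          simp [Judgement.boundary] at ih₁ ⊢
          exact ih₁.2
        | cons D Δ =>
          simp [Judgement.boundary] at ih₂ ⊢
          exact .of_rule₂ (.ctxConv Γ Δ T₁ T₂ _) h₁ ih₂
      | tm t B =>
        simp [Judgement.boundary] at ih₂ ⊢
        exact .of_rule₂ (.ctxConv Γ Δ T₁ T₂ _) h₁ ih₂
      | tyEq B B' =>
        simp [Judgement.boundary] at ih₂ ⊢
        exact ⟨.of_rule₂ (.ctxConv Γ Δ T₁ T₂ _) h₁ ih₂.1,
          .of_rule₂ (.ctxConv Γ Δ T₁ T₂ _) h₁ ih₂.2⟩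
      | tmEq t t' B =>
        simp [Judgement.boundary] at ih₂ ⊢
        exact ⟨.of_rule₂ (.ctxConv Γ Δ T₁ T₂ _) h₁ ih₂.1,
          .of_rule₂ (.ctxConv Γ Δ T₁ T₂ _) h₁ ih₂.2⟩
    | weakening Γ Δ T b =>
      have h₁ := h _ (List.mem_cons_self ..)
      have ih₂ := ih _ (List.mem_cons_of_mem _ (List.mem_cons_self ..))
      cases b with
      | ty B =>
        cases Δ with
        | nil => simpa [Judgement.boundary, Body.rename] using h₁
        | cons D Δ =>
          simp [Judgement.boundary, Body.rename] at ih₂ ⊢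
          exact .of_rule₂ (.weakening Γ Δ T _) h₁ ih₂
      | tm t B =>
        simp [Judgement.boundary, Body.rename] at ih₂ ⊢
        exact .of_rule₂ (.weakening Γ Δ T _) h₁ ih₂
      | tyEq B B' =>
        simp [Judgement.boundary, Body.rename] at ih₂ ⊢
        exact ⟨.of_rule₂ (.weakening Γ Δ T _) h₁ ih₂.1, .of_rule₂ (.weakening Γ Δ T _) h₁ ih₂.2⟩
      | tmEq t t' B =>
        simp [Judgement.boundary, Body.rename] at ih₂ ⊢
        exact ⟨.of_rule₂ (.weakening Γ Δ T _) h₁ ih₂.1, .of_rule₂ (.weakening Γ Δ T _) h₁ ih₂.2⟩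

theorem CtxEq.refl : ∀ {Γ : Ctx C} {T : Expr C}, Derivable Λ ⟨Γ, .ty T⟩ → CtxEq Λ (T :: Γ) (T :: Γ)
  | [], T, h => ⟨trivial, .of_rule₁ (.tyRefl _ _) h⟩
  | _ :: _, T, h =>
    ⟨CtxEq.refl (h.boundary _ (by simp [Judgement.boundary])), .of_rule₁ (.tyRefl _ _) h⟩

/-- Judgements may be transported along equalities of contexts. -/
theorem CtxEq.convert : ∀ {Γ Δ : Ctx C}, CtxEq Λ Γ Δ → ∀ (E : Ctx C) (b : Body C),
    Derivable Λ ⟨E ++ Γ, b⟩ → Derivable Λ ⟨E ++ Δ, b⟩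
  | [], [], _, _, _, h => h
  | S :: Γ, T :: Δ, ⟨h₁, h₂⟩, E, b, h => by
    have := CtxEq.convert h₁ (E ++ [T]) b
      (by simpa using Derivable.of_rule₂ (.ctxConv Γ E S T b) h₂ h)
    simpa using this

set_option linter.unusedVariables false in
theorem CtxEq.symm : ∀ {Γ Δ : Ctx C}, CtxEq Λ Γ Δ → CtxEq Λ Δ Γ
  | [], [], _ => trivial
  | S :: Γ, T :: Δ, ⟨h₁, h₂⟩ =>
    ⟨h₁.symm, h₁.convert [] _ (.of_rule₁ (.tySymm Γ S T) h₂)⟩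

set_option linter.unusedVariables false in
theorem CtxEq.trans : ∀ {Γ Δ Θ : Ctx C}, CtxEq Λ Γ Δ → CtxEq Λ Δ Θ → CtxEq Λ Γ Θ
  | [], [], [], _, _ => trivial
  | S :: Γ, T :: Δ, U :: Θ, ⟨h₁, h₂⟩, ⟨k₁, k₂⟩ =>
    ⟨h₁.trans k₁, .of_rule₂ (.tyTrans Γ S T U) h₂ (h₁.symm.convert [] _ k₂)⟩

theorem Cong.refl {J : Judgement C} (hJ : Derivable Λ J) (hk : J.body.kind = .ty ∨ J.body.kind = .tm) :
    Cong Λ J J := by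
  obtain ⟨Γ, b⟩ := J
  cases b with
  | ty T => exact CtxEq.refl hJ
  | tm t T =>
    exact ⟨CtxEq.refl (hJ.boundary _ (by simp [Judgement.boundary])), .of_rule₁ (.tmRefl _ _ _) hJ⟩
  | tyEq T T' => simp [Body.kind] at hk
  | tmEq t t' T => simp [Body.kind] at hk

theorem Cong.symm {J K : Judgement C} (h : Cong Λ J K) : Cong Λ K J := by
  obtain ⟨Γ, b⟩ := J
  obtain ⟨Δ, c⟩ := K
  cases b <;> cases c <;> try exact h.elim
  · exact CtxEq.symm h
  · obtain ⟨h₁, h₂⟩ := h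
    refine ⟨h₁.symm, h₁.1.convert [] _ ?_⟩
    exact .of_rule₂ (.tmEqConv _ _ _ _ _) h₁.2 (.of_rule₁ (.tmSymm _ _ _ _) h₂)

theorem Cong.trans {J K L : Judgement C} (h : Cong Λ J K) (k : Cong Λ K L) : Cong Λ J L := by
  obtain ⟨Γ, b⟩ := J
  obtain ⟨Δ, c⟩ := K
  obtain ⟨Θ, d⟩ := L
  cases b <;> cases c <;> (try exact h.elim) <;> cases d <;> try exact k.elim
  · exact CtxEq.trans h k
  · obtain ⟨h₁, h₂⟩ := h
    obtain ⟨k₁, k₂⟩ := k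
    refine ⟨h₁.trans k₁, .of_rule₂ (.tmTrans _ _ _ _ _) h₂ ?_⟩
    exact .of_rule₂ (.tmEqConv _ _ _ _ _) (.of_rule₁ (.tySymm _ _ _) h₁.2)
      (h₁.1.symm.convert [] _ k₂)

end Facts

end RawSyntax

/-! ### The category of `{w}`-GATs -/

/-- The judgement `Γ ⊢ A(x₀, …, xₘ) type`, where `x₀, …, xₘ` are the variables of `Γ`. -/
def tyDecl {C : Type u} (c : C) (Γ : Ctx C) : Judgement C :=
  ⟨Γ, .ty (.app c Γ.length fun i => .var i)⟩

/-- The judgement `Γ ⊢ f(x₀, …, xₘ) : T`, where `x₀, …, xₘ` are the variables of `Γ`. -/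
def tmDecl {C : Type u} (c : C) (Γ : Ctx C) (T : Expr C) : Judgement C :=
  ⟨Γ, .tm (.app c Γ.length fun i => .var i) T⟩

/-- A generalised algebraic theory over the structural rule of weakening alone. -/
structure WGAT : Type (u + 1) where
  /-- the type-constants -/
  TyConst : Type u
  /-- the term-constants -/
  TmConst : Type u
  /-- the basic judgements -/
  basic : Set (Judgement (TyConst ⊕ TmConst))
  existsUnique_tyDecl : ∀ A : TyConst, ∃! J, J ∈ basic ∧ ∃ Γ, J = tyDecl (.inl A) Γ
  existsUnique_tmDecl : ∀ f : TmConst, ∃! J, J ∈ basic ∧ ∃ Γ T, J = tmDecl (.inr f) Γ T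
  basic_cases : ∀ J ∈ basic,
    (∃ A Γ, J = tyDecl (.inl A) Γ) ∨ (∃ f Γ T, J = tmDecl (.inr f) Γ T) ∨
      J.body.kind = .tyEq ∨ J.body.kind = .tmEq
  derivable_of_mem_basic : ∀ J ∈ basic, Derivable basic J

namespace WGAT

/-- Judgements over the alphabet of type- and term-constants of `T`. -/
abbrev J (T : WGAT.{u}) : Type u := Judgement (T.TyConst ⊕ T.TmConst)

/-- The derived judgements of `T`. -/
abbrev Der (T : WGAT.{u}) (J : T.J) : Prop := Derivable T.basic J

/-- An interpretation of `T` in `U`: an assignation of derived judgements of `U` to derived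
judgements of `T` which preserves the kind, the boundary and the deduction rules.  Its values at
judgements which are not derived are irrelevant, as interpretations will be identified when
they agree up to `≡` on derived judgements. -/
structure Interpretation (T U : WGAT.{u}) : Type u where
  toFun : T.J → U.J
  derivable : ∀ J, T.Der J → U.Der (toFun J)
  kind : ∀ J, T.Der J → (toFun J).body.kind = J.body.kind
  boundary : ∀ J, T.Der J → (toFun J).boundary = J.boundary.map toFun
  rule : ∀ (r : RuleName) (Js : List T.J) (J : T.J), (∀ K ∈ Js, T.Der K) → Rule r Js J →
    Rule r (Js.map toFun) (toFun J)

namespace Interpretation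

variable {T U V : WGAT.{u}}

/-- The identity interpretation. -/
def id (T : WGAT.{u}) : Interpretation T T where
  toFun J := J
  derivable _ h := h
  kind _ _ := rfl
  boundary _ _ := by simp
  rule _ _ _ _ h := by simpa using h

/-- Composition of interpretations. -/
def comp (φ : Interpretation T U) (ψ : Interpretation U V) : Interpretation T V where
  toFun J := ψ.toFun (φ.toFun J)
  derivable J h := ψ.derivable _ (φ.derivable _ h)
  kind J h := (ψ.kind _ (φ.derivable _ h)).trans (φ.kind _ h)
  boundary J h := by
    rw [ψ.boundary _ (φ.derivable _ h), φ.boundary _ h, List.map_map]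
    rfl
  rule r Js J h hr := by
    have := ψ.rule r (Js.map φ.toFun) (φ.toFun J)
      (by simpa using fun K hK => φ.derivable K (h K hK)) (φ.rule r Js J h hr)
    rwa [List.map_map] at this

variable (φ : Interpretation T U)

theorem map_ty {Γ : Ctx _} {A : Expr _} (h : T.Der ⟨Γ, .ty A⟩) :
    ∃ Γ' A', φ.toFun ⟨Γ, .ty A⟩ = ⟨Γ', .ty A'⟩ := by
  have := φ.kind _ h
  generalize φ.toFun ⟨Γ, .ty A⟩ = K at this ⊢
  obtain ⟨Γ', b⟩ := K
  cases b <;> simp [Body.kind] at this ⊢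

theorem map_tm {Γ : Ctx _} {t A : Expr _} (h : T.Der ⟨Γ, .tm t A⟩) :
    ∃ Γ' t' A', φ.toFun ⟨Γ, .tm t A⟩ = ⟨Γ', .tm t' A'⟩ ∧ φ.toFun ⟨Γ, .ty A⟩ = ⟨Γ', .ty A'⟩ := by
  have h₁ := φ.kind _ h
  have h₂ := φ.boundary _ h
  generalize φ.toFun ⟨Γ, .tm t A⟩ = K at h₁ h₂ ⊢
  obtain ⟨Γ', b⟩ := K
  cases b <;> simp [Body.kind, Judgement.boundary] at h₁ h₂ ⊢
  exact h₂.symm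

theorem map_tyEq {Γ : Ctx _} {A B : Expr _} (h : T.Der ⟨Γ, .tyEq A B⟩) :
    ∃ Γ' A' B', φ.toFun ⟨Γ, .tyEq A B⟩ = ⟨Γ', .tyEq A' B'⟩ ∧
      φ.toFun ⟨Γ, .ty A⟩ = ⟨Γ', .ty A'⟩ ∧ φ.toFun ⟨Γ, .ty B⟩ = ⟨Γ', .ty B'⟩ := by
  have h₁ := φ.kind _ h
  have h₂ := φ.boundary _ h
  generalize φ.toFun ⟨Γ, .tyEq A B⟩ = K at h₁ h₂ ⊢
  obtain ⟨Γ', b⟩ := K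
  cases b <;> simp [Body.kind, Judgement.boundary] at h₁ h₂ ⊢
  exact ⟨h₂.1.symm, h₂.2.symm⟩

theorem map_tmEq {Γ : Ctx _} {s t A : Expr _} (h : T.Der ⟨Γ, .tmEq s t A⟩) :
    ∃ Γ' s' t' A', φ.toFun ⟨Γ, .tmEq s t A⟩ = ⟨Γ', .tmEq s' t' A'⟩ ∧
      φ.toFun ⟨Γ, .tm s A⟩ = ⟨Γ', .tm s' A'⟩ ∧ φ.toFun ⟨Γ, .tm t A⟩ = ⟨Γ', .tm t' A'⟩ := by
  have h₁ := φ.kind _ h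
  have h₂ := φ.boundary _ h
  generalize φ.toFun ⟨Γ, .tmEq s t A⟩ = K at h₁ h₂ ⊢
  obtain ⟨Γ', b⟩ := K
  cases b <;> simp [Body.kind, Judgement.boundary] at h₁ h₂ ⊢
  exact ⟨h₂.1.symm, h₂.2.symm⟩

theorem length_ty : ∀ {Γ : Ctx _} {A : Expr _}, T.Der ⟨Γ, .ty A⟩ →
    (φ.toFun ⟨Γ, .ty A⟩).ctx.length = Γ.length
  | [], A, h => by
    obtain ⟨Γ', A', e⟩ := φ.map_ty h
    have := φ.boundary _ h
    rw [e] at this ⊢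
    cases Γ' <;> simp [Judgement.boundary] at this ⊢
  | B :: Γ, A, h => by
    have ih := length_ty (h.boundary ⟨Γ, .ty B⟩ (by simp [Judgement.boundary]))
    obtain ⟨Γ', A', e⟩ := φ.map_ty h
    have := φ.boundary _ h
    rw [e] at this ⊢
    cases Γ' with
    | nil => simp [Judgement.boundary] at this
    | cons B' Γ' =>
      simp [Judgement.boundary] at this ⊢
      rw [← this] at ih
      exact ih

/-- Interpretations preserve degrees. -/
theorem length {J : T.J} (h : T.Der J) : (φ.toFun J).ctx.length = J.ctx.length := by
  obtain ⟨Γ, b⟩ := J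
  cases b with
  | ty A => exact φ.length_ty h
  | tm t A =>
    obtain ⟨Γ', t', A', e, e'⟩ := φ.map_tm h
    have := φ.length_ty (h.boundary ⟨Γ, .ty A⟩ (by simp [Judgement.boundary]))
    rw [e'] at this
    rwa [e]
  | tyEq A B =>
    obtain ⟨Γ', A', B', e, e', -⟩ := φ.map_tyEq h
    have := φ.length_ty (h.boundary ⟨Γ, .ty A⟩ (by simp [Judgement.boundary]))
    rw [e'] at this
    rwa [e]
  | tmEq s t A =>
    have h' := h.boundary ⟨Γ, .tm s A⟩ (by simp [Judgement.boundary])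
    obtain ⟨Γ', s', t', A', e, e', -⟩ := φ.map_tmEq h
    obtain ⟨Γ'', s'', A'', k, k'⟩ := φ.map_tm h'
    have := φ.length_ty (h'.boundary ⟨Γ, .ty A⟩ (by simp [Judgement.boundary]))
    rw [k'] at this
    rw [e] at *
    rw [e'] at k
    simp only [Judgement.mk.injEq] at k
    rw [← k.1] at this
    exact this

theorem map_ctxConv {Γ E : Ctx _} {A B : Expr _} {b : Body _} (h₁ : T.Der ⟨Γ, .tyEq A B⟩)
    (h₂ : T.Der ⟨E ++ A :: Γ, b⟩) :
    ∃ Γ' E' A' B' b', φ.toFun ⟨Γ, .tyEq A B⟩ = ⟨Γ', .tyEq A' B'⟩ ∧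
      φ.toFun ⟨E ++ A :: Γ, b⟩ = ⟨E' ++ A' :: Γ', b'⟩ ∧
      φ.toFun ⟨E ++ B :: Γ, b⟩ = ⟨E' ++ B' :: Γ', b'⟩ := by
  have := φ.rule _ _ _ (by simpa using ⟨h₁, h₂⟩) (.ctxConv Γ E A B b)
  generalize hK : φ.toFun ⟨E ++ B :: Γ, b⟩ = K, hL : List.map φ.toFun _ = L at this
  cases this with
  | ctxConv Γ' E' A' B' b' =>
    simp at hL
    exact ⟨Γ', E', A', B', b', hL.1, hL.2, rfl⟩

theorem map_convert : ∀ {Γ Δ : Ctx _}, CtxEq T.basic Γ Δ → ∀ (E : Ctx _) (b : Body _),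
    T.Der ⟨E ++ Γ, b⟩ → ∃ E' Γ' Δ' b', φ.toFun ⟨E ++ Γ, b⟩ = ⟨E' ++ Γ', b'⟩ ∧
      φ.toFun ⟨E ++ Δ, b⟩ = ⟨E' ++ Δ', b'⟩ ∧ CtxEq U.basic Γ' Δ' ∧ E'.length = E.length
  | [], [], _, E, b, h => by
    have hl := φ.length h
    generalize φ.toFun ⟨E ++ [], b⟩ = K at hl ⊢
    obtain ⟨E', b'⟩ := K
    exact ⟨E', [], [], b', by simp, by simp, trivial, by simpa using hl⟩
  | A :: Γ, B :: Δ, ⟨h₁, h₂⟩, E, b, h => by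
    obtain ⟨Γ₁, E₁, A₁, B₁, b₁, e₁, e₂, e₃⟩ := φ.map_ctxConv h₂ h
    have h₃ : T.Der ⟨E ++ B :: Γ, b⟩ := .of_rule₂ (.ctxConv Γ E A B b) h₂ h
    obtain ⟨E₂, Γ₂, Δ₂, b₂, k₁, k₂, k₃, k₄⟩ := map_convert h₁ (E ++ [B]) b (by simpa using h₃)
    have l₁ := φ.length h₂
    have l₃ := φ.length h₃
    have d₂ := φ.derivable _ h₂
    simp only [List.append_assoc, List.cons_append, List.nil_append] at k₁ k₂
    rw [e₁] at l₁ d₂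
    rw [e₃] at k₁ l₃
    simp only [Judgement.mk.injEq] at k₁
    obtain ⟨k₁, rfl⟩ := k₁
    have l₄ := congrArg List.length k₁
    simp at l₁ l₃ l₄ k₄
    have k₁' : (E₁ ++ [B₁]) ++ Γ₁ = E₂ ++ Γ₂ := by simpa using k₁
    obtain ⟨rfl, rfl⟩ := List.append_inj k₁' (by simp; omega)
    refine ⟨E₁, A₁ :: Γ₁, B₁ :: Δ₂, b₁, e₂, by simpa using k₂, ⟨k₃, d₂⟩, by omega⟩

/-- Interpretations preserve `≡`. -/
theorem map_cong {J K : T.J} (hJ : T.Der J) (hK : T.Der K) (h : Cong T.basic J K) :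
    Cong U.basic (φ.toFun J) (φ.toFun K) := by
  obtain ⟨Γ, b⟩ := J
  obtain ⟨Δ, c⟩ := K
  cases b <;> cases c <;> try exact h.elim
  · rename_i A B
    obtain ⟨h₁, h₂⟩ := h
    have d := φ.derivable _ h₂
    obtain ⟨Γ', A', B', e₁, e₂, e₃⟩ := φ.map_tyEq h₂
    obtain ⟨E, Γ₁, Δ₁, b, k₁, k₂, k₃, k₄⟩ := φ.map_convert h₁ [] (.ty B)
      (h₂.boundary _ (by simp [Judgement.boundary]))
    obtain rfl := List.length_eq_zero_iff.1 k₄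
    simp only [List.nil_append] at k₁ k₂
    rw [e₃] at k₁
    rw [e₁] at d
    simp only [Judgement.mk.injEq] at k₁
    obtain ⟨rfl, rfl⟩ := k₁
    rw [e₂, k₂]
    exact ⟨k₃, d⟩
  · rename_i s A t B
    obtain ⟨⟨h₁, h₂⟩, h₃⟩ := h
    have d₂ := φ.derivable _ h₂
    have d₃ := φ.derivable _ h₃
    obtain ⟨Γ', A', B', e₁, e₂, e₃⟩ := φ.map_tyEq h₂
    obtain ⟨Γ'', s', t', A'', f₁, f₂, f₃⟩ := φ.map_tmEq h₃
    have hs : T.Der ⟨Γ, .tm s A⟩ := hJ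
    have ht : T.Der ⟨Γ, .tm t A⟩ := h₃.boundary _ (by simp [Judgement.boundary])
    obtain ⟨Γ₃, s₃, A₃, g₁, g₂⟩ := φ.map_tm hs
    rw [f₂] at g₁
    rw [e₂] at g₂
    simp only [Judgement.mk.injEq, Body.tm.injEq, Body.ty.injEq] at g₁ g₂
    obtain ⟨rfl, rfl, rfl⟩ := g₁
    obtain ⟨rfl, rfl⟩ := g₂
    have r := φ.rule _ _ _ (by simpa using ⟨h₂, ht⟩) (.tmConv Γ A B t)
    simp only [List.map_cons, List.map_nil, e₁, f₃] at r
    obtain ⟨E, Γ₁, Δ₁, b, k₁, k₂, k₃, k₄⟩ := φ.map_convert h₁ [] (.tm t B)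
      (.of_rule₂ (.tmConv Γ A B t) h₂ ht)
    obtain rfl := List.length_eq_zero_iff.1 k₄
    simp only [List.nil_append] at k₁ k₂
    rw [k₁] at r
    rw [e₁] at d₂
    rw [f₁] at d₃
    cases r
    rw [f₂, k₂]
    exact ⟨⟨k₃, d₂⟩, d₃⟩

/-- Interpretations are identified when they agree up to `≡` on all derived type judgements and
all derived term judgements. -/
def setoid (T U : WGAT.{u}) : Setoid (Interpretation T U) where
  r φ ψ := ∀ J, T.Der J → J.body.kind = .ty ∨ J.body.kind = .tm →
    Cong U.basic (φ.toFun J) (ψ.toFun J)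
  iseqv :=
    { refl := fun φ J hJ hk => Cong.refl (φ.derivable J hJ) (by rwa [φ.kind J hJ])
      symm := fun h J hJ hk => (h J hJ hk).symm
      trans := fun h k J hJ hk => (h J hJ hk).trans (k J hJ hk) }

end Interpretation

instance : Category.{u} WGAT.{u} where
  Hom T U := Quotient (Interpretation.setoid T U)
  id T := Quotient.mk _ (Interpretation.id T)
  comp {T U V} := Quotient.map₂ Interpretation.comp (by
    intro φ φ' h ψ ψ' k J hJ hk
    exact (ψ.map_cong (φ.derivable J hJ) (φ'.derivable J hJ) (h J hJ hk)).trans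
      (k _ (φ'.derivable J hJ) (by rwa [φ'.kind J hJ])))
  id_comp := by rintro T U ⟨φ⟩; rfl
  comp_id := by rintro T U ⟨φ⟩; rfl
  assoc := by rintro T U V X ⟨φ⟩ ⟨ψ⟩ ⟨χ⟩; rfl

end WGAT

/-! ### Type-and-term structures -/

/-- The vertices of the graph generating the category `ℍ`: the vertex `ty n` is the object written
`n + 1`, and the vertex `tm n` the object written `(n + 1)_t`.  (So `n` is a length of contexts,
and `n + 1` a degree.) -/
inductive HVertex : Type
  | ty (n : ℕ)
  | tm (n : ℕ)

/-- The edges `n ⟶ n + 1` and `n ⟶ n_t`. -/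
inductive HVertex.Edge : HVertex → HVertex → Type
  | succ (n : ℕ) : HVertex.Edge (.ty n) (.ty (n + 1))
  | term (n : ℕ) : HVertex.Edge (.ty n) (.tm n)

instance : Quiver HVertex where
  Hom := HVertex.Edge

/-- The category `ℍ`, freely generated by the graph above. -/
abbrev HCat : Type := Paths HVertex

/-- Type-and-term structures. -/
abbrev TTStr : Type (u + 1) := HCatᵒᵖ ⥤ Type u

namespace TTStr

/-- The type-and-term structure with given elements and given boundary maps. -/
def mk (X : HVertex → Type u) (d : ∀ n, X (.ty (n + 1)) → X (.ty n))
    (dt : ∀ n, X (.tm n) → X (.ty n)) : TTStr.{u} :=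
  (Paths.lift (C := (Type u)ᵒᵖ)
    { obj := fun v => op (X v)
      map := fun {v w} (e : HVertex.Edge v w) => match v, w, e with
        | _, _, .succ n => (TypeCat.ofHom (d n)).op
        | _, _, .term n => (TypeCat.ofHom (dt n)).op }).leftOp

/-- Naturality of transformations of presheaves on a free category may be checked on generators. -/
def pathsNatTrans {V : Type u₁} [Quiver.{v₁} V] {D : Type u₂} [Category.{v₂} D]
    {F G : (Paths V)ᵒᵖ ⥤ D} (app : ∀ v : Paths V, F.obj (op v) ⟶ G.obj (op v))
    (h : ∀ {v w : V} (e : v ⟶ w), F.map ((Paths.of V).map e).op ≫ app ((Paths.of V).obj v) =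
      app ((Paths.of V).obj w) ≫ G.map ((Paths.of V).map e).op) : F ⟶ G where
  app v := app v.unop
  naturality := by
    suffices H : ∀ {a b : Paths V} (p : a ⟶ b), F.map p.op ≫ app a = app b ≫ G.map p.op by
      intro a b p
      exact H p.unop
    intro a b p
    induction p using Paths.induction with
    | id => simp
    | comp p q ih => rw [op_comp, F.map_comp, G.map_comp, Category.assoc, ih, reassoc_of% (h q)]

/-- A map of type-and-term structures is a family of functions commuting with the boundary maps. -/
def homMk {X Y : HVertex → Type u} {d : ∀ n, X (.ty (n + 1)) → X (.ty n)}
    {dt : ∀ n, X (.tm n) → X (.ty n)} {d' : ∀ n, Y (.ty (n + 1)) → Y (.ty n)}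
    {dt' : ∀ n, Y (.tm n) → Y (.ty n)} (f : ∀ v, X v → Y v)
    (hd : ∀ n x, f _ (d n x) = d' n (f _ x)) (hdt : ∀ n x, f _ (dt n x) = dt' n (f _ x)) :
    mk X d dt ⟶ mk Y d' dt' :=
  pathsNatTrans (F := mk X d dt) (G := mk Y d' dt') (fun v => TypeCat.ofHom (f v)) (by
    intro v w e
    ext x
    change HVertex.Edge v w at e
    cases e with
    | succ n => exact hd n x
    | term n => exact hdt n x)

end TTStr

/-! ### The forgetful functor -/

namespace WGAT

/-- The kind of judgement which corresponds to a vertex. -/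
def vKind : HVertex → Kind
  | .ty _ => .ty
  | .tm _ => .tm

/-- The length of context which corresponds to a vertex. -/
def vLen : HVertex → ℕ
  | .ty n => n
  | .tm n => n

theorem vKind_cases : ∀ v, vKind v = .ty ∨ vKind v = .tm
  | .ty _ => .inl rfl
  | .tm _ => .inr rfl

/-- The derived type judgements, respectively term judgements, in a context of length `n`. -/
def El (T : WGAT.{u}) (v : HVertex) : Type u :=
  { J : T.J // T.Der J ∧ J.body.kind = vKind v ∧ J.ctx.length = vLen v }

/-- The congruence `≡` as an equivalence relation on derived judgements. -/
def elSetoid (T : WGAT.{u}) (v : HVertex) : Setoid (T.El v) where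
  r J K := Cong T.basic J.1 K.1
  iseqv :=
    { refl := fun J => Cong.refl J.2.1 (by rw [J.2.2.1]; exact vKind_cases v)
      symm := fun h => h.symm
      trans := fun h k => h.trans k }

end WGAT

/-- The judgement which is the boundary of a type judgement of degree `> 1` or of a term judgement
(for any other judgement, the value is not used). -/
def Judgement.bd {C : Type u} (J : Judgement C) : Judgement C := J.boundary.headD J

namespace WGAT

theorem exists_of_kind_ty_succ {C : Type u} {J : Judgement C} {n : ℕ} (h₁ : J.body.kind = .ty)
    (h₂ : J.ctx.length = n + 1) : ∃ A Γ B, J = ⟨A :: Γ, .ty B⟩ ∧ Γ.length = n := by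
  obtain ⟨Γ, b⟩ := J
  cases Γ with
  | nil => simp at h₂
  | cons A Γ =>
    cases b <;> simp [Body.kind] at h₁
    exact ⟨A, Γ, _, rfl, by simpa using h₂⟩

theorem exists_of_kind_tm {C : Type u} {J : Judgement C} (h₁ : J.body.kind = .tm) :
    ∃ Γ t A, J = ⟨Γ, .tm t A⟩ := by
  obtain ⟨Γ, b⟩ := J
  cases b <;> simp [Body.kind] at h₁
  exact ⟨_, _, _, rfl⟩

/-- The boundary of a derived type judgement of degree `> 1`. -/
def bdTy (T : WGAT.{u}) (n : ℕ) (J : T.El (.ty (n + 1))) : T.El (.ty n) :=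
  ⟨J.1.bd, by
    obtain ⟨J, h, h₁, h₂⟩ := J
    obtain ⟨A, Γ, B, rfl, hl⟩ := exists_of_kind_ty_succ h₁ h₂
    exact ⟨h.boundary _ (by simp [Judgement.boundary, Judgement.bd]), rfl, hl⟩⟩

/-- The boundary of a derived term judgement. -/
def bdTm (T : WGAT.{u}) (n : ℕ) (J : T.El (.tm n)) : T.El (.ty n) :=
  ⟨J.1.bd, by
    obtain ⟨J, h, h₁, h₂⟩ := J
    obtain ⟨Γ, t, A, rfl⟩ := exists_of_kind_tm h₁
    exact ⟨h.boundary _ (by simp [Judgement.boundary, Judgement.bd]), rfl, h₂⟩⟩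

/-- The type-and-term structure of derived type judgements and derived term judgements modulo `≡`. -/
def forgetObj (T : WGAT.{u}) : TTStr.{u} :=
  TTStr.mk (fun v => Quotient (T.elSetoid v))
    (fun n => Quotient.map (T.bdTy n) (by
      rintro ⟨J, hJ, h₁, h₂⟩ ⟨K, hK, k₁, k₂⟩ h
      obtain ⟨A, Γ, B, rfl, hl⟩ := exists_of_kind_ty_succ h₁ h₂
      obtain ⟨A', Γ', B', rfl, hl'⟩ := exists_of_kind_ty_succ k₁ k₂
      exact And.left h))
    (fun n => Quotient.map (T.bdTm n) (by
      rintro ⟨J, hJ, h₁, h₂⟩ ⟨K, hK, k₁, k₂⟩ h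
      obtain ⟨Γ, t, A, rfl⟩ := exists_of_kind_tm h₁
      obtain ⟨Γ', t', A', rfl⟩ := exists_of_kind_tm k₁
      exact And.left h))

/-- The action of an interpretation on derived judgements. -/
def Interpretation.mapEl {T U : WGAT.{u}} (φ : Interpretation T U) (v : HVertex) (J : T.El v) :
    U.El v :=
  ⟨φ.toFun J.1, φ.derivable _ J.2.1, (φ.kind _ J.2.1).trans J.2.2.1,
    (φ.length J.2.1).trans J.2.2.2⟩

/-- The action of an equivalence class of interpretations on equivalence classes of judgements:
`[φ]` sends `[J]` to `[φ(J)]`. -/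
def mapClass {T U : WGAT.{u}} (f : T ⟶ U) (v : HVertex) :
    Quotient (T.elSetoid v) → Quotient (U.elSetoid v) :=
  Quotient.map₂ (fun φ J => Interpretation.mapEl φ v J) (by
    intro φ ψ h J K k
    exact (φ.map_cong J.2.1 K.2.1 k).trans
      (h _ K.2.1 (by rw [K.2.2.1]; exact vKind_cases v))) f

end WGAT


namespace WGAT

theorem Interpretation.bd_ty {T U : WGAT.{u}} (φ : Interpretation T U) (n : ℕ)
    (J : T.El (.ty (n + 1))) : φ.mapEl _ (T.bdTy n J) = U.bdTy n (φ.mapEl _ J) := by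
  obtain ⟨J, h, h₁, h₂⟩ := J
  apply Subtype.ext
  have hb := φ.boundary _ h
  obtain ⟨A, Γ, B, rfl, hl⟩ := exists_of_kind_ty_succ h₁ h₂
  simp [Judgement.boundary] at hb
  simp [Interpretation.mapEl, bdTy, Judgement.bd, hb, Judgement.boundary]

theorem Interpretation.bd_tm {T U : WGAT.{u}} (φ : Interpretation T U) (n : ℕ)
    (J : T.El (.tm n)) : φ.mapEl _ (T.bdTm n J) = U.bdTm n (φ.mapEl _ J) := by
  obtain ⟨J, h, h₁, h₂⟩ := J
  apply Subtype.ext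
  have hb := φ.boundary _ h
  obtain ⟨Γ, t, A, rfl⟩ := exists_of_kind_tm h₁
  simp [Judgement.boundary] at hb
  simp [Interpretation.mapEl, bdTm, Judgement.bd, hb, Judgement.boundary]

/-- The forgetful functor from `{w}`-GATs to type-and-term structures. -/
def forget : WGAT.{u} ⥤ TTStr.{u} where
  obj T := T.forgetObj
  map {T U} f := TTStr.homMk (mapClass f)
    (by
      obtain ⟨φ⟩ := f
      rintro n ⟨J⟩
      exact congrArg (Quotient.mk _) (φ.bd_ty n J))
    (by
      obtain ⟨φ⟩ := f
      rintro n ⟨J⟩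
      exact congrArg (Quotient.mk _) (φ.bd_tm n J))
  map_id T := by
    ext v x
    obtain ⟨J⟩ := x
    rfl
  map_comp {T U V} f g := by
    ext v x
    obtain ⟨φ⟩ := f
    obtain ⟨ψ⟩ := g
    obtain ⟨J⟩ := x
    rfl

end WGAT

/-! ### Heaps -/

/-- Min-heaps of size `n`: functions `φ : [0,n] → [0,n]` with `φ 0 = 0`
and `φ i < i` for all `i ∈ [1,n]`. -/
def Heap (n : ℕ) : Type :=
  { φ : Fin (n + 1) → Fin (n + 1) // φ 0 = 0 ∧ ∀ i, i ≠ 0 → φ i < i }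

namespace Heap

variable {n : ℕ} (φ : Heap n)

/-- The depth of `i`: the number of elements of `{φ(i), φ²(i), …}`. -/
noncomputable def depth (i : Fin (n + 1)) : ℕ :=
  (Set.range fun k : ℕ => φ.1^[k + 1] i).ncard

theorem iterate_le (k : ℕ) (i : Fin (n + 1)) : φ.1^[k] i ≤ i := by
  induction k with
  | zero => exact le_rfl
  | succ k ih =>
    rw [Function.iterate_succ_apply']
    by_cases h : φ.1^[k] i = 0
    · rw [h, φ.2.1]; exact Fin.zero_le _
    · exact (φ.2.2 _ h).le.trans ih

theorem depth_of_eq_zero {i : Fin (n + 1)} (h : φ.1 i = 0) : φ.depth i = 1 := by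
  have : (Set.range fun k : ℕ => φ.1^[k + 1] i) = {0} := by
    ext j
    constructor
    · rintro ⟨k, rfl⟩
      simp only [Function.iterate_succ_apply, h]
      exact Function.iterate_fixed φ.2.1 k
    · rintro rfl
      exact ⟨0, h⟩
  rw [depth, this, Set.ncard_singleton]

theorem depth_of_ne_zero {i : Fin (n + 1)} (h : φ.1 i ≠ 0) :
    φ.depth i = φ.depth (φ.1 i) + 1 := by
  have : (Set.range fun k : ℕ => φ.1^[k + 1] i) =
      insert (φ.1 i) (Set.range fun k : ℕ => φ.1^[k + 1] (φ.1 i)) := by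
    ext j
    constructor
    · rintro ⟨k, rfl⟩
      cases k with
      | zero => exact .inl rfl
      | succ k => exact .inr ⟨k, rfl⟩
    · rintro (rfl | ⟨k, rfl⟩)
      · exact ⟨0, rfl⟩
      · exact ⟨k + 1, rfl⟩
  rw [depth, this, Set.ncard_insert_of_notMem, depth]
  rintro ⟨k, hk⟩
  have h₁ := φ.iterate_le k (φ.1 (φ.1 i))
  have h₂ := φ.2.2 _ h
  simp only [Function.iterate_succ_apply] at hk
  rw [hk] at h₁
  exact absurd h₂ (not_lt.2 h₁)

/-- For a heap `φ` and a set `S` of its nodes, the type-and-term structure whose type-elements of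
degree `m` are the nodes `i ∈ [1,n]` of depth `m`, with boundary `φ i`, and which has exactly
one term-element over each node in `S` and none over the others. -/
noncomputable def shape (S : Set (Fin (n + 1))) : TTStr.{u} :=
  TTStr.mk
    (fun
      | .ty m => ULift.{u} { i : Fin (n + 1) // i ≠ 0 ∧ φ.depth i = m + 1 }
      | .tm m => ULift.{u} { i : Fin (n + 1) // i ∈ S ∧ i ≠ 0 ∧ φ.depth i = m + 1 })
    (fun m i => ⟨φ.1 i.down.1, by
      obtain ⟨⟨i, h₀, h⟩⟩ := i
      have hi : φ.1 i ≠ 0 := fun h' => by simp [φ.depth_of_eq_zero h'] at h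
      exact ⟨hi, by simpa [φ.depth_of_ne_zero hi] using h⟩⟩)
    (fun m i => ⟨i.down.1, i.down.2.2⟩)

/-- The type-and-term structure `[φ]`. -/
noncomputable def tyShape : TTStr.{u} := φ.shape ∅

/-- The type-and-term structure `[φ]ₜ`: a new term-element is adjoined to `[φ]` over the node `n`. -/
noncomputable def tmShape : TTStr.{u} := φ.shape {Fin.last n}

end Heap

/-! ### Strongly cartesian monads -/

section Categories

/-- The functor `X ↦ ∑ i, Hom(P i, X)`, a coproduct of representable functors. -/
def sumRepresentable {D : Type u₁} [Category.{u} D] {ι : Type} (P : ι → D) : D ⥤ Type u where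
  obj X := Σ i, (P i ⟶ X)
  map f := TypeCat.ofHom fun x => ⟨x.1, x.2 ≫ f⟩

variable {D : Type u₁} [Category.{v₁} D] {E : Type u₂} [Category.{v₂} E]

/-- `F` is local right adjoint if all functors `F / X : D / X ⥤ E / F X` are right adjoints. -/
def IsLocalRightAdjoint (F : D ⥤ E) : Prop :=
  ∀ X : D, (Over.post (X := X) F).IsRightAdjoint

/-- A monad is cartesian if it preserves pullbacks and all naturality squares of its unit
and of its multiplication are pullbacks. -/
structure IsCartesianMonad (T : Monad D) : Prop where
  preservesPullbacks : PreservesLimitsOfShape WalkingCospan T.toFunctor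
  unit : ∀ {X Y : D} (f : X ⟶ Y),
    IsPullback (T.η.app X) f (T.map f) (T.η.app Y)
  mult : ∀ {X Y : D} (f : X ⟶ Y),
    IsPullback (T.μ.app X) (T.map (T.map f)) (T.map f) (T.μ.app Y)

/-- A monad is strongly cartesian if it is cartesian and local right adjoint. -/
structure IsStronglyCartesianMonad (T : Monad D) : Prop where
  cartesian : IsCartesianMonad T
  localRightAdjoint : IsLocalRightAdjoint T.toFunctor

end Categories

end WeakeningMonad

/-! The left adjoint sends a presheaf X to the theory `free X`, whose constants are the elements of
X, each declared in the context formed by its iterated boundaries (`declCtx`). This theory has no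
equality axioms, and there is no substitution. Hence every derivable equality is an identity of
expressions (`okJ_of_derivable`), and the congruence is trivial (`eq_of_cong`). Every type in a
derivable context is a constant a applied to a list l of variables. Either a has no boundary and l
is empty, or l = l' ++ [j], where the variable j is declared with type a'(l') and a' is the boundary
of a. Conversely, every context of this form is derivable, since each of its types is the generic
declaration of its constant transported along weakenings (`OkCtx.exists_thin`, `Thin.derivable`).

For the universal property, a map from X to the underlying presheaf of U is realised by
representatives whose boundaries match strictly (`tyRep`), and these extend to all expressions
(`lift`). Uniqueness holds because weakening is the only rule that acts nontrivially on the type and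
term judgements of `free X` (`cong_of_gen`).

A context of the above form is a labelled heap: the parent of a variable is the last argument of its
type, and the constants label the nodes compatibly with boundaries, which amounts to a map from the
heap to X. A term judgement adds one term-element over the label of the last node. This gives
`bijective_toTy` and `bijective_toTm`. A functor into presheaves whose components are coproducts of
representables preserves pullbacks. It is also local right adjoint: over a representable, the value
of the left adjoint is the map out of the representing object of one summand, and colimits do the
rest.

For the unit, a judgement whose relabelling is generic has all variables as arguments of its type,
which forces its whole context to be generic. For the multiplication, a context over WX has types
b(l) with b an extended context over X, and flattening replaces b(l) by the last type of b, renamed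
along l. The whole of b is then the restriction of the flattened context to the levels in l and the
current one (`along_mult`). So b can be recovered from its image over Y, which gives the variables,
and from the flattened context over X, which gives the labels. -/

namespace WeakeningMonad

/-! ### Scoping and renaming -/

section Scoping

variable {C : Type u}

/-- All variables of the expression have level less than `n`. -/
def Expr.Scoped (n : ℕ) : Expr C → Prop
  | .var i => i < n
  | .app _ _ args => ∀ j, (args j).Scoped n

/-- All variables of the body have level less than `n`. -/
def Body.Scoped (n : ℕ) : Body C → Prop
  | .ty T => T.Scoped n
  | .tm t T => t.Scoped n ∧ T.Scoped n
  | .tyEq T T' => T.Scoped n ∧ T'.Scoped n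
  | .tmEq t t' T => t.Scoped n ∧ t'.Scoped n ∧ T.Scoped n

theorem Expr.rename_rename (f g : ℕ → ℕ) : ∀ E : Expr C,
    (E.rename f).rename g = E.rename fun i => g (f i)
  | .var _ => rfl
  | .app c k args => by simp [Expr.rename, fun j => Expr.rename_rename f g (args j)]

theorem Expr.rename_congr {n : ℕ} {f g : ℕ → ℕ} (h : ∀ i < n, f i = g i) : ∀ {E : Expr C},
    E.Scoped n → E.rename f = E.rename g
  | .var i, hE => congrArg _ (h i hE)
  | .app c k args, hE => by simp [Expr.rename, fun j => Expr.rename_congr h (hE j)]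

theorem Expr.rename_id : ∀ E : Expr C, E.rename (fun i => i) = E
  | .var _ => rfl
  | .app c k args => by simp [Expr.rename, fun j => Expr.rename_id (args j)]

theorem Expr.rename_eq_self {n : ℕ} {f : ℕ → ℕ} (h : ∀ i < n, f i = i) {E : Expr C}
    (hE : E.Scoped n) : E.rename f = E :=
  (Expr.rename_congr h hE).trans E.rename_id

theorem Expr.Scoped.rename {n m : ℕ} {f : ℕ → ℕ} (h : ∀ i < n, f i < m) : ∀ {E : Expr C},
    E.Scoped n → (E.rename f).Scoped m
  | .var i, hE => h i hE
  | .app _ _ _, hE => fun j => (hE j).rename h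

theorem Body.Scoped.rename {n m : ℕ} {f : ℕ → ℕ} (h : ∀ i < n, f i < m) {b : Body C}
    (hb : b.Scoped n) : (b.rename f).Scoped m := by
  cases b with
  | ty T => exact Expr.Scoped.rename h hb
  | tm t T => exact ⟨hb.1.rename h, hb.2.rename h⟩
  | tyEq T T' => exact ⟨hb.1.rename h, hb.2.rename h⟩
  | tmEq t t' T => exact ⟨hb.1.rename h, hb.2.1.rename h, hb.2.2.rename h⟩

theorem Body.rename_rename (f g : ℕ → ℕ) (b : Body C) :
    (b.rename f).rename g = b.rename fun i => g (f i) := by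
  cases b <;> simp [Body.rename, Expr.rename_rename]

theorem Body.rename_id (b : Body C) : b.rename (fun i => i) = b := by
  cases b <;> simp [Body.rename, Expr.rename_id]

theorem skip_lt {k i n : ℕ} (h : i < n) : skip k i < n + 1 := by
  unfold skip; split <;> omega

theorem skip_of_lt {k i : ℕ} (h : i < k) : skip k i = i := if_pos h

theorem skip_of_le {k i : ℕ} (h : k ≤ i) : skip k i = i + 1 := if_neg (not_lt.2 h)

/-- Each declaration of the context only uses variables declared before. -/
def CtxScoped : Ctx C → Prop
  | [] => True
  | T :: Γ => CtxScoped Γ ∧ T.Scoped Γ.length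

theorem CtxScoped.replace {Γ : Ctx C} {S T : Expr C} (hT : T.Scoped Γ.length) :
    ∀ {Δ : Ctx C}, CtxScoped (Δ ++ S :: Γ) → CtxScoped (Δ ++ T :: Γ)
  | [], h => ⟨h.1, hT⟩
  | _ :: _, h => ⟨CtxScoped.replace hT h.1, by simpa using h.2⟩

theorem CtxScoped.insert {Γ : Ctx C} {T : Expr C} (hT : T.Scoped Γ.length) :
    ∀ {Δ : Ctx C}, CtxScoped (Δ ++ Γ) →
      CtxScoped (Δ.map (Expr.rename (skip Γ.length)) ++ T :: Γ)
  | [], h => ⟨h, hT⟩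
  | _ :: _, h => ⟨CtxScoped.insert hT h.1, by
      have := h.2.rename (fun _ => skip_lt (k := Γ.length))
      simpa [← add_assoc] using this⟩

/-- Derived judgements are well-scoped. -/
theorem Derivable.scoped {Λ : Set (Judgement C)}
    (hty : ∀ Γ T, (⟨Γ, .ty T⟩ : Judgement C) ∈ Λ → T.Scoped Γ.length)
    (htm : ∀ Γ t T, (⟨Γ, .tm t T⟩ : Judgement C) ∈ Λ → t.Scoped Γ.length)
    {J : Judgement C} (hJ : Derivable Λ J) : CtxScoped J.ctx ∧ J.body.Scoped J.ctx.length := by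
  induction hJ with
  | @basic J hJ h ih =>
    obtain ⟨Γ, b⟩ := J
    cases b with
    | ty T =>
      cases Γ with
      | nil => exact ⟨trivial, hty _ _ hJ⟩
      | cons S Γ =>
        exact ⟨ih ⟨Γ, .ty S⟩ (by simp [Judgement.boundary]), hty _ _ hJ⟩
    | tm t T =>
      have := ih ⟨Γ, .ty T⟩ (by simp [Judgement.boundary])
      exact ⟨this.1, htm _ _ _ hJ, this.2⟩
    | tyEq T T' =>
      have h₁ := ih ⟨Γ, .ty T⟩ (by simp [Judgement.boundary])
      have h₂ := ih ⟨Γ, .ty T'⟩ (by simp [Judgement.boundary])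
      exact ⟨h₁.1, h₁.2, h₂.2⟩
    | tmEq t t' T =>
      have h₁ := ih ⟨Γ, .tm t T⟩ (by simp [Judgement.boundary])
      have h₂ := ih ⟨Γ, .tm t' T⟩ (by simp [Judgement.boundary])
      exact ⟨h₁.1, h₁.2.1, h₂.2⟩
  | rule hr h ih =>
    cases hr with
    | tmRefl Γ t T =>
      have := ih _ (List.mem_cons_self ..)
      exact ⟨this.1, this.2.1, this.2⟩
    | tmSymm Γ t₁ t₂ T =>
      have := ih _ (List.mem_cons_self ..)
      exact ⟨this.1, this.2.2.1, this.2.1, this.2.2.2⟩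
    | tmTrans Γ t₁ t₂ t₃ T =>
      have h₁ := ih _ (List.mem_cons_self ..)
      have h₂ := ih _ (List.mem_cons_of_mem _ (List.mem_cons_self ..))
      exact ⟨h₁.1, h₁.2.1, h₂.2.2⟩
    | tyRefl Γ T =>
      have := ih _ (List.mem_cons_self ..)
      exact ⟨this.1, this.2, this.2⟩
    | tySymm Γ T₁ T₂ =>
      have := ih _ (List.mem_cons_self ..)
      exact ⟨this.1, this.2.2, this.2.1⟩
    | tyTrans Γ T₁ T₂ T₃ =>
      have h₁ := ih _ (List.mem_cons_self ..)
      have h₂ := ih _ (List.mem_cons_of_mem _ (List.mem_cons_self ..))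
      exact ⟨h₁.1, h₁.2.1, h₂.2.2⟩
    | tmConv Γ T₁ T₂ t =>
      have h₁ := ih _ (List.mem_cons_self ..)
      have h₂ := ih _ (List.mem_cons_of_mem _ (List.mem_cons_self ..))
      exact ⟨h₁.1, h₂.2.1, h₁.2.2⟩
    | tmEqConv Γ T₁ T₂ t₁ t₂ =>
      have h₁ := ih _ (List.mem_cons_self ..)
      have h₂ := ih _ (List.mem_cons_of_mem _ (List.mem_cons_self ..))
      exact ⟨h₁.1, h₂.2.1, h₂.2.2.1, h₁.2.2⟩
    | ctxConv Γ Δ T₁ T₂ b =>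
      have h₁ := ih _ (List.mem_cons_self ..)
      have h₂ := ih _ (List.mem_cons_of_mem _ (List.mem_cons_self ..))
      exact ⟨h₂.1.replace h₁.2.2, by simpa using h₂.2⟩
    | weakening Γ Δ T b =>
      have h₁ := ih _ (List.mem_cons_self ..)
      have h₂ := ih _ (List.mem_cons_of_mem _ (List.mem_cons_self ..))
      refine ⟨h₂.1.insert h₁.2, ?_⟩
      have := h₂.2.rename (fun _ => skip_lt (k := Γ.length))
      simpa [← add_assoc] using this

end Scoping

/-- A basic type or term judgement declares a constant, applied exactly to the levels below the
length of its context. Basic equalities inherit scoping from their boundaries. -/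
theorem WGAT.Der.scoped {T : WGAT.{u}} {J : T.J} (hJ : T.Der J) :
    CtxScoped J.ctx ∧ J.body.Scoped J.ctx.length := by
  refine Derivable.scoped ?_ ?_ hJ
  · intro Γ A h
    rcases T.basic_cases _ h with ⟨c, Δ, e⟩ | ⟨c, Δ, B, e⟩ | e | e
    · simp only [tyDecl, Judgement.mk.injEq, Body.ty.injEq] at e
      obtain ⟨rfl, rfl⟩ := e
      exact fun j => j.2
    all_goals simp [tmDecl, Body.kind] at e
  · intro Γ t A h
    rcases T.basic_cases _ h with ⟨c, Δ, e⟩ | ⟨c, Δ, B, e⟩ | e | e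
    · simp [tyDecl] at e
    · simp only [tmDecl, Judgement.mk.injEq, Body.tm.injEq] at e
      obtain ⟨rfl, rfl, rfl⟩ := e
      exact fun j => j.2
    all_goals simp [Body.kind] at e

/-! ### Thinnings -/

section Thin

variable {C : Type u} {Λ : Set (Judgement C)}

/-- The context is derivable. -/
def DerCtx (Λ : Set (Judgement C)) : Ctx C → Prop
  | [] => True
  | T :: Γ => Derivable Λ ⟨Γ, .ty T⟩

theorem Derivable.derCtx_ty {Γ : Ctx C} {T : Expr C} (h : Derivable Λ ⟨Γ, .ty T⟩) :
    DerCtx Λ Γ := by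
  cases Γ with
  | nil => trivial
  | cons S Γ => exact h.boundary _ (by simp [Judgement.boundary])

theorem DerCtx.tail {Γ : Ctx C} {T : Expr C} (h : DerCtx Λ (T :: Γ)) : DerCtx Λ Γ :=
  Derivable.derCtx_ty h

/-- `Thin Γ Δ θ`: the context `Γ` is obtained from `Δ` by omitting declarations; `θ` is the
resulting renaming of variables. -/
inductive Thin : Ctx C → Ctx C → (ℕ → ℕ) → Prop
  | nil : Thin [] [] fun i => i
  | drop {Γ Δ : Ctx C} {θ : ℕ → ℕ} (S : Expr C) (h : Thin Γ Δ θ) :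
      Thin Γ (S :: Δ) fun i => skip Δ.length (θ i)
  | keep {Γ Δ : Ctx C} {θ : ℕ → ℕ} (T : Expr C) (h : Thin Γ Δ θ) :
      Thin (T :: Γ) (T.rename θ :: Δ) θ

/-- The constructor `keep` leaves `θ` unchanged. This is legitimate because past the end of the
context `θ` is a shift, so the new variable goes to the new variable. -/
theorem Thin.apply_add {Γ Δ : Ctx C} {θ : ℕ → ℕ} (h : Thin Γ Δ θ) :
    ∀ i, θ (Γ.length + i) = Δ.length + i := by
  induction h with
  | nil => simp
  | drop S h ih =>
    intro i
    simp only [ih i, List.length_cons]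
    rw [skip_of_le (by omega)]
    omega
  | keep T h ih =>
    intro i
    rw [List.length_cons, List.length_cons, add_right_comm, add_assoc, ih]
    omega

/-- Derivations may be transported along thinnings. -/
theorem Thin.derivable {Γ Γ' : Ctx C} {θ : ℕ → ℕ} (h : Thin Γ Γ' θ) (hΓ : DerCtx Λ Γ') :
    ∀ (Δ : Ctx C) (b : Body C), Derivable Λ ⟨Δ ++ Γ, b⟩ →
      Derivable Λ ⟨Δ.map (Expr.rename θ) ++ Γ', b.rename θ⟩ := by
  induction h with
  | nil =>
    intro Δ b hb
    have : (Expr.rename fun i => i : Expr C → Expr C) = id := funext Expr.rename_id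
    simpa [this, Body.rename_id] using hb
  | @drop Γ Γ' θ S h ih =>
    intro Δ b hb
    have := Derivable.of_rule₂ (.weakening _ _ _ _) hΓ (ih hΓ.tail Δ b hb)
    simpa [Function.comp_def, Expr.rename_rename, Body.rename_rename] using this
  | @keep Γ Γ' θ T h ih =>
    intro Δ b hb
    -- The kept declaration is absorbed into the tail; for this the statement ranges over all `Δ`.
    have := ih hΓ.tail (Δ ++ [T]) b (by simpa using hb)
    simpa using this

/-! ### Congruence of weakening -/

/-- All equalities witnessing `CtxEq` are derived in the left-hand context. So only weakening by `T`
is performed, and only `T` has to be derivable beforehand. -/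
theorem CtxEq.weaken {Γ Γ' : Ctx C} {T T' : Expr C} (hT : CtxEq Λ (T :: Γ) (T' :: Γ'))
    (hΓ : Γ.length = Γ'.length) (hd : Derivable Λ ⟨Γ, .ty T⟩) :
    ∀ {Δ Δ' : Ctx C}, Δ.length = Δ'.length → CtxEq Λ (Δ ++ Γ) (Δ' ++ Γ') →
      CtxEq Λ (Δ.map (Expr.rename (skip Γ.length)) ++ T :: Γ)
        (Δ'.map (Expr.rename (skip Γ'.length)) ++ T' :: Γ')
  | [], [], _, _ => hT
  | A :: Δ, A' :: Δ', hl, h => by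
    refine ⟨CtxEq.weaken hT hΓ hd (by simpa using hl) h.1, ?_⟩
    rw [← hΓ]
    exact Derivable.of_rule₂ (.weakening _ _ _ _) hd h.2

theorem Cong.weaken {Γ Γ' Δ Δ' : Ctx C} {T T' : Expr C} {b b' : Body C}
    (hT : Cong Λ ⟨Γ, .ty T⟩ ⟨Γ', .ty T'⟩) (hΓ : Γ.length = Γ'.length)
    (hΔ : Δ.length = Δ'.length) (hd : Derivable Λ ⟨Γ, .ty T⟩)
    (hb : Cong Λ ⟨Δ ++ Γ, b⟩ ⟨Δ' ++ Γ', b'⟩) :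
    Cong Λ ⟨Δ.map (Expr.rename (skip Γ.length)) ++ T :: Γ, b.rename (skip Γ.length)⟩
      ⟨Δ'.map (Expr.rename (skip Γ'.length)) ++ T' :: Γ', b'.rename (skip Γ'.length)⟩ := by
  cases b <;> cases b' <;> try exact hb.elim
  · rename_i A A'
    exact CtxEq.weaken hT hΓ hd (Δ := A :: Δ) (Δ' := A' :: Δ') (by simpa using hΔ) hb
  · rename_i t A t' A'
    refine ⟨CtxEq.weaken hT hΓ hd (Δ := A :: Δ) (Δ' := A' :: Δ') (by simpa using hΔ) hb.1, ?_⟩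
    rw [← hΓ]
    exact Derivable.of_rule₂ (.weakening _ _ _ _) hd hb.2

end Thin

/-! ### Levels of contexts, and constants applied to variables -/

section Levels

variable {C : Type u}

/-- The symbol `c` applied to the variables listed in `l`. -/
def Expr.appVars (c : C) (l : List ℕ) : Expr C := .app c l.length fun i => .var (l.get i)

/-- The type of the variable at level `i`. -/
def declAt (Γ : Ctx C) (i : ℕ) : Option (Expr C) := Γ.reverse[i]?

/-- Every comparison of judgements below reduces to this: labels and arguments can be read off an
expression. -/
theorem Expr.appVars_injective {c c' : C} {l l' : List ℕ}
    (h : Expr.appVars c l = Expr.appVars c' l') : c = c' ∧ l = l' := by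
  simp only [Expr.appVars, Expr.app.injEq] at h
  obtain ⟨h₁, h₂, h₃⟩ := h
  refine ⟨h₁, List.ext_get h₂ fun i hi hi' => ?_⟩
  -- The two lengths are generalised to variables so that their equality can be eliminated.
  have key : ∀ {k k' : ℕ} (e : k = k') {a : Fin k → ℕ} {b : Fin k' → ℕ},
      ((fun i => Expr.var (a i)) : Fin k → Expr C) ≍ ((fun i => Expr.var (b i)) : Fin k' → Expr C) →
      ∀ i, a i = b (Fin.cast e i) := by
    rintro k _ rfl a b h i
    have := congrFun (eq_of_heq h) i
    simpa using this
  exact key h₂ h₃ ⟨i, hi⟩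

@[simp]
theorem Expr.rename_appVars (f : ℕ → ℕ) (c : C) (l : List ℕ) :
    (Expr.appVars c l).rename f = Expr.appVars c (l.map f) := by
  have key : ∀ (k : ℕ) (e : k = l.length),
      Expr.app c k (fun i => Expr.var (f (l.get (Fin.cast e i)))) =
      Expr.app c (l.map f).length fun i => .var ((l.map f).get i) := by
    intro k e
    obtain rfl : k = (l.map f).length := by simpa using e
    simp
  exact key _ rfl

theorem Expr.app_var_eq_appVars (c : C) (n : ℕ) :
    Expr.app c n (fun i => .var i) = Expr.appVars c (List.range n) := by
  have key : ∀ (k : ℕ) (e : k = n), Expr.app c n (fun i => .var i) =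
      Expr.app c k fun i : Fin k => .var i := by rintro _ rfl; rfl
  rw [key _ List.length_range]
  simp [Expr.appVars]

theorem Expr.scoped_appVars {n : ℕ} {c : C} {l : List ℕ} (h : ∀ i ∈ l, i < n) :
    (Expr.appVars c l).Scoped n := fun _ => h _ (List.get_mem ..)

theorem declAt_cons (Γ : Ctx C) (T : Expr C) (i : ℕ) :
    declAt (T :: Γ) i = if i = Γ.length then some T else declAt Γ i := by
  unfold declAt
  rw [List.reverse_cons, List.getElem?_append, List.length_reverse]
  split_ifs with h₁ h₂ h₂
  · omega
  · rfl
  · subst h₂; simp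
  · rw [List.getElem?_eq_none (by simp; omega), List.getElem?_eq_none (by simp; omega)]

theorem declAt_cons_length (Γ : Ctx C) (T : Expr C) : declAt (T :: Γ) Γ.length = some T := by
  simp [declAt_cons]

theorem declAt_cons_of_lt {Γ : Ctx C} {T : Expr C} {i : ℕ} (h : i < Γ.length) :
    declAt (T :: Γ) i = declAt Γ i := by
  rw [declAt_cons, if_neg h.ne]

theorem lt_of_declAt {Γ : Ctx C} {i : ℕ} {T : Expr C} (h : declAt Γ i = some T) :
    i < Γ.length := by
  unfold declAt at h
  by_contra h'
  rw [List.getElem?_eq_none (by simpa using h')] at h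
  cases h

theorem exists_declAt {Γ : Ctx C} {i : ℕ} (h : i < Γ.length) : ∃ T, declAt Γ i = some T :=
  ⟨_, List.getElem?_eq_getElem (by simpa using h)⟩

theorem declAt_append {Γ : Ctx C} {i : ℕ} (Δ : Ctx C) (h : i < Γ.length) :
    declAt (Δ ++ Γ) i = declAt Γ i := by
  induction Δ with
  | nil => rfl
  | cons T Δ ih => rw [List.cons_append, declAt_cons_of_lt (by simp; omega), ih]

theorem declAt_map {D : Type u₁} (g : Expr C → Expr D) (Γ : Ctx C) (i : ℕ) :
    declAt (Γ.map g) i = (declAt Γ i).map g := by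
  simp [declAt, ← List.map_reverse]

theorem ext_declAt {Γ Δ : Ctx C} (h : ∀ i, declAt Γ i = declAt Δ i) : Γ = Δ :=
  List.reverse_injective (List.ext_getElem? h)

/-- Every context splits at each of its levels. -/
theorem exists_append_of_declAt : ∀ {Γ : Ctx C} {i : ℕ} {T : Expr C}, declAt Γ i = some T →
    ∃ Δ Γ', Γ = Δ ++ T :: Γ' ∧ Γ'.length = i
  | [], i, T, h => by simp [declAt] at h
  | S :: Γ, i, T, h => by
    rw [declAt_cons] at h
    split_ifs at h with hi
    · obtain rfl := Option.some_injective _ h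
      exact ⟨[], Γ, rfl, hi.symm⟩
    · obtain ⟨Δ, Γ', rfl, h'⟩ := exists_append_of_declAt h
      exact ⟨S :: Δ, Γ', rfl, h'⟩

end Levels

/-! ### Elements of type-and-term structures -/

namespace TTStr

variable (X : TTStr.{u})

/-- The boundary of a type-element. -/
def bdTy (n : ℕ) (A : X.obj (op ((Paths.of _).obj (.ty (n + 1))))) :
    X.obj (op ((Paths.of _).obj (.ty n))) :=
  X.map ((Paths.of _).map (HVertex.Edge.succ n : HVertex.ty n ⟶ HVertex.ty (n + 1))).op A

/-- The boundary of a term-element. -/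
def bdTm (n : ℕ) (A : X.obj (op ((Paths.of _).obj (.tm n)))) :
    X.obj (op ((Paths.of _).obj (.ty n))) :=
  X.map ((Paths.of _).map (HVertex.Edge.term n : HVertex.ty n ⟶ HVertex.tm n)).op A

/-- The type-elements. -/
abbrev TyEl : Type u := Σ n : ℕ, X.obj (op ((Paths.of _).obj (HVertex.ty n)))

/-- The term-elements. -/
abbrev TmEl : Type u := Σ n : ℕ, X.obj (op ((Paths.of _).obj (HVertex.tm n)))

variable {X}

/-- The boundary of a type-element, if there is one. -/
def TyEl.bd : TyEl X → Option (TyEl X)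
  | ⟨0, _⟩ => none
  | ⟨n + 1, A⟩ => some ⟨n, X.bdTy n A⟩

/-- The boundary of a term-element. -/
def TmEl.bd (f : TmEl X) : TyEl X := ⟨f.1, X.bdTm f.1 f.2⟩

/-- The action of a map on type-elements. -/
def TyEl.map {Y : TTStr.{u}} (g : X ⟶ Y) (A : TyEl X) : TyEl Y := ⟨A.1, g.app _ A.2⟩

/-- The action of a map on term-elements. -/
def TmEl.map {Y : TTStr.{u}} (g : X ⟶ Y) (f : TmEl X) : TmEl Y := ⟨f.1, g.app _ f.2⟩

theorem bdTy_app {Y : TTStr.{u}} (g : X ⟶ Y) (n : ℕ)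
    (A : X.obj (op ((Paths.of _).obj (.ty (n + 1))))) :
    g.app _ (X.bdTy n A) = Y.bdTy n (g.app _ A) :=
  NatTrans.naturality_apply g _ A

theorem bdTm_app {Y : TTStr.{u}} (g : X ⟶ Y) (n : ℕ)
    (A : X.obj (op ((Paths.of _).obj (.tm n)))) :
    g.app _ (X.bdTm n A) = Y.bdTm n (g.app _ A) :=
  NatTrans.naturality_apply g _ A

theorem TyEl.bd_map {Y : TTStr.{u}} (g : X ⟶ Y) (A : TyEl X) :
    (A.map g).bd = A.bd.map (TyEl.map g) := by
  obtain ⟨_ | n, A⟩ := A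
  · rfl
  · simp [TyEl.map, TyEl.bd, bdTy_app]

theorem TmEl.bd_map {Y : TTStr.{u}} (g : X ⟶ Y) (f : TmEl X) :
    (f.map g).bd = f.bd.map g :=
  Sigma.ext rfl (heq_of_eq (bdTm_app ..).symm)

theorem TyEl.fst_of_bd {a a' : TyEl X} (h : a.bd = some a') : a.1 = a'.1 + 1 := by
  obtain ⟨_ | n, A⟩ := a
  · simp [TyEl.bd] at h
  · simp only [TyEl.bd, Option.some.injEq] at h
    subst h; rfl

theorem TyEl.fst_of_bd_none {a : TyEl X} (h : a.bd = none) : a.1 = 0 := by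
  obtain ⟨_ | n, A⟩ := a
  · rfl
  · simp [TyEl.bd] at h

/-! ### The free theory on a presheaf -/

/-- The alphabet of the free theory. -/
abbrev Sym (X : TTStr.{u}) : Type u := TyEl X ⊕ TmEl X

/-- The context of the declaration of the type-constant given by a type-element. -/
def declCtx : ∀ (n : ℕ), X.obj (op ((Paths.of _).obj (.ty n))) → Ctx (Sym X)
  | 0, _ => []
  | n + 1, A => .appVars (.inl ⟨n, X.bdTy n A⟩) (List.range n) :: declCtx n (X.bdTy n A)

theorem length_declCtx : ∀ (n : ℕ) (A : X.obj (op ((Paths.of _).obj (.ty n)))),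
    (declCtx n A).length = n
  | 0, _ => rfl
  | n + 1, A => by rw [declCtx, List.length_cons, length_declCtx n]

/-- The context of the declaration of a type-element. -/
def TyEl.ctx (A : TyEl X) : Ctx (Sym X) := declCtx A.1 A.2

theorem TyEl.length_ctx (A : TyEl X) : A.ctx.length = A.1 := length_declCtx _ _

/-- The declaration of a type-element. -/
def TyEl.decl (A : TyEl X) : Expr (Sym X) := .appVars (.inl A) (List.range A.1)

/-- The declaration of a term-element. -/
def TmEl.decl (f : TmEl X) : Expr (Sym X) := .appVars (.inr f) (List.range f.1)

theorem TyEl.ctx_of_bd {A B : TyEl X} (h : A.bd = some B) : A.ctx = B.decl :: B.ctx := by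
  obtain ⟨_ | n, A⟩ := A
  · simp [TyEl.bd] at h
  · simp only [TyEl.bd, Option.some.injEq] at h
    subst h; rfl

theorem TyEl.ctx_of_bd_none {A : TyEl X} (h : A.bd = none) : A.ctx = [] := by
  obtain ⟨_ | n, A⟩ := A
  · rfl
  · simp [TyEl.bd] at h

theorem TyEl.tyDecl_ctx (A : TyEl X) : tyDecl (.inl A) A.ctx = (⟨A.ctx, .ty A.decl⟩ : Judgement (Sym X)) := by
  rw [tyDecl, Expr.app_var_eq_appVars, TyEl.length_ctx, TyEl.decl]

theorem TmEl.tmDecl_ctx (f : TmEl X) : tmDecl (.inr f) f.bd.ctx f.bd.decl =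
    (⟨f.bd.ctx, .tm f.decl f.bd.decl⟩ : Judgement (Sym X)) := by
  rw [tmDecl, Expr.app_var_eq_appVars, TyEl.length_ctx, TmEl.decl]; rfl

variable (X) in
/-- The basic judgements of the free theory. -/
def freeBasic : Set (Judgement (Sym X)) :=
  { J | (∃ A : TyEl X, J = tyDecl (.inl A) A.ctx) ∨
    ∃ f : TmEl X, J = tmDecl (.inr f) f.bd.ctx f.bd.decl }

theorem TyEl.derivable_decl : ∀ (A : TyEl X), Derivable (freeBasic X) ⟨A.ctx, .ty A.decl⟩
  | ⟨n, A⟩ => by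
    induction n with
    | zero =>
      refine .basic (.inl ⟨⟨0, A⟩, (TyEl.tyDecl_ctx _).symm⟩) ?_
      simp [TyEl.ctx, declCtx, Judgement.boundary]
    | succ n ih =>
      refine .basic (.inl ⟨⟨n + 1, A⟩, (TyEl.tyDecl_ctx _).symm⟩) ?_
      simp only [TyEl.ctx, declCtx, Judgement.boundary, List.mem_singleton, forall_eq]
      exact ih _

theorem TmEl.derivable_decl (f : TmEl X) :
    Derivable (freeBasic X) ⟨f.bd.ctx, .tm f.decl f.bd.decl⟩ := by
  refine .basic (.inr ⟨f, (TmEl.tmDecl_ctx _).symm⟩) ?_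
  simpa only [Judgement.boundary, List.mem_singleton, forall_eq] using f.bd.derivable_decl

variable (X) in
/-- The free theory on a type-and-term structure. -/
def free : WGAT.{u} where
  TyConst := TyEl X
  TmConst := TmEl X
  basic := freeBasic X
  existsUnique_tyDecl A := by
    refine ⟨_, ⟨.inl ⟨A, rfl⟩, _, rfl⟩, ?_⟩
    rintro J ⟨⟨B, rfl⟩ | ⟨f, rfl⟩, Γ, e⟩
    · simp only [tyDecl, Judgement.mk.injEq, Body.ty.injEq, Expr.app.injEq, Sum.inl.injEq] at e
      rw [e.2.1]
    · simp [tyDecl, tmDecl] at e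
  existsUnique_tmDecl f := by
    refine ⟨_, ⟨.inr ⟨f, rfl⟩, _, _, rfl⟩, ?_⟩
    rintro J ⟨⟨B, rfl⟩ | ⟨f, rfl⟩, Γ, T, e⟩
    · simp [tyDecl, tmDecl] at e
    · simp only [tmDecl, Judgement.mk.injEq, Body.tm.injEq, Expr.app.injEq, Sum.inr.injEq] at e
      rw [e.2.1.1]
  basic_cases := by
    rintro J (⟨A, rfl⟩ | ⟨f, rfl⟩)
    · exact .inl ⟨A, _, rfl⟩
    · exact .inr (.inl ⟨f, _, _, rfl⟩)
  derivable_of_mem_basic := by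
    rintro J (⟨A, rfl⟩ | ⟨f, rfl⟩)
    · rw [TyEl.tyDecl_ctx]
      exact A.derivable_decl
    · rw [TmEl.tmDecl_ctx]
      exact f.derivable_decl

end TTStr

namespace TTStr

variable {X : TTStr.{u}}

/-! ### Derived judgements of the free theory -/

/-- The expression is a type-element applied to variables of the context, in such a way that
the last variable is declared with the boundary of the type-element. -/
def OkTy (Γ : Ctx (Sym X)) (T : Expr (Sym X)) : Prop :=
  ∃ (a : TyEl X) (l : List ℕ), T = .appVars (.inl a) l ∧
    (a.bd = none ∧ l = [] ∨ ∃ (j : ℕ) (a' : TyEl X) (l' : List ℕ),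
      declAt Γ j = some (.appVars (.inl a') l') ∧ a.bd = some a' ∧ l = l' ++ [j])

/-- All declarations in the context are of the form `OkTy`. -/
def OkCtx : Ctx (Sym X) → Prop
  | [] => True
  | T :: Γ => OkCtx Γ ∧ OkTy Γ T

/-- The term is a term-element applied to the variables of its type, whose symbol is the
boundary of the term-element. -/
def OkTm (t T : Expr (Sym X)) : Prop :=
  ∃ (f : TmEl X) (l : List ℕ), t = .appVars (.inr f) l ∧ T = .appVars (.inl f.bd) l

theorem OkCtx.of_append : ∀ {Δ Γ : Ctx (Sym X)}, OkCtx (Δ ++ Γ) → OkCtx Γ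
  | [], _, h => h
  | _ :: _, _, h => OkCtx.of_append h.1

/-- A type only refers to the part of the context before it, whence the bound `j < i`. This bound is
the heap condition. -/
theorem OkCtx.okTy_of_declAt {Γ : Ctx (Sym X)} (hΓ : OkCtx Γ) {i : ℕ} {T : Expr (Sym X)}
    (h : declAt Γ i = some T) : ∃ (a : TyEl X) (l : List ℕ), T = .appVars (.inl a) l ∧
    (a.bd = none ∧ l = [] ∨ ∃ j < i, ∃ (a' : TyEl X) (l' : List ℕ),
      declAt Γ j = some (.appVars (.inl a') l') ∧ a.bd = some a' ∧ l = l' ++ [j]) := by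
  obtain ⟨Δ, Γ', rfl, rfl⟩ := exists_append_of_declAt h
  obtain ⟨-, a, l, hT, ha | ⟨j, a', l', h', h''⟩⟩ := hΓ.of_append
  · exact ⟨a, l, hT, .inl ha⟩
  · have hj := lt_of_declAt h'
    refine ⟨a, l, hT, .inr ⟨j, hj, a', l', ?_, h''⟩⟩
    rwa [declAt_append _ (by simp; omega), declAt_cons_of_lt hj]

/-- A criterion for `OkCtx`, level by level. -/
theorem okCtx_of_declAt : ∀ {Γ : Ctx (Sym X)}, (∀ i T, declAt Γ i = some T →
    ∃ (a : TyEl X) (l : List ℕ), T = .appVars (.inl a) l ∧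
    (a.bd = none ∧ l = [] ∨ ∃ j < i, ∃ (a' : TyEl X) (l' : List ℕ),
      declAt Γ j = some (.appVars (.inl a') l') ∧ a.bd = some a' ∧ l = l' ++ [j])) → OkCtx Γ
  | [], _ => trivial
  | S :: Γ, h => by
    refine ⟨okCtx_of_declAt fun i T hi => ?_, ?_⟩
    · have hi' := lt_of_declAt hi
      obtain ⟨a, l, hT, ha | ⟨j, hj, a', l', h', h''⟩⟩ :=
        h i T (by rwa [declAt_cons_of_lt hi'])
      · exact ⟨a, l, hT, .inl ha⟩
      · exact ⟨a, l, hT, .inr ⟨j, hj, a', l', by rwa [declAt_cons_of_lt (by omega)] at h', h''⟩⟩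
    · obtain ⟨a, l, hT, ha | ⟨j, hj, a', l', h', h''⟩⟩ := h _ _ (declAt_cons_length Γ S)
      · exact ⟨a, l, hT, .inl ha⟩
      · exact ⟨a, l, hT, .inr ⟨j, a', l', by rwa [declAt_cons_of_lt hj] at h', h''⟩⟩

/-- Induction along parents: passing from the parent to the child adds one argument and raises the
degree by one. -/
theorem OkCtx.arity {Γ : Ctx (Sym X)} (hΓ : OkCtx Γ) (i : ℕ) : ∀ {a : TyEl X} {l : List ℕ},
    declAt Γ i = some (.appVars (.inl a) l) → l.length = a.1 ∧ ∀ k ∈ l, k < i := by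
  induction i using Nat.strong_induction_on with
  | _ i ih =>
    intro a l h
    obtain ⟨b, m, e, h'⟩ := hΓ.okTy_of_declAt h
    obtain ⟨e', rfl⟩ := Expr.appVars_injective e
    obtain rfl := Sum.inl_injective e'
    obtain ⟨h₁, rfl⟩ | ⟨j, hj, a', l', h₁, h₂, rfl⟩ := h'
    · exact ⟨(TyEl.fst_of_bd_none h₁).symm, by simp⟩
    · obtain ⟨k₁, k₂⟩ := ih j hj h₁
      refine ⟨by rw [TyEl.fst_of_bd h₂, ← k₁]; simp, fun k hk => ?_⟩
      rcases List.mem_append.1 hk with hk | hk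
      · exact (k₂ k hk).trans hj
      · obtain rfl := List.mem_singleton.1 hk
        exact hj

theorem OkCtx.arity_cons {Γ : Ctx (Sym X)} {a : TyEl X} {l : List ℕ}
    (hΓ : OkCtx (.appVars (.inl a) l :: Γ)) : l.length = a.1 ∧ ∀ k ∈ l, k < Γ.length :=
  hΓ.arity _ (declAt_cons_length _ _)

/-- Below the inserted variable nothing is renamed, but the formula is still correct there: `skip`
fixes both such a level and the arguments of its type, which are earlier levels. -/
theorem declAt_weaken {Γ Δ : Ctx (Sym X)} (S : Expr (Sym X)) (hΓ : OkCtx (Δ ++ Γ)) {j : ℕ}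
    {a : TyEl X} {l : List ℕ} (h : declAt (Δ ++ Γ) j = some (.appVars (.inl a) l)) :
    declAt (Δ.map (Expr.rename (skip Γ.length)) ++ S :: Γ) (skip Γ.length j) =
      some (.appVars (.inl a) (l.map (skip Γ.length))) := by
  induction Δ with
  | nil =>
    have hj := lt_of_declAt h
    rw [List.nil_append] at hj h
    have hl : l.map (skip Γ.length) = l :=
      List.map_congr_left (fun k hk => skip_of_lt (((hΓ.arity j h).2 k hk).trans hj))
        |>.trans (List.map_id l)
    rwa [skip_of_lt hj, List.map_nil, List.nil_append, declAt_cons_of_lt hj, hl]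
  | cons T Δ ih =>
    rw [List.cons_append, declAt_cons] at h
    rw [List.map_cons, List.cons_append, declAt_cons]
    split_ifs at h with hj
    · rw [if_pos, Option.some_injective _ h, Expr.rename_appVars]
      rw [hj, skip_of_le (by simp)]
      simp [← add_assoc]
    · rw [if_neg, ih hΓ.1 h]
      have := lt_of_declAt h
      have := skip_lt (k := Γ.length) this
      simp at this ⊢
      omega

theorem OkTy.weaken {Γ Δ : Ctx (Sym X)} (S : Expr (Sym X)) (hΓ : OkCtx (Δ ++ Γ))
    {T : Expr (Sym X)} (h : OkTy (Δ ++ Γ) T) :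
    OkTy (Δ.map (Expr.rename (skip Γ.length)) ++ S :: Γ) (T.rename (skip Γ.length)) := by
  obtain ⟨a, l, rfl, ⟨h, rfl⟩ | ⟨j, a', l', h, h', rfl⟩⟩ := h
  · exact ⟨a, [], by simp, .inl ⟨h, rfl⟩⟩
  · exact ⟨a, _, Expr.rename_appVars _ _ _, .inr ⟨_, a', _, declAt_weaken S hΓ h, h', by simp⟩⟩

theorem OkCtx.weaken {Γ : Ctx (Sym X)} {S : Expr (Sym X)} (hS : OkTy Γ S) :
    ∀ {Δ : Ctx (Sym X)}, OkCtx (Δ ++ Γ) →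
      OkCtx (Δ.map (Expr.rename (skip Γ.length)) ++ S :: Γ)
  | [], h => ⟨h, hS⟩
  | _ :: _, h => ⟨OkCtx.weaken hS h.1, h.2.weaken S h.1⟩

theorem OkTm.rename {t T : Expr (Sym X)} (h : OkTm t T) (θ : ℕ → ℕ) :
    OkTm (t.rename θ) (T.rename θ) := by
  obtain ⟨f, l, rfl, rfl⟩ := h
  exact ⟨f, l.map θ, by simp, by simp⟩

theorem TyEl.okCtx (A : TyEl X) : OkCtx (A.decl :: A.ctx) := by
  obtain ⟨n, A⟩ := A
  induction n with
  | zero => exact ⟨trivial, _, _, rfl, .inl ⟨rfl, rfl⟩⟩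
  | succ n ih =>
    refine ⟨ih _, _, _, rfl, .inr ⟨n, ⟨n, X.bdTy n A⟩, List.range n, ?_, rfl, List.range_succ⟩⟩
    simp [TyEl.ctx, declCtx, declAt_cons, length_declCtx]

/-- The shape of a derived judgement of the free theory. -/
def OkJ : Judgement (Sym X) → Prop
  | ⟨Γ, .ty T⟩ => OkCtx (T :: Γ)
  | ⟨Γ, .tm t T⟩ => OkCtx (T :: Γ) ∧ OkTm t T
  | ⟨Γ, .tyEq T T'⟩ => OkCtx (T :: Γ) ∧ T = T'
  | ⟨Γ, .tmEq t t' T⟩ => (OkCtx (T :: Γ) ∧ OkTm t T) ∧ t = t'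

/-- No basic judgement is an equality, and the rules only produce trivial equalities from trivial
ones. By induction all equalities are identities, so conversions return their second hypothesis
unchanged, and weakening is the only rule that affects the shape of contexts. -/
theorem okJ_of_derivable {J : Judgement (Sym X)} (hJ : Derivable (freeBasic X) J) : OkJ J := by
  induction hJ with
  | basic hJ h ih =>
    obtain ⟨A, rfl⟩ | ⟨f, rfl⟩ := hJ
    · rw [TyEl.tyDecl_ctx]
      exact A.okCtx
    · rw [TmEl.tmDecl_ctx]
      exact ⟨f.bd.okCtx, f, _, rfl, rfl⟩
  | @rule r Js J hr h ih =>
    -- In transitivity and conversion the first hypothesis is an equality. Once it is known to be an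
    -- identity, the conclusion coincides with the second hypothesis.
    obtain ⟨J₁, Js', rfl⟩ : ∃ J₁ Js', Js = J₁ :: Js' := by cases hr <;> exact ⟨_, _, rfl⟩
    have ih₁ := ih _ (List.mem_cons_self ..)
    cases hr with
    | tmRefl Γ t T => exact ⟨ih₁, rfl⟩
    | tmSymm Γ t₁ t₂ T => obtain ⟨k, rfl⟩ := ih₁; exact ⟨k, rfl⟩
    | tmTrans Γ t₁ t₂ t₃ T =>
      obtain ⟨h, rfl⟩ := ih₁
      exact ih _ (List.mem_cons_of_mem _ (List.mem_cons_self ..))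
    | tyRefl Γ T => exact ⟨ih₁, rfl⟩
    | tySymm Γ T₁ T₂ => obtain ⟨k, rfl⟩ := ih₁; exact ⟨k, rfl⟩
    | tyTrans Γ T₁ T₂ T₃ =>
      obtain ⟨h, rfl⟩ := ih₁
      exact ih _ (List.mem_cons_of_mem _ (List.mem_cons_self ..))
    | tmConv Γ T₁ T₂ t =>
      obtain ⟨h, rfl⟩ := ih₁
      exact ih _ (List.mem_cons_of_mem _ (List.mem_cons_self ..))
    | tmEqConv Γ T₁ T₂ t₁ t₂ =>
      obtain ⟨h, rfl⟩ := ih₁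
      exact ih _ (List.mem_cons_of_mem _ (List.mem_cons_self ..))
    | ctxConv Γ Δ T₁ T₂ b =>
      obtain ⟨h, rfl⟩ := ih₁
      exact ih _ (List.mem_cons_of_mem _ (List.mem_cons_self ..))
    | weakening Γ Δ T b =>
      have ih₂ := ih _ (List.mem_cons_of_mem _ (List.mem_cons_self ..))
      cases b with
      | ty B => exact OkCtx.weaken (Δ := B :: Δ) ih₁.2 ih₂
      | tm t B => exact ⟨OkCtx.weaken (Δ := B :: Δ) ih₁.2 ih₂.1, ih₂.2.rename _⟩
      | tyEq B B' => exact ⟨OkCtx.weaken (Δ := B :: Δ) ih₁.2 ih₂.1, congrArg _ ih₂.2⟩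
      | tmEq t t' B =>
        exact ⟨⟨OkCtx.weaken (Δ := B :: Δ) ih₁.2 ih₂.1.1, ih₂.1.2.rename _⟩, congrArg _ ih₂.2⟩

/-- Dropping later declarations only moves levels beyond the end of `Δ`. -/
theorem thin_append {C : Type u} {Γ Δ : Ctx C} {θ : ℕ → ℕ} (h : Thin Γ Δ θ) {n : ℕ}
    (hn : ∀ i < n, θ i < Δ.length) : ∀ Θ : Ctx C,
    ∃ θ', Thin Γ (Θ ++ Δ) θ' ∧ ∀ i < n, θ' i = θ i
  | [] => ⟨θ, h, fun _ _ => rfl⟩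
  | S :: Θ => by
    obtain ⟨θ', h', e⟩ := thin_append h hn Θ
    refine ⟨_, h'.drop S, fun i hi => ?_⟩
    have := hn i hi
    rw [skip_of_lt (by rw [e i hi]; simp; omega), e i hi]

/-- The arguments `l` select a copy of the generic context of `a` inside `Γ`. Recursively, the
context of the boundary `a'` sits in the part of `Γ` before the parent `j`; one keeps the
declaration of `j` and drops everything after it. -/
theorem OkCtx.exists_thin : ∀ (n : ℕ) {Γ : Ctx (Sym X)} {a : TyEl X} {l : List ℕ}, Γ.length = n →
    OkCtx (.appVars (.inl a) l :: Γ) → ∃ θ, Thin a.ctx Γ θ ∧ l = (List.range a.1).map θ := by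
  intro n
  induction n using Nat.strong_induction_on with
  | _ n ih =>
    rintro Γ a l rfl ⟨hΓ, b, m, e, h⟩
    obtain ⟨e', rfl⟩ := Expr.appVars_injective e
    obtain rfl := Sum.inl_injective e'
    obtain ⟨ha, rfl⟩ | ⟨j, a', l', h₁, ha, rfl⟩ := h
    · obtain ⟨θ, hθ, -⟩ := thin_append (C := Sym X) .nil (n := 0) (by simp) Γ
      refine ⟨θ, ?_, by simp [TyEl.fst_of_bd_none ha]⟩
      rw [TyEl.ctx_of_bd_none ha]
      simpa using hθ
    · obtain ⟨Δ, Γ', rfl, rfl⟩ := exists_append_of_declAt h₁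
      obtain ⟨θ, hθ, rfl⟩ := ih Γ'.length (by simp; omega) rfl hΓ.of_append
      have hlt := hΓ.of_append.arity_cons.2
      -- The variable at level `a'.1`, the last argument of `a`, goes to the level of the parent.
      have hθ₀ := hθ.apply_add 0
      rw [add_zero, add_zero, TyEl.length_ctx] at hθ₀
      obtain ⟨θ', hθ', e⟩ := thin_append (hθ.keep a'.decl) (n := a'.1 + 1) (by
        intro i hi
        rw [List.length_cons, Nat.lt_succ_iff]
        rcases Nat.lt_succ_iff_lt_or_eq.1 hi with hi | rfl
        · exact (hlt _ (List.mem_map_of_mem (List.mem_range.2 hi))).le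
        · exact hθ₀.le) Δ
      refine ⟨θ', ?_, ?_⟩
      · rw [TyEl.ctx_of_bd ha]
        simpa [TyEl.decl] using hθ'
      · rw [TyEl.fst_of_bd ha, List.range_succ, List.map_append, List.map_singleton,
          e _ (Nat.lt_succ_self _), hθ₀]
        congr 1
        exact List.map_congr_left fun i hi => (e i (by have := List.mem_range.1 hi; omega)).symm

/-- With `okJ_of_derivable`, this makes the syntactic condition `OkCtx` an exact description of
derivable contexts. -/
theorem OkCtx.derCtx : ∀ {Γ : Ctx (Sym X)}, OkCtx Γ → DerCtx (freeBasic X) Γ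
  | [], _ => trivial
  | T :: Γ, h => by
    obtain ⟨a, l, rfl, -⟩ := h.2
    obtain ⟨θ, hθ, rfl⟩ := h.exists_thin _ rfl
    have := hθ.derivable (OkCtx.derCtx h.1) [] _ a.derivable_decl
    simpa [DerCtx, Body.rename, TyEl.decl] using this

theorem derivable_tm_of_ok {Γ : Ctx (Sym X)} {t T : Expr (Sym X)} (h : OkCtx (T :: Γ))
    (ht : OkTm t T) : Derivable (freeBasic X) ⟨Γ, .tm t T⟩ := by
  obtain ⟨f, l, rfl, rfl⟩ := ht
  obtain ⟨θ, hθ, rfl⟩ := h.exists_thin _ rfl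
  have := hθ.derivable (OkCtx.derCtx h.1) [] _ f.derivable_decl
  simpa [DerCtx, Body.rename, TyEl.decl, TmEl.decl, show f.bd.1 = f.1 from rfl] using this

theorem ctx_eq_of_ctxEq : ∀ {Γ Δ : Ctx (Sym X)}, CtxEq (freeBasic X) Γ Δ → Γ = Δ
  | [], [], _ => rfl
  | S :: Γ, T :: Δ, ⟨h₁, h₂⟩ => by rw [ctx_eq_of_ctxEq h₁, (okJ_of_derivable h₂).2]

/-- Elements of the underlying presheaf of a free theory may therefore be treated as judgements. -/
theorem eq_of_cong {J K : Judgement (Sym X)} (h : Cong (freeBasic X) J K) : J = K := by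
  obtain ⟨Γ, b⟩ := J
  obtain ⟨Δ, c⟩ := K
  cases b <;> cases c <;> try exact h.elim
  · obtain ⟨rfl, rfl⟩ := List.cons.inj (ctx_eq_of_ctxEq h)
    rfl
  · obtain ⟨h₁, h₂⟩ := h
    obtain ⟨rfl, rfl⟩ := List.cons.inj (ctx_eq_of_ctxEq h₁)
    obtain ⟨-, rfl⟩ := okJ_of_derivable h₂
    rfl

end TTStr

/-! ### Interpreting expressions -/

section Interp

variable {C : Type u} {D : Type u₁}

/-- The level of a variable. -/
def Expr.varIdx : Expr C → ℕ
  | .var i => i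
  | .app _ _ _ => 0

/-- The interpretation of expressions in which all symbols are applied to variables. -/
def Expr.interp (ρ : C → Expr D) : Expr C → Expr D
  | .var i => .var i
  -- The default `0` is harmless when `ρ c` only uses variables below the arity `k`, as it will in
  -- all applications.
  | .app c k args => (ρ c).rename fun i => if h : i < k then (args ⟨i, h⟩).varIdx else 0

/-- Apply a function to all expressions of a body. -/
def Body.mapExpr (g : Expr C → Expr D) : Body C → Body D
  | .ty T => .ty (g T)
  | .tm t T => .tm (g t) (g T)
  | .tyEq T T' => .tyEq (g T) (g T')
  | .tmEq t t' T => .tmEq (g t) (g t') (g T)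

/-- Apply a function to all expressions of a judgement. -/
def Judgement.mapExpr (g : Expr C → Expr D) (J : Judgement C) : Judgement D :=
  ⟨J.ctx.map g, J.body.mapExpr g⟩

theorem Expr.interp_appVars (ρ : C → Expr D) (c : C) (l : List ℕ) :
    (Expr.appVars c l).interp ρ = (ρ c).rename fun i => l.getD i 0 := by
  simp only [appVars, interp]
  congr 1
  funext i
  split_ifs with h
  · simp [varIdx, h]
  · simp at h
    simp [h]

/-- Scoping keeps the lookup in `l` away from the default value `0`, which `θ` need not fix. -/
theorem Expr.interp_rename {ρ : C → Expr D} {c : C} {l : List ℕ} (h : (ρ c).Scoped l.length)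
    (θ : ℕ → ℕ) : ((Expr.appVars c l).rename θ).interp ρ = ((Expr.appVars c l).interp ρ).rename θ := by
  rw [rename_appVars, interp_appVars, interp_appVars, rename_rename]
  exact rename_congr (fun i hi => by simp [hi]) h

theorem Expr.interp_appVars_range {ρ : C → Expr D} {c : C} {n : ℕ} (h : (ρ c).Scoped n) :
    (Expr.appVars c (List.range n)).interp ρ = ρ c := by
  rw [interp_appVars]
  exact rename_eq_self (fun i hi => by simp [hi]) h

theorem Judgement.mapExpr_boundary (g : Expr C → Expr D) (J : Judgement C) :
    (J.mapExpr g).boundary = J.boundary.map (mapExpr g) := by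
  obtain ⟨Γ, b⟩ := J
  cases b <;> try rfl
  cases Γ <;> rfl

end Interp

namespace TTStr

/-- A map of type-and-term structures is a family of functions commuting with the boundaries. -/
def homOfFun {X Y : TTStr.{u}}
    (f : ∀ v : HVertex, X.obj (op ((Paths.of _).obj v)) → Y.obj (op ((Paths.of _).obj v)))
    (hty : ∀ n A, f _ (X.bdTy n A) = Y.bdTy n (f _ A))
    (htm : ∀ n A, f _ (X.bdTm n A) = Y.bdTm n (f _ A)) : X ⟶ Y :=
  pathsNatTrans (F := X) (G := Y) (fun v => TypeCat.ofHom (f v)) (by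
    intro v w e
    ext x
    change HVertex.Edge v w at e
    cases e with
    | succ n => exact hty n x
    | term n => exact htm n x)

theorem hom_ext {X Y : TTStr.{u}} {f g : X ⟶ Y}
    (h : ∀ (v : HVertex) (x : X.obj (op ((Paths.of _).obj v))), f.app _ x = g.app _ x) : f = g := by
  ext v x
  exact h v.unop x

end TTStr

/-! ### Representatives with prescribed boundary -/

namespace WGAT

/-- The class of a derived judgement. -/
def cls (U : WGAT.{u}) {v : HVertex} (J : U.El v) :
    (forget.obj U).obj (op ((Paths.of _).obj v)) := Quotient.mk (U.elSetoid v) J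

variable {U : WGAT.{u}}

theorem cls_surjective {v : HVertex} (x : (forget.obj U).obj (op ((Paths.of _).obj v))) :
    ∃ J : U.El v, U.cls J = x := Quotient.exists_rep (s := U.elSetoid v) x

theorem cls_eq_iff {v : HVertex} {J K : U.El v} : U.cls J = U.cls K ↔ Cong U.basic J.1 K.1 :=
  Quotient.eq (r := U.elSetoid v)

/-- Interpretations preserve boundaries strictly, whereas maps of presheaves do so up to `≡`.
Context conversion repairs this: any representative can be moved over a chosen representative of its
boundary. -/
theorem exists_ty_rep {n : ℕ} (x : (forget.obj U).obj (op ((Paths.of _).obj (.ty (n + 1)))))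
    {K : U.El (.ty n)} (hK : U.cls K = (forget.obj U).bdTy n x) :
    ∃ J : U.El (.ty (n + 1)), U.cls J = x ∧ U.bdTy n J = K := by
  obtain ⟨⟨J, hJ, h₁, h₂⟩, rfl⟩ := cls_surjective x
  obtain ⟨K, k, k₁, k₂⟩ := K
  replace hK := (cls_eq_iff (K := U.bdTy n ⟨J, hJ, h₁, h₂⟩)).1 hK
  obtain ⟨A, Γ, B, rfl, hl⟩ := exists_of_kind_ty_succ h₁ h₂
  obtain ⟨Δ, c⟩ := K
  obtain ⟨A', rfl⟩ : ∃ A', c = .ty A' := by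
    cases c <;> simp [Body.kind, vKind] at k₁ ⊢
  have h : CtxEq U.basic (A :: Γ) (A' :: Δ) := CtxEq.symm hK
  have hB := h.convert [] _ hJ
  refine ⟨⟨⟨A' :: Δ, .ty B⟩, hB, rfl, congrArg (· + 1) k₂⟩, ?_, rfl⟩
  exact cls_eq_iff.2 ⟨h.symm, .of_rule₁ (.tyRefl _ _) hB⟩

theorem exists_tm_rep {n : ℕ} (x : (forget.obj U).obj (op ((Paths.of _).obj (.tm n))))
    {K : U.El (.ty n)} (hK : U.cls K = (forget.obj U).bdTm n x) :
    ∃ J : U.El (.tm n), U.cls J = x ∧ U.bdTm n J = K := by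
  obtain ⟨⟨J, hJ, h₁, h₂⟩, rfl⟩ := cls_surjective x
  obtain ⟨K, k, k₁, k₂⟩ := K
  replace hK := (cls_eq_iff (K := U.bdTm n ⟨J, hJ, h₁, h₂⟩)).1 hK
  obtain ⟨Γ, t, A, rfl⟩ := exists_of_kind_tm h₁
  obtain ⟨Δ, c⟩ := K
  obtain ⟨A', rfl⟩ : ∃ A', c = .ty A' := by
    cases c <;> simp [Body.kind, vKind] at k₁ ⊢
  have h : CtxEq U.basic (A :: Γ) (A' :: Δ) := CtxEq.symm hK
  -- The type of the term is converted while still in the old context, and the context afterwards.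
  have ht := h.1.convert [] _ (Derivable.of_rule₂ (.tmConv _ _ _ _) h.2 hJ)
  refine ⟨⟨⟨Δ, .tm t A'⟩, ht, rfl, k₂⟩, ?_, rfl⟩
  exact cls_eq_iff.2 ⟨h.symm, .of_rule₁ (.tmRefl _ _ _) ht⟩

/-- The expression on the left of the colon, or the type. -/
def headExpr {C : Type u} (J : Judgement C) : Expr C :=
  match J.body with
  | .ty T => T
  | .tm t _ => t
  | .tyEq T _ => T
  | .tmEq t _ _ => t

theorem eq_of_kind_ty {C : Type u} {J : Judgement C} (h : J.body.kind = .ty) :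
    J = ⟨J.ctx, .ty (headExpr J)⟩ := by
  obtain ⟨Γ, b⟩ := J
  cases b <;> simp [Body.kind] at h
  rfl

theorem eq_of_kind_tm {C : Type u} {J : Judgement C} (h : J.body.kind = .tm) :
    J = ⟨J.bd.ctx, .tm (headExpr J) (headExpr J.bd)⟩ := by
  obtain ⟨Γ, b⟩ := J
  cases b <;> simp [Body.kind] at h
  rfl

end WGAT

/-! ### The interpretation induced by a map of presheaves, and the adjunction -/

namespace TTStr

open WGAT

variable {X : TTStr.{u}} {U : WGAT.{u}}

/-- Representatives of the classes of type judgements chosen by a map, with strictly compatible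
boundaries. -/
noncomputable def tyRep (g : X ⟶ forget.obj U) : ∀ (n : ℕ)
    (A : X.obj (op ((Paths.of _).obj (.ty n)))), { J : U.El (.ty n) // U.cls J = g.app _ A }
  | 0, A => ⟨(cls_surjective (g.app _ A)).choose, (cls_surjective (g.app _ A)).choose_spec⟩
  | n + 1, A =>
    have h := exists_ty_rep (g.app _ A)
      ((tyRep g n (X.bdTy n A)).2.trans (bdTy_app g n A))
    ⟨h.choose, h.choose_spec.1⟩

theorem bdTy_tyRep (g : X ⟶ forget.obj U) (n : ℕ)
    (A : X.obj (op ((Paths.of _).obj (.ty (n + 1))))) :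
    U.bdTy n (tyRep g (n + 1) A).1 = (tyRep g n (X.bdTy n A)).1 :=
  (exists_ty_rep (g.app _ A) ((tyRep g n (X.bdTy n A)).2.trans (bdTy_app g n A))).choose_spec.2

theorem exists_tmRep (g : X ⟶ forget.obj U) (n : ℕ) (f : X.obj (op ((Paths.of _).obj (.tm n)))) :
    ∃ J : U.El (.tm n), U.cls J = g.app _ f ∧ U.bdTm n J = (tyRep g n (X.bdTm n f)).1 :=
  exists_tm_rep (g.app _ f) ((tyRep g n (X.bdTm n f)).2.trans (bdTm_app g n f))

/-- The expressions in the chosen representatives. -/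
noncomputable def repExpr (g : X ⟶ forget.obj U) : Sym X → Expr (U.TyConst ⊕ U.TmConst)
  | .inl A => headExpr (tyRep g A.1 A.2).1.1
  | .inr f => headExpr (exists_tmRep g f.1 f.2).choose.1

theorem tyRep_eq (g : X ⟶ forget.obj U) (A : TyEl X) : (tyRep g A.1 A.2).1.1 =
    ⟨(tyRep g A.1 A.2).1.1.ctx, .ty (repExpr g (.inl A))⟩ :=
  eq_of_kind_ty (tyRep g A.1 A.2).1.2.2.1

theorem scoped_repExpr_ty (g : X ⟶ forget.obj U) (A : TyEl X) :
    (repExpr g (.inl A)).Scoped A.1 := by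
  have h := (tyRep g A.1 A.2).1.2
  have := (WGAT.Der.scoped h.1).2
  rw [h.2.2, tyRep_eq] at this
  exact this

theorem tmRep_eq (g : X ⟶ forget.obj U) (f : TmEl X) : (exists_tmRep g f.1 f.2).choose.1 =
    ⟨(tyRep g f.1 f.bd.2).1.1.ctx, .tm (repExpr g (.inr f)) (repExpr g (.inl f.bd))⟩ := by
  have h₁ := eq_of_kind_tm (exists_tmRep g f.1 f.2).choose.2.2.1
  have h₂ : (exists_tmRep g f.1 f.2).choose.1.bd = (tyRep g f.1 f.bd.2).1.1 :=
    congrArg Subtype.val (exists_tmRep g f.1 f.2).choose_spec.2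
  rw [h₂] at h₁
  exact h₁

theorem scoped_repExpr_tm (g : X ⟶ forget.obj U) (f : TmEl X) :
    (repExpr g (.inr f)).Scoped f.1 := by
  have h := (exists_tmRep g f.1 f.2).choose.2
  have := (WGAT.Der.scoped h.1).2
  rw [h.2.2, tmRep_eq] at this
  exact this.1

/-- Here the strict compatibility of the chosen representatives enters: it lets the translated types
of the iterated boundaries assemble to the context of one representative. -/
theorem map_interp_declCtx (g : X ⟶ forget.obj U) : ∀ (n : ℕ)
    (A : X.obj (op ((Paths.of _).obj (.ty n)))),
    (declCtx n A).map (Expr.interp (repExpr g)) = (tyRep g n A).1.1.ctx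
  | 0, A => (List.length_eq_zero_iff.1 (tyRep g 0 A).1.2.2.2).symm
  | n + 1, A => by
    have h := congrArg Subtype.val (bdTy_tyRep g n A)
    have h' := tyRep_eq g ⟨n, X.bdTy n A⟩
    have h₁ := (tyRep g (n + 1) A).1.2
    rw [declCtx, List.map_cons, map_interp_declCtx g n,
      Expr.interp_appVars_range (scoped_repExpr_ty g ⟨n, _⟩)]
    obtain ⟨B, Γ, B', e, hl⟩ := exists_of_kind_ty_succ h₁.2.1 h₁.2.2
    simp only [WGAT.bdTy, e, Judgement.bd, Judgement.boundary, List.headD_cons] at h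
    simp only [← h, Judgement.mk.injEq, Body.ty.injEq, true_and] at h'
    rw [← h, e, ← h']

theorem mapExpr_tyDecl (g : X ⟶ forget.obj U) (A : TyEl X) :
    (⟨A.ctx, .ty A.decl⟩ : Judgement (Sym X)).mapExpr (Expr.interp (repExpr g)) =
      (tyRep g A.1 A.2).1.1 := by
  rw [tyRep_eq]
  simp only [Judgement.mapExpr, Body.mapExpr, TyEl.ctx, TyEl.decl]
  rw [map_interp_declCtx, Expr.interp_appVars_range (scoped_repExpr_ty g A)]

theorem mapExpr_tmDecl (g : X ⟶ forget.obj U) (f : TmEl X) :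
    (⟨f.bd.ctx, .tm f.decl f.bd.decl⟩ : Judgement (Sym X)).mapExpr (Expr.interp (repExpr g)) =
      (exists_tmRep g f.1 f.2).choose.1 := by
  rw [tmRep_eq]
  simp only [Judgement.mapExpr, Body.mapExpr, TyEl.ctx, TyEl.decl, TmEl.decl]
  rw [map_interp_declCtx, Expr.interp_appVars_range (scoped_repExpr_ty g f.bd),
    Expr.interp_appVars_range (scoped_repExpr_tm g f)]
  rfl

/-- The interpretation commutes with renaming on the expressions in derived judgements. -/
theorem interp_rename_of_okTy (g : X ⟶ forget.obj U) {Γ : Ctx (Sym X)} {T : Expr (Sym X)}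
    (h : OkCtx (T :: Γ)) (θ : ℕ → ℕ) : (T.rename θ).interp (repExpr g) =
      (T.interp (repExpr g)).rename θ := by
  obtain ⟨a, l, rfl, -⟩ := h.2
  exact Expr.interp_rename (by rw [h.arity_cons.1]; exact scoped_repExpr_ty g a) θ

theorem interp_rename_of_okTm (g : X ⟶ forget.obj U) {Γ : Ctx (Sym X)} {t T : Expr (Sym X)}
    (h : OkCtx (T :: Γ)) (ht : OkTm t T) (θ : ℕ → ℕ) : (t.rename θ).interp (repExpr g) =
      (t.interp (repExpr g)).rename θ := by
  obtain ⟨f, l, rfl, rfl⟩ := ht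
  exact Expr.interp_rename (by rw [h.arity_cons.1]; exact scoped_repExpr_tm g f) θ

theorem map_interp_rename (g : X ⟶ forget.obj U) (θ : ℕ → ℕ) {Γ : Ctx (Sym X)} :
    ∀ {Δ : Ctx (Sym X)}, OkCtx (Δ ++ Γ) →
      (Δ.map (Expr.rename θ)).map (Expr.interp (repExpr g)) =
        (Δ.map (Expr.interp (repExpr g))).map (Expr.rename θ)
  | [], _ => rfl
  | T :: Δ, h => by
    simp only [List.map_cons]
    rw [map_interp_rename g θ h.1, interp_rename_of_okTy g h]

theorem mapExpr_rename (g : X ⟶ forget.obj U) (θ : ℕ → ℕ) {Γ : Ctx (Sym X)} {b : Body (Sym X)}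
    (h : OkJ ⟨Γ, b⟩) : (b.rename θ).mapExpr (Expr.interp (repExpr g)) =
      (b.mapExpr (Expr.interp (repExpr g))).rename θ := by
  cases b with
  | ty T => simp [Body.mapExpr, Body.rename, interp_rename_of_okTy g h]
  | tm t T =>
    simp [Body.mapExpr, Body.rename, interp_rename_of_okTy g h.1, interp_rename_of_okTm g h.1 h.2]
  | tyEq T T' =>
    obtain ⟨h, rfl⟩ := h
    simp [Body.mapExpr, Body.rename, interp_rename_of_okTy g h]
  | tmEq t t' T =>
    obtain ⟨h, rfl⟩ := h
    simp [Body.mapExpr, Body.rename, interp_rename_of_okTy g h.1, interp_rename_of_okTm g h.1 h.2]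

theorem OkJ.okCtx {J : Judgement (Sym X)} (h : OkJ J) : OkCtx J.ctx := by
  obtain ⟨Γ, b⟩ := J
  cases b with
  | ty T => exact OkCtx.of_append (Δ := [T]) h
  | tm t T => exact OkCtx.of_append (Δ := [T]) h.1
  | tyEq T T' => exact OkCtx.of_append (Δ := [T]) h.1
  | tmEq t t' T => exact OkCtx.of_append (Δ := [T]) h.1.1

/-- All rules except weakening are stable under any expressionwise translation. Weakening requires
that the translation commute with `skip`, which holds on derived judgements by their shape. -/
theorem rule_mapExpr (g : X ⟶ forget.obj U) {r : RuleName} {Js : List (Judgement (Sym X))}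
    {J : Judgement (Sym X)} (h : ∀ K ∈ Js, Derivable (freeBasic X) K) (hr : Rule r Js J) :
    Rule r (Js.map (Judgement.mapExpr (Expr.interp (repExpr g))))
      (J.mapExpr (Expr.interp (repExpr g))) := by
  cases hr with
  | tmRefl Γ t T => exact .tmRefl _ _ _
  | tmSymm Γ t₁ t₂ T => exact .tmSymm _ _ _ _
  | tmTrans Γ t₁ t₂ t₃ T => exact .tmTrans _ _ _ _ _
  | tyRefl Γ T => exact .tyRefl _ _
  | tySymm Γ T₁ T₂ => exact .tySymm _ _ _
  | tyTrans Γ T₁ T₂ T₃ => exact .tyTrans _ _ _ _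
  | tmConv Γ T₁ T₂ t => exact .tmConv _ _ _ _
  | tmEqConv Γ T₁ T₂ t₁ t₂ => exact .tmEqConv _ _ _ _ _
  | ctxConv Γ Δ T₁ T₂ b =>
    simpa [Judgement.mapExpr, Body.mapExpr] using
      Rule.ctxConv (Γ.map (Expr.interp (repExpr g))) (Δ.map (Expr.interp (repExpr g)))
        (T₁.interp (repExpr g)) (T₂.interp (repExpr g)) (b.mapExpr (Expr.interp (repExpr g)))
  | weakening Γ Δ T b =>
    have h' := okJ_of_derivable (h _ (List.mem_cons_of_mem _ (List.mem_cons_self ..)))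
    have := Rule.weakening (Γ.map (Expr.interp (repExpr g))) (Δ.map (Expr.interp (repExpr g)))
        (T.interp (repExpr g)) (b.mapExpr (Expr.interp (repExpr g)))
    rw [← mapExpr_rename g _ h', ← map_interp_rename g _ h'.okCtx, List.length_map] at this
    simpa only [Judgement.mapExpr, Body.mapExpr, List.map_cons, List.map_nil, List.map_append]
      using this

/-- The interpretation of the free theory induced by a map of type-and-term structures. -/
noncomputable def lift (g : X ⟶ forget.obj U) : Interpretation (free X) U where
  toFun J := J.mapExpr (Expr.interp (repExpr g))
  derivable J hJ := by
    induction hJ with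
    | basic hJ h ih =>
      obtain ⟨A, rfl⟩ | ⟨f, rfl⟩ := hJ
      · rw [TyEl.tyDecl_ctx, mapExpr_tyDecl]
        exact (tyRep g A.1 A.2).1.2.1
      · rw [TmEl.tmDecl_ctx, mapExpr_tmDecl]
        exact (exists_tmRep g f.1 f.2).choose.2.1
    | rule hr h ih => exact .rule (rule_mapExpr g h hr) (List.forall_mem_map.2 ih)
  kind := by
    rintro ⟨Γ, b⟩ -
    cases b <;> rfl
  boundary J _ := J.mapExpr_boundary _
  rule _ _ _ h hr := rule_mapExpr g h hr

/-- The generic type-element as a derived judgement of the free theory. -/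
def TyEl.el (A : TyEl X) : (free X).El (.ty A.1) :=
  ⟨⟨A.ctx, .ty A.decl⟩, A.derivable_decl, rfl, A.length_ctx⟩

/-- The generic term-element as a derived judgement of the free theory. -/
def TmEl.el (f : TmEl X) : (free X).El (.tm f.1) :=
  ⟨⟨f.bd.ctx, .tm f.decl f.bd.decl⟩, f.derivable_decl, rfl, f.bd.length_ctx⟩

variable (X) in
/-- The inclusion of generators. -/
def gen : X ⟶ forget.obj (free X) :=
  homOfFun (fun
    | .ty n => fun A => (free X).cls (TyEl.el (X := X) ⟨n, A⟩)
    | .tm n => fun f => (free X).cls (TmEl.el (X := X) ⟨n, f⟩))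
    (fun _ _ => rfl) (fun _ _ => rfl)

theorem gen_comp_lift (g : X ⟶ forget.obj U) :
    gen X ≫ forget.map (Quotient.mk _ (lift g) : free X ⟶ U) = g := by
  refine hom_ext fun v x => ?_
  rw [NatTrans.comp_app, types_comp_apply]
  cases v with
  | ty n =>
    refine Eq.trans ?_ (tyRep g n x).2
    exact congrArg U.cls (Subtype.ext (mapExpr_tyDecl g ⟨n, x⟩))
  | tm n =>
    refine Eq.trans ?_ (exists_tmRep g n x).choose_spec.1
    exact congrArg U.cls (Subtype.ext (mapExpr_tmDecl g ⟨n, x⟩))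

/-- The images of a weakening under two interpretations are only known to be instances of the rule.
Equal context lengths ensure that both insert the new variable at the same level. -/
theorem _root_.WeakeningMonad.Cong.of_weakening {C : Type u} {Λ : Set (Judgement C)}
    {J₁ J₂ J₃ K₁ K₂ K₃ : Judgement C} (hJ : Rule .weakening [J₁, J₂] J₃)
    (hK : Rule .weakening [K₁, K₂] K₃) (h₁ : Cong Λ J₁ K₁) (h₂ : Cong Λ J₂ K₂)
    (l₁ : J₁.ctx.length = K₁.ctx.length) (l₂ : J₂.ctx.length = K₂.ctx.length)
    (hd : Derivable Λ J₁) : Cong Λ J₃ K₃ := by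
  cases hJ
  cases hK
  simp only [List.length_append] at l₁ l₂
  exact Cong.weaken h₁ l₁ (by omega) hd h₂

/-- Uniqueness in the universal property. As equalities in the free theory are identities,
conversions do nothing to type and term judgements, and weakening respects `≡`. -/
theorem cong_of_gen {φ ψ : Interpretation (free X) U}
    (hty : ∀ A : TyEl X, Cong U.basic (φ.toFun ⟨A.ctx, .ty A.decl⟩) (ψ.toFun ⟨A.ctx, .ty A.decl⟩))
    (htm : ∀ f : TmEl X, Cong U.basic (φ.toFun ⟨f.bd.ctx, .tm f.decl f.bd.decl⟩)
      (ψ.toFun ⟨f.bd.ctx, .tm f.decl f.bd.decl⟩))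
    {J : Judgement (Sym X)} (hJ : Derivable (freeBasic X) J)
    (hk : J.body.kind = .ty ∨ J.body.kind = .tm) :
    Cong U.basic (φ.toFun J) (ψ.toFun J) := by
  induction hJ with
  | basic hJ h ih =>
    obtain ⟨A, rfl⟩ | ⟨f, rfl⟩ := hJ
    · rw [TyEl.tyDecl_ctx]
      exact hty A
    · rw [TmEl.tmDecl_ctx]
      exact htm f
  | @rule r Js J hr h ih =>
    have hφ := φ.rule _ _ _ h hr
    have hψ := ψ.rule _ _ _ h hr
    cases hr with
    | tmConv Γ T₁ T₂ t =>
      obtain ⟨-, rfl⟩ := okJ_of_derivable (h _ (List.mem_cons_self ..))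
      exact ih _ (List.mem_cons_of_mem _ (List.mem_cons_self ..)) (.inr rfl)
    | ctxConv Γ Δ T₁ T₂ b =>
      obtain ⟨-, rfl⟩ := okJ_of_derivable (h _ (List.mem_cons_self ..))
      exact ih _ (List.mem_cons_of_mem _ (List.mem_cons_self ..)) hk
    | weakening Γ Δ T b =>
      have hd₁ := h _ (List.mem_cons_self ..)
      have hd₂ := h _ (List.mem_cons_of_mem _ (List.mem_cons_self ..))
      have ih₁ := ih _ (List.mem_cons_self ..) (.inl rfl)
      have ih₂ := ih _ (List.mem_cons_of_mem _ (List.mem_cons_self ..)) (by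
        cases b <;> exact hk)
      exact Cong.of_weakening hφ hψ ih₁ ih₂ ((φ.length hd₁).trans (ψ.length hd₁).symm)
        ((φ.length hd₂).trans (ψ.length hd₂).symm) (φ.derivable _ hd₁)
    -- The remaining rules conclude with equality judgements.
    | _ => simp [Body.kind] at hk

theorem hom_free_ext {p q : free X ⟶ U} (h : gen X ≫ forget.map p = gen X ≫ forget.map q) :
    p = q := by
  obtain ⟨φ⟩ := p
  obtain ⟨ψ⟩ := q
  refine Quotient.sound fun J hJ hk => cong_of_gen (fun A => ?_) (fun f => ?_) hJ hk
  · have := ConcreteCategory.congr_hom (NatTrans.congr_app h (op ((Paths.of _).obj (.ty A.1)))) A.2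
    exact cls_eq_iff.1 this
  · have := ConcreteCategory.congr_hom (NatTrans.congr_app h (op ((Paths.of _).obj (.tm f.1)))) f.2
    exact cls_eq_iff.1 this

/-- The universal property of the free theory. -/
noncomputable def freeHomEquiv (X : TTStr.{u}) (U : WGAT.{u}) :
    (free X ⟶ U) ≃ (X ⟶ forget.obj U) where
  toFun p := gen X ≫ forget.map p
  invFun g := Quotient.mk _ (lift g)
  left_inv _ := hom_free_ext (gen_comp_lift _)
  right_inv g := gen_comp_lift g

/-- The free theory functor. -/
noncomputable def freeFunctor : TTStr.{u} ⥤ WGAT.{u} :=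
  Adjunction.leftAdjointOfEquiv (G := forget) (F_obj := free) freeHomEquiv
    (fun X _ _ g h => by simp [freeHomEquiv])

/-- The free theory functor is left adjoint to the forgetful functor. -/
noncomputable def freeAdj : freeFunctor.{u} ⊣ forget :=
  Adjunction.adjunctionOfEquivLeft freeHomEquiv (fun X _ _ g h => by simp [freeHomEquiv])

end TTStr

/-! ### Functors which are pointwise coproducts of representables -/

section FamiliallyRepresentable

variable {D : Type u₁} [Category.{u} D]

/-- The maps preserve the index, so compatible pairs live in a single summand, where the universal
property of the given square applies. -/
theorem isPullback_sumRepresentable {ι : Type} (P : ι → D) {A B X Y : D} {f : A ⟶ B} {g : A ⟶ X}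
    {h : B ⟶ Y} {k : X ⟶ Y} (sq : IsPullback f g h k) :
    IsPullback ((sumRepresentable P).map f) ((sumRepresentable P).map g)
      ((sumRepresentable P).map h) ((sumRepresentable P).map k) := by
  rw [Types.isPullback_iff]
  refine ⟨by rw [← Functor.map_comp, sq.w, Functor.map_comp], ?_, ?_⟩
  · rintro ⟨i, a⟩ ⟨j, b⟩ ⟨h₁, h₂⟩
    obtain ⟨rfl, h₁⟩ := Sigma.mk.inj_iff.1 h₁
    obtain ⟨-, h₂⟩ := Sigma.mk.inj_iff.1 h₂
    exact congrArg (Sigma.mk i) (sq.hom_ext (eq_of_heq h₁) (eq_of_heq h₂))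
  · rintro ⟨i, a⟩ ⟨j, b⟩ h
    obtain ⟨rfl, h⟩ := Sigma.mk.inj_iff.1 h
    have h := eq_of_heq h
    exact ⟨⟨i, sq.lift a b h⟩, congrArg (Sigma.mk i) (sq.lift_fst a b h),
      congrArg (Sigma.mk i) (sq.lift_snd a b h)⟩

variable {C : Type} [Category.{0} C] {F : D ⥤ (Cᵒᵖ ⥤ Type u)}

/-- Each component of the functor is a coproduct of representables. -/
def FamiliallyRepresentable (F : D ⥤ (Cᵒᵖ ⥤ Type u)) : Prop :=
  ∀ c : Cᵒᵖ, ∃ (ι : Type) (P : ι → D),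
    Nonempty (F ⋙ (evaluation Cᵒᵖ (Type u)).obj c ≅ sumRepresentable P)

theorem FamiliallyRepresentable.preservesPullbacks [HasPullbacks D]
    (hF : FamiliallyRepresentable F) : PreservesLimitsOfShape WalkingCospan F := by
  refine preservesLimitsOfShape_walkingCospan_of_forall_isPullback fun X Y Z f g _ =>
    ⟨_, _, _, IsPullback.of_hasPullback f g, IsPullback.of_forall_isPullback_app fun c => ?_⟩
  obtain ⟨ι, P, ⟨e⟩⟩ := hF c
  exact (isPullback_sumRepresentable P (IsPullback.of_hasPullback f g)).of_iso
    (e.symm.app _) (e.symm.app _) (e.symm.app _) (e.symm.app _)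
    (e.inv.naturality _) (e.inv.naturality _) (e.inv.naturality _) (e.inv.naturality _)

/-- By Yoneda, `g` is an element of `F X` at `c`, that is, a pair of an index `i` and a map `x : P i
⟶ X`. Lifting `g` along `F W ⟶ F X` means lifting this pair, hence factoring `x` through `W`. So the
left adjoint takes the value `x` at `g`. -/
theorem leftAdjointObjIsDefined_post_uliftYoneda (hF : FamiliallyRepresentable F) {X : D} {c : C}
    (g : uliftYoneda.{u}.obj c ⟶ F.obj X) :
    (Over.post (X := X) F).leftAdjointObjIsDefined (Over.mk g) := by
  obtain ⟨ι, P, ⟨e⟩⟩ := hF (op c)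
  obtain ⟨⟨i, x⟩, hx⟩ : ∃ y, e.hom.app X (uliftYonedaEquiv g) = y := ⟨_, rfl⟩
  have hx' : uliftYonedaEquiv g = e.inv.app X ⟨i, x⟩ := by
    rw [← hx]; exact (e.hom_inv_id_app_apply X _).symm
  let r (W : Over X) (h : Over.mk x ⟶ W) : Over.mk g ⟶ (Over.post F).obj W :=
    Over.homMk (uliftYonedaEquiv.symm (e.inv.app W.left ⟨i, h.left⟩)) (by
      apply uliftYonedaEquiv.injective
      change (F.map W.hom).app (op c) (uliftYonedaEquiv (uliftYonedaEquiv.symm _)) = uliftYonedaEquiv g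
      rw [Equiv.apply_symm_apply, hx']
      refine (NatTrans.naturality_apply e.inv W.hom _).symm.trans ?_
      have : h.left ≫ W.hom = x := Over.w h
      exact congrArg (fun y => e.inv.app X ⟨i, y⟩) this)
  have hr (W : Over X) : Function.Bijective (r W) := by
    constructor
    · intro h h' e'
      have e₁ : (r W h).left = (r W h').left := by rw [e']
      have e₂ := uliftYonedaEquiv.symm.injective e₁
      have e₃ := (e.inv_hom_id_app_apply W.left ⟨i, h.left⟩).symm.trans
        ((congrArg (e.hom.app W.left) e₂).trans (e.inv_hom_id_app_apply W.left ⟨i, h'.left⟩))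
      obtain ⟨-, e₃⟩ := Sigma.mk.inj_iff.1 e₃
      exact Over.OverMorphism.ext (eq_of_heq e₃)
    · intro k
      obtain ⟨⟨j, y⟩, hy⟩ : ∃ y, e.hom.app W.left (uliftYonedaEquiv k.left) = y := ⟨_, rfl⟩
      have hk : k.left ≫ F.map W.hom = g := Over.w k
      -- Naturality along `W.hom` forces the index to be `i` and `y` to be a map over `X`.
      have h₁ : (⟨j, y ≫ W.hom⟩ : Σ i, (P i ⟶ X)) = ⟨i, x⟩ := by
        rw [← hx, ← hk]
        refine Eq.trans ?_ (NatTrans.naturality_apply e.hom W.hom _).symm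
        exact congrArg ((sumRepresentable P).map W.hom) hy.symm
      obtain ⟨rfl, h₂⟩ := Sigma.mk.inj_iff.1 h₁
      refine ⟨Over.homMk y (eq_of_heq h₂), Over.OverMorphism.ext ?_⟩
      apply uliftYonedaEquiv.injective
      change uliftYonedaEquiv (uliftYonedaEquiv.symm (e.inv.app W.left ⟨j, y⟩)) = _
      rw [Equiv.apply_symm_apply, ← hy]
      exact e.hom_inv_id_app_apply W.left _
  refine Functor.CorepresentableBy.isCorepresentable (X := Over.mk x)
    { homEquiv := fun {W} => Equiv.ofBijective (r W) (hr W)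
      homEquiv_comp := fun {W W'} f h => ?_ }
  refine Over.OverMorphism.ext (uliftYonedaEquiv.injective ?_)
  change uliftYonedaEquiv (uliftYonedaEquiv.symm (e.inv.app W'.left ⟨i, h.left ≫ f.left⟩)) =
    (F.map f.left).app (op c) (uliftYonedaEquiv (uliftYonedaEquiv.symm (e.inv.app W.left ⟨i, h.left⟩)))
  rw [Equiv.apply_symm_apply, Equiv.apply_symm_apply]
  exact NatTrans.naturality_apply e.inv f.left ⟨i, h.left⟩

/-- Every presheaf over `F X` is a colimit, taken over `F X`, of representables indexed by its
category of elements. The objects where a left adjoint is defined are closed under such colimits. -/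
theorem FamiliallyRepresentable.isLocalRightAdjoint [HasColimitsOfSize.{0, u} D]
    (hF : FamiliallyRepresentable F) : IsLocalRightAdjoint F := by
  intro X
  apply Functor.isRightAdjoint_of_leftAdjointObjIsDefined_eq_top
  ext Y
  simp only [Pi.top_apply, Prop.top_eq_true, iff_true]
  obtain ⟨Y, ⟨⟨⟩⟩, g⟩ := Y
  exact Functor.leftAdjointObjIsDefined_of_isColimit
    (F := Over.post (X := X) F) (Over.isColimitLiftCocone _ g (Presheaf.colimitOfRepresentable.{u} Y))
    fun j => leftAdjointObjIsDefined_post_uliftYoneda hF _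

end FamiliallyRepresentable

namespace TTStr

open WGAT

/-! ### The free theory as a type-and-term structure -/

variable {X Y : TTStr.{u}}

variable (X) in
/-- The underlying type-and-term structure of the free theory. -/
abbrev weak : TTStr.{u} := forget.obj (free X)

/-- The unique judgement in a class of derived judgements of the free theory. -/
def judg {v : HVertex} (w : (weak X).obj (op ((Paths.of _).obj v))) : Judgement (Sym X) :=
  Quotient.lift (s := (free X).elSetoid v) (fun J => J.1) (fun _ _ h => eq_of_cong h) w

theorem judg_injective {v : HVertex} {w w' : (weak X).obj (op ((Paths.of _).obj v))}
    (h : judg w = judg w') : w = w' := by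
  obtain ⟨J, rfl⟩ := cls_surjective w
  obtain ⟨K, rfl⟩ := cls_surjective w'
  exact congrArg _ (Subtype.ext h)

theorem judg_spec {v : HVertex} (w : (weak X).obj (op ((Paths.of _).obj v))) :
    Derivable (freeBasic X) (judg w) ∧ (judg w).body.kind = vKind v ∧
      (judg w).ctx.length = vLen v := by
  obtain ⟨J, rfl⟩ := cls_surjective w
  exact J.2

/-- The context of a derived type judgement, extended by the type. -/
def full {n : ℕ} (w : (weak X).obj (op ((Paths.of _).obj (.ty n)))) : Ctx (Sym X) :=
  headExpr (judg w) :: (judg w).ctx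

/-- The term of a derived term judgement. -/
def term {n : ℕ} (w : (weak X).obj (op ((Paths.of _).obj (.tm n)))) : Expr (Sym X) :=
  headExpr (judg w)

theorem judg_ty {n : ℕ} (w : (weak X).obj (op ((Paths.of _).obj (.ty n)))) :
    judg w = ⟨(judg w).ctx, .ty (headExpr (judg w))⟩ := eq_of_kind_ty (judg_spec w).2.1

theorem full_injective {n : ℕ} {w w' : (weak X).obj (op ((Paths.of _).obj (.ty n)))}
    (h : full w = full w') : w = w' := by
  obtain ⟨h₁, h₂⟩ := List.cons.inj h
  apply judg_injective
  rw [judg_ty w, judg_ty w', h₁, h₂]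

theorem length_full {n : ℕ} (w : (weak X).obj (op ((Paths.of _).obj (.ty n)))) :
    (full w).length = n + 1 := congrArg (· + 1) (judg_spec w).2.2

theorem okCtx_full {n : ℕ} (w : (weak X).obj (op ((Paths.of _).obj (.ty n)))) :
    OkCtx (full w) := by
  have := okJ_of_derivable (judg_spec w).1
  rw [judg_ty w] at this
  exact this

theorem exists_full {n : ℕ} {Γ : Ctx (Sym X)} (h : OkCtx Γ) (hl : Γ.length = n + 1) :
    ∃ w : (weak X).obj (op ((Paths.of _).obj (.ty n))), full w = Γ := by
  cases Γ with
  | nil => simp at hl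
  | cons T Γ => exact ⟨(free X).cls ⟨⟨Γ, .ty T⟩, h.derCtx, rfl, Nat.succ_injective hl⟩, rfl⟩

theorem full_bdTy {n : ℕ} (w : (weak X).obj (op ((Paths.of _).obj (.ty (n + 1))))) :
    full w = headExpr (judg w) :: full ((weak X).bdTy n w) := by
  obtain ⟨⟨J, hJ, h₁, h₂⟩, rfl⟩ := cls_surjective w
  obtain ⟨A, Γ, B, rfl, hl⟩ := exists_of_kind_ty_succ h₁ h₂
  rfl

theorem judg_tm {n : ℕ} (w : (weak X).obj (op ((Paths.of _).obj (.tm n)))) :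
    judg w = ⟨(judg ((weak X).bdTm n w)).ctx,
      .tm (term w) (headExpr (judg ((weak X).bdTm n w)))⟩ := by
  obtain ⟨⟨J, hJ, h₁, h₂⟩, rfl⟩ := cls_surjective w
  obtain ⟨Γ, t, A, rfl⟩ := exists_of_kind_tm h₁
  rfl

theorem tm_ext {n : ℕ} {w w' : (weak X).obj (op ((Paths.of _).obj (.tm n)))}
    (h : (weak X).bdTm n w = (weak X).bdTm n w') (h' : term w = term w') : w = w' := by
  apply judg_injective
  rw [judg_tm w, judg_tm w', h, h']

theorem okTm_term {n : ℕ} (w : (weak X).obj (op ((Paths.of _).obj (.tm n)))) :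
    OkTm (term w) (headExpr (judg ((weak X).bdTm n w))) := by
  have := okJ_of_derivable (judg_spec w).1
  rw [judg_tm w] at this
  exact this.2

theorem exists_tm {n : ℕ} (w : (weak X).obj (op ((Paths.of _).obj (.ty n)))) {t : Expr (Sym X)}
    (ht : OkTm t (headExpr (judg w))) :
    ∃ w' : (weak X).obj (op ((Paths.of _).obj (.tm n))), (weak X).bdTm n w' = w ∧ term w' = t :=
  ⟨(free X).cls ⟨⟨(judg w).ctx, .tm t (headExpr (judg w))⟩,
    derivable_tm_of_ok (okCtx_full w) ht, rfl, (judg_spec w).2.2⟩,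
    judg_injective (judg_ty w).symm, rfl⟩

/-! ### The action of maps -/

/-- The map of underlying type-and-term structures which extends a map. -/
noncomputable abbrev ext (g : X ⟶ weak Y) : weak X ⟶ weak Y :=
  forget.map (Quotient.mk _ (lift g) : free X ⟶ free Y)

/-- The expressions by which constants are interpreted. -/
noncomputable def repSym (g : X ⟶ weak Y) : Sym X → Expr (Sym Y) := repExpr g

theorem judg_ext (g : X ⟶ weak Y) {v : HVertex} (w : (weak X).obj (op ((Paths.of _).obj v))) :
    judg ((ext g).app _ w) = (judg w).mapExpr (Expr.interp (repSym g)) := by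
  obtain ⟨J, rfl⟩ := cls_surjective w
  rfl

theorem full_ext (g : X ⟶ weak Y) {n : ℕ} (w : (weak X).obj (op ((Paths.of _).obj (.ty n)))) :
    full ((ext g).app _ w) = (full w).map (Expr.interp (repSym g)) := by
  rw [full, judg_ext, full, judg_ty w]
  rfl

theorem term_ext (g : X ⟶ weak Y) {n : ℕ} (w : (weak X).obj (op ((Paths.of _).obj (.tm n)))) :
    term ((ext g).app _ w) = (term w).interp (repSym g) := by
  rw [term, judg_ext, judg_tm w]
  rfl

/-- Since classes in a free theory are singletons, the choice of representatives made in `repExpr`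
is forced, and the interpretation becomes computable from `g`. -/
theorem repSym_ty (g : X ⟶ weak Y) (a : TyEl X) :
    repSym g (.inl a) = headExpr (judg (g.app _ a.2)) := by
  rw [← (tyRep g a.1 a.2).2]
  rfl

theorem repSym_tm (g : X ⟶ weak Y) (f : TmEl X) :
    repSym g (.inr f) = term (g.app _ f.2) := by
  rw [← (exists_tmRep g f.1 f.2).choose_spec.1]
  rfl

/-- The action of the monad on maps. -/
noncomputable abbrev relabel (g : X ⟶ Y) : weak X ⟶ weak Y := ext (g ≫ gen Y)

theorem interp_relabel_ty (g : X ⟶ Y) {a : TyEl X} {l : List ℕ} (h : l.length = a.1) :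
    (Expr.appVars (.inl a) l).interp (repSym (g ≫ gen Y)) = .appVars (.inl (a.map g)) l := by
  have e : repSym (g ≫ gen Y) (.inl a) = (a.map g).decl := repSym_ty _ a
  rw [Expr.interp_appVars, e, TyEl.decl, Expr.rename_appVars]
  congr 1
  exact List.ext_getElem (by simp [TyEl.map, h]) (by simp +contextual)

theorem interp_relabel_tm (g : X ⟶ Y) {f : TmEl X} {l : List ℕ} (h : l.length = f.1) :
    (Expr.appVars (.inr f) l).interp (repSym (g ≫ gen Y)) = .appVars (.inr (f.map g)) l := by
  have e : repSym (g ≫ gen Y) (.inr f) = (f.map g).decl := repSym_tm _ f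
  rw [Expr.interp_appVars, e, TmEl.decl, Expr.rename_appVars]
  congr 1
  exact List.ext_getElem (by simp [TmEl.map, h]) (by simp +contextual)

theorem declAt_full {n : ℕ} (w : (weak X).obj (op ((Paths.of _).obj (.ty n)))) {i : ℕ}
    (hi : i < n + 1) : ∃ (a : TyEl X) (l : List ℕ), declAt (full w) i = some (.appVars (.inl a) l) := by
  obtain ⟨T, hT⟩ := exists_declAt (Γ := full w) (i := i) (by rwa [length_full])
  obtain ⟨a, l, rfl, -⟩ := (okCtx_full w).okTy_of_declAt hT
  exact ⟨a, l, hT⟩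

theorem declAt_relabel (g : X ⟶ Y) {n : ℕ} (w : (weak X).obj (op ((Paths.of _).obj (.ty n))))
    {i : ℕ} {a : TyEl X} {l : List ℕ} (h : declAt (full w) i = some (.appVars (.inl a) l)) :
    declAt (full ((relabel g).app _ w)) i = some (.appVars (.inl (a.map g)) l) := by
  rw [full_ext, declAt_map, h, Option.map_some, interp_relabel_ty g ((okCtx_full w).arity i h).1]

theorem full_ext_declAt {n : ℕ} {w w' : (weak X).obj (op ((Paths.of _).obj (.ty n)))}
    (h : ∀ i < n + 1, declAt (full w) i = declAt (full w') i) : w = w' := by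
  refine full_injective (ext_declAt fun i => ?_)
  by_cases hi : i < n + 1
  · exact h i hi
  · rw [declAt, declAt, List.getElem?_eq_none, List.getElem?_eq_none] <;> simp [length_full] <;> omega

theorem declAt_full_self {n : ℕ} (w : (weak X).obj (op ((Paths.of _).obj (.ty n)))) :
    declAt (full w) n = some (headExpr (judg w)) := by
  rw [full, declAt_cons, if_pos]
  exact (judg_spec w).2.2.symm

end TTStr

/-! ### Heaps as labelled contexts -/

namespace Heap

open TTStr

variable {n : ℕ} (φ : Heap n) {S : Set (Fin (n + 1))} {X Y : TTStr.{u}}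

theorem lt_self {i : Fin (n + 1)} (h : φ.1 i ≠ 0) : φ.1 i < i :=
  φ.2.2 i fun hi => h (by rw [hi, φ.2.1])

/-- The levels of the ancestors of a node. -/
def anc (i : Fin (n + 1)) : List ℕ :=
  -- Levels start at `0` and node `0` is the root, which stands for no variable; so node `k + 1` is
  -- the variable at level `k`.
  if _h : φ.1 i = 0 then [] else anc (φ.1 i) ++ [(φ.1 i).val - 1]
termination_by i.val
decreasing_by exact φ.lt_self _h

theorem exists_depth (i : Fin (n + 1)) : ∃ m, φ.depth i = m + 1 := by
  by_cases h : φ.1 i = 0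
  · exact ⟨0, φ.depth_of_eq_zero h⟩
  · exact ⟨_, φ.depth_of_ne_zero h⟩

/-- The type-element which labels a node. -/
noncomputable def label (x : φ.shape S ⟶ X) (i : Fin (n + 1)) (hi : i ≠ 0) : TyEl X :=
  ⟨φ.depth i - 1, x.app (op ((Paths.of _).obj (.ty (φ.depth i - 1)))) ⟨⟨i, hi, by
    obtain ⟨m, hm⟩ := φ.exists_depth i
    omega⟩⟩⟩

variable {φ}

theorem label_eq (x : φ.shape S ⟶ X) {i : Fin (n + 1)} (hi : i ≠ 0) {m : ℕ}
    (h : φ.depth i = m + 1) :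
    φ.label x i hi = ⟨m, x.app (op ((Paths.of _).obj (.ty m))) ⟨⟨i, hi, h⟩⟩⟩ := by
  obtain rfl : m = φ.depth i - 1 := by omega
  rfl

theorem bd_label_none (x : φ.shape S ⟶ X) {i : Fin (n + 1)} (hi : i ≠ 0) (h : φ.1 i = 0) :
    (φ.label x i hi).bd = none := by
  rw [label_eq x hi (φ.depth_of_eq_zero h)]
  rfl

theorem bd_label_some (x : φ.shape S ⟶ X) {i : Fin (n + 1)} (hi : i ≠ 0) (h : φ.1 i ≠ 0) :
    (φ.label x i hi).bd = some (φ.label x (φ.1 i) h) := by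
  obtain ⟨m, hm⟩ := φ.exists_depth (φ.1 i)
  rw [label_eq x hi ((φ.depth_of_ne_zero h).trans (congrArg (· + 1) hm)), label_eq x h hm]
  simp only [TyEl.bd, Option.some.injEq]
  congr 1
  exact (bdTy_app x m _).symm

/-- Maps out of a heap are determined by their labels. -/
theorem label_ext {x y : φ.shape S ⟶ X} (h : ∀ i hi, φ.label x i hi = φ.label y i hi)
    (h' : ∀ m i, x.app (op ((Paths.of _).obj (.tm m))) i = y.app _ i) : x = y := by
  refine TTStr.hom_ext fun v i => ?_
  cases v with
  | tm m => exact h' m i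
  | ty m =>
    obtain ⟨⟨i, hi, hd⟩⟩ := i
    have := h i hi
    rw [label_eq x hi hd, label_eq y hi hd] at this
    exact eq_of_heq (Sigma.mk.inj_iff.1 this).2

/-- A type-element as an element of given degree. -/
def _root_.WeakeningMonad.TTStr.TyEl.ofDeg (a : TyEl X) (m : ℕ) (h : a.1 = m) :
    X.obj (op ((Paths.of _).obj (.ty m))) := h ▸ a.2

theorem _root_.WeakeningMonad.TTStr.TyEl.mk_ofDeg (a : TyEl X) (m : ℕ) (h : a.1 = m) :
    (⟨m, a.ofDeg m h⟩ : TyEl X) = a := by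
  subst h; rfl

/-- A term-element as an element of given degree. -/
def _root_.WeakeningMonad.TTStr.TmEl.ofDeg (a : TmEl X) (m : ℕ) (h : a.1 = m) :
    X.obj (op ((Paths.of _).obj (.tm m))) := h ▸ a.2

theorem _root_.WeakeningMonad.TTStr.TmEl.mk_ofDeg (a : TmEl X) (m : ℕ) (h : a.1 = m) :
    (⟨m, a.ofDeg m h⟩ : TmEl X) = a := by
  subst h; rfl

/-- Needed to place each label in the component of the presheaf that belongs to its node: depth and
degree obey the same recursion along parents. -/
theorem depth_of_labels {lab : Fin (n + 1) → TyEl X}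
    (h₀ : ∀ i ≠ 0, φ.1 i = 0 → (lab i).bd = none)
    (h₁ : ∀ i ≠ 0, φ.1 i ≠ 0 → (lab i).bd = some (lab (φ.1 i))) (i : Fin (n + 1)) (hi : i ≠ 0) :
    φ.depth i = (lab i).1 + 1 := by
  induction i using WellFoundedLT.induction with
  | _ i ih =>
    by_cases h : φ.1 i = 0
    · rw [φ.depth_of_eq_zero h, TyEl.fst_of_bd_none (h₀ i hi h)]
    · rw [φ.depth_of_ne_zero h, ih _ (φ.lt_self h) h, TyEl.fst_of_bd (h₁ i hi h)]

/-- Compatible labels define a map out of a heap. -/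
theorem exists_hom_of_labels (lab : Fin (n + 1) → TyEl X)
    (h₀ : ∀ i ≠ 0, φ.1 i = 0 → (lab i).bd = none)
    (h₁ : ∀ i ≠ 0, φ.1 i ≠ 0 → (lab i).bd = some (lab (φ.1 i)))
    (tlab : ∀ i ∈ S, TmEl X) (ht : ∀ i hi, (tlab i hi).bd = lab i) :
    ∃ x : φ.shape S ⟶ X, (∀ i hi, φ.label x i hi = lab i) ∧
      ∀ i (hi : i ∈ S) m h, (⟨m, x.app (op ((Paths.of _).obj (.tm m))) ⟨⟨i, hi, h⟩⟩⟩ : TmEl X) =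
        tlab i hi := by
  have hd := depth_of_labels h₀ h₁
  have ht' (i hi) : (tlab i hi).1 = (lab i).1 := congrArg Sigma.fst (ht i hi)
  refine ⟨homOfFun (X := φ.shape S) (fun
    | .ty m => fun i => (lab i.down.1).ofDeg m (by
        have := hd _ i.down.2.1
        have := i.down.2.2
        omega)
    | .tm m => fun i => (tlab i.down.1 i.down.2.1).ofDeg m (by
        have := hd _ i.down.2.2.1
        have := i.down.2.2.2
        have := ht' _ i.down.2.1
        omega)) ?_ ?_, ?_, ?_⟩
  · rintro m ⟨i, hi, h⟩
    have hi' : φ.1 i ≠ 0 := fun h' => by simp [φ.depth_of_eq_zero h'] at h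
    have h₂ := h₁ i hi hi'
    rw [← TyEl.mk_ofDeg (lab i) (m + 1) (by have := hd i hi; omega)] at h₂
    rw [← TyEl.mk_ofDeg (lab (φ.1 i)) m (by
      have := TyEl.fst_of_bd (h₁ i hi hi'); have := hd i hi; omega)] at h₂
    exact (eq_of_heq (Sigma.mk.inj_iff.1 (Option.some_injective _ h₂)).2).symm
  · rintro m ⟨i, hi, hi', h⟩
    have h₂ := ht i hi
    have e : (lab i).1 = m := by have := hd i hi'; omega
    rw [← TyEl.mk_ofDeg (lab i) m e, ← TmEl.mk_ofDeg (tlab i hi) m ((ht' i hi).trans e)] at h₂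
    exact (eq_of_heq (Sigma.mk.inj_iff.1 h₂).2).symm
  · intro i hi
    obtain ⟨m, hm⟩ := φ.exists_depth i
    rw [label_eq _ hi hm]
    exact TyEl.mk_ofDeg (lab i) m _
  · intro i hi m h
    exact TmEl.mk_ofDeg (tlab i hi) m _

end Heap

namespace TTStr

theorem forget_map_freeFunctor_map {X Y : TTStr.{u}} (g : X ⟶ Y) :
    WGAT.forget.map (freeFunctor.map g) = relabel g := by
  have : freeFunctor.map g = Quotient.mk _ (lift (g ≫ gen Y)) := by
    change Quotient.mk _ (lift (g ≫ gen Y ≫ WGAT.forget.map (𝟙 _))) = _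
    rw [CategoryTheory.Functor.map_id, Category.comp_id]
    rfl
  rw [this]
  rfl

theorem forget_map_freeFunctor_map_apply {X Y : TTStr.{u}} (g : X ⟶ Y) (v : HVertex)
    (w : (weak X).obj (op ((Paths.of _).obj v))) :
    (WGAT.forget.map (freeFunctor.map g)).app (op ((Paths.of _).obj v)) w =
      (relabel g).app (op ((Paths.of _).obj v)) w :=
  congrArg (fun k : weak X ⟶ weak Y => k.app (op ((Paths.of _).obj v)) w)
    (forget_map_freeFunctor_map g)

end TTStr

/-! ### Derived judgements of the free theory as labelled heaps -/

namespace Heap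

open TTStr

variable {n : ℕ} {φ : Heap (n + 1)} {S : Set (Fin (n + 1 + 1))} {X Y : TTStr.{u}}

theorem anc_of_eq_zero {n : ℕ} {φ : Heap n} {i : Fin (n + 1)} (h : φ.1 i = 0) : φ.anc i = [] := by
  rw [anc, dif_pos h]

theorem anc_of_ne_zero {n : ℕ} {φ : Heap n} {i : Fin (n + 1)} (h : φ.1 i ≠ 0) :
    φ.anc i = φ.anc (φ.1 i) ++ [(φ.1 i).val - 1] := by
  rw [anc, dif_neg h]

theorem last_ne_zero {n : ℕ} : Fin.last (n + 1) ≠ 0 := Fin.last_pos.ne'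

/-- The context described by a labelled heap. -/
noncomputable def ctx (x : φ.shape S ⟶ X) : Ctx (Sym X) :=
  (List.ofFn fun i : Fin (n + 1) =>
    Expr.appVars (.inl (φ.label x i.succ i.succ_ne_zero)) (φ.anc i.succ)).reverse

theorem length_ctx (x : φ.shape S ⟶ X) : (ctx x).length = n + 1 := by simp [ctx]

theorem declAt_ctx (x : φ.shape S ⟶ X) (i : Fin (n + 1)) : declAt (ctx x) i =
    some (.appVars (.inl (φ.label x i.succ i.succ_ne_zero)) (φ.anc i.succ)) := by
  rw [declAt, ctx, List.reverse_reverse, List.getElem?_ofFn, dif_pos i.2]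

theorem okCtx_ctx (x : φ.shape S ⟶ X) : OkCtx (ctx x) := by
  refine okCtx_of_declAt fun i T h => ?_
  have hi := lt_of_declAt h
  rw [length_ctx] at hi
  obtain ⟨i, rfl⟩ : ∃ j : Fin (n + 1), j.val = i := ⟨⟨i, hi⟩, rfl⟩
  rw [declAt_ctx] at h
  obtain rfl := Option.some_injective _ h
  refine ⟨_, _, rfl, ?_⟩
  by_cases h₀ : φ.1 i.succ = 0
  · exact .inl ⟨bd_label_none x _ h₀, anc_of_eq_zero h₀⟩
  · obtain ⟨j, hj⟩ := Fin.exists_succ_eq.2 h₀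
    have hlt := φ.lt_self h₀
    rw [← hj, Fin.succ_lt_succ_iff] at hlt
    refine .inr ⟨j, hlt, _, _, declAt_ctx x j, ?_, ?_⟩
    · rw [bd_label_some x _ h₀]
      congr! 1
      congr 1
      exact hj.symm
    · rw [anc_of_ne_zero h₀, ← hj]
      simp

/-- The derived type judgement described by a labelled heap. -/
noncomputable def toTy (x : φ.shape S ⟶ X) : (weak X).obj (op ((Paths.of _).obj (.ty n))) :=
  (exists_full (okCtx_ctx x) (length_ctx x)).choose

theorem full_toTy (x : φ.shape S ⟶ X) : full (toTy x) = ctx x :=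
  (exists_full (okCtx_ctx x) (length_ctx x)).choose_spec

theorem declAt_toTy (x : φ.shape S ⟶ X) (i : Fin (n + 1)) : declAt (full (toTy x)) i =
    some (.appVars (.inl (φ.label x i.succ i.succ_ne_zero)) (φ.anc i.succ)) := by
  rw [full_toTy, declAt_ctx]

theorem toTy_comp (x : φ.shape S ⟶ X) (g : X ⟶ Y) :
    toTy (x ≫ g) = (relabel g).app _ (toTy x) := by
  refine full_ext_declAt fun i hi => ?_
  have h := declAt_relabel g _ (declAt_toTy x ⟨i, hi⟩)
  exact (declAt_toTy (x ≫ g) ⟨i, hi⟩).trans h.symm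

/-- The parent of a node is the last entry in its list of ancestors, and the root has an empty list
above its children. -/
theorem eq_of_anc {ψ : Heap (n + 1)} (h : ∀ i : Fin (n + 1), φ.anc i.succ = ψ.anc i.succ) :
    φ = ψ := by
  refine Subtype.ext (funext fun i => ?_)
  cases i using Fin.cases with
  | zero => rw [φ.2.1, ψ.2.1]
  | succ i =>
    have := h i
    by_cases h₁ : φ.1 i.succ = 0 <;> by_cases h₂ : ψ.1 i.succ = 0
    · rw [h₁, h₂]
    · simp [anc_of_eq_zero h₁, anc_of_ne_zero h₂] at this
    · simp [anc_of_ne_zero h₁, anc_of_eq_zero h₂] at this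
    · rw [anc_of_ne_zero h₁, anc_of_ne_zero h₂] at this
      have := (List.append_inj' this rfl).2
      simp only [List.cons.injEq, and_true] at this
      have h₁' := Fin.val_ne_zero_iff.2 h₁
      have h₂' := Fin.val_ne_zero_iff.2 h₂
      exact Fin.ext (by omega)

theorem eq_of_toTy_eq {ψ : Heap (n + 1)} {S' : Set (Fin (n + 1 + 1))} {x : φ.shape S ⟶ X}
    {y : ψ.shape S' ⟶ X} (h : toTy x = toTy y) : φ = ψ := by
  refine eq_of_anc fun i => ?_
  have h₁ := declAt_toTy x i
  rw [h, declAt_toTy y] at h₁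
  exact (Expr.appVars_injective (Option.some_injective _ h₁)).2.symm

theorem label_eq_of_toTy_eq {x y : φ.shape S ⟶ X} (h : toTy x = toTy y) (i hi) :
    φ.label x i hi = φ.label y i hi := by
  obtain ⟨i, rfl⟩ := Fin.exists_succ_eq.2 hi
  have h₁ := declAt_toTy x i
  rw [h, declAt_toTy y] at h₁
  exact (Sum.inl_injective (Expr.appVars_injective (Option.some_injective _ h₁)).1).symm

/-- Every derived type judgement is described by a labelled heap, whose labels may be extended
to term-elements. -/
theorem exists_toTy (w : (weak X).obj (op ((Paths.of _).obj (.ty n)))) :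
    ∃ (φ : Heap (n + 1)) (lab : Fin (n + 1 + 1) → TyEl X),
      (∀ i ≠ 0, φ.1 i = 0 → (lab i).bd = none) ∧
      (∀ i ≠ 0, φ.1 i ≠ 0 → (lab i).bd = some (lab (φ.1 i))) ∧
      ∀ i : Fin (n + 1), declAt (full w) i = some (.appVars (.inl (lab i.succ)) (φ.anc i.succ)) := by
  -- The node `q` is that of the last argument, or the root when there are no arguments; it becomes
  -- the parent of `i.succ`.
  have key (i : Fin (n + 1)) : ∃ (a : TyEl X) (l : List ℕ) (q : Fin (n + 1 + 1)), q < i.succ ∧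
      declAt (full w) i = some (.appVars (.inl a) l) ∧ (q = 0 → a.bd = none ∧ l = []) ∧
      ∀ j : Fin (n + 1), q = j.succ → ∃ a' l', declAt (full w) j = some (.appVars (.inl a') l') ∧
        a.bd = some a' ∧ l = l' ++ [j.val] := by
    obtain ⟨T, hT⟩ := exists_declAt (Γ := full w) (i := i) (by rw [length_full]; exact i.2)
    obtain ⟨a, l, rfl, h | ⟨j, hj, a', l', h⟩⟩ := (okCtx_full w).okTy_of_declAt hT
    · exact ⟨a, l, 0, Fin.succ_pos i, hT, fun _ => h, fun j hj => (Fin.succ_ne_zero j hj.symm).elim⟩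
    · refine ⟨a, l, Fin.succ ⟨j, hj.trans i.2⟩, Fin.succ_lt_succ_iff.2 hj, hT,
        fun h => (Fin.succ_ne_zero _ h).elim, fun k hk => ?_⟩
      obtain rfl := Fin.succ_injective _ hk
      exact ⟨a', l', h⟩
  choose a l q hq hal h₀ h₁ using key
  let φ : Heap (n + 1) := ⟨Fin.cases 0 q, rfl, fun i hi => by
    obtain ⟨i, rfl⟩ := Fin.exists_succ_eq.2 hi
    exact hq i⟩
  have hφ (i : Fin (n + 1)) : φ.1 i.succ = q i := rfl
  have h₁' (i j : Fin (n + 1)) (h : q i = j.succ) : (a i).bd = some (a j) ∧ l i = l j ++ [j.val] := by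
    obtain ⟨a', l', h₂, h₃, h₄⟩ := h₁ i j h
    rw [hal] at h₂
    obtain ⟨e₁, rfl⟩ := Expr.appVars_injective (Option.some_injective _ h₂)
    rw [Sum.inl_injective e₁]
    exact ⟨h₃, h₄⟩
  have hl (i : Fin (n + 1)) : l i = φ.anc i.succ := by
    induction i using WellFoundedLT.induction with
    | _ i ih =>
      by_cases h : q i = 0
      · rw [anc_of_eq_zero (by rw [hφ, h]), (h₀ i h).2]
      · obtain ⟨j, hj⟩ := Fin.exists_succ_eq.2 h
        have hlt := hq i
        rw [← hj, Fin.succ_lt_succ_iff] at hlt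
        rw [anc_of_ne_zero (by rwa [hφ]), hφ, ← hj, ← ih j hlt, (h₁' i j hj.symm).2]
        simp
  -- The label `a 0` at the root is a dummy, as labels only matter at nonzero nodes.
  refine ⟨φ, Fin.cases (a 0) a, fun i hi h => ?_, fun i hi h => ?_, fun i => ?_⟩
  · obtain ⟨i, rfl⟩ := Fin.exists_succ_eq.2 hi
    exact (h₀ i h).1
  · obtain ⟨i, rfl⟩ := Fin.exists_succ_eq.2 hi
    obtain ⟨j, hj⟩ := Fin.exists_succ_eq.2 h
    rw [← hj]
    exact (h₁' i j hj.symm).1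
  · rw [← hl]
    exact hal i

theorem toTy_eq {x : φ.shape S ⟶ X} {w : (weak X).obj (op ((Paths.of _).obj (.ty n)))}
    (h : ∀ i : Fin (n + 1), declAt (full w) i =
      some (.appVars (.inl (φ.label x i.succ i.succ_ne_zero)) (φ.anc i.succ))) : toTy x = w :=
  full_ext_declAt fun i hi => (declAt_toTy x ⟨i, hi⟩).trans (h ⟨i, hi⟩).symm

theorem bijective_toTy : Function.Bijective fun p : Σ φ : Heap (n + 1), (φ.tyShape ⟶ X) =>
    toTy p.2 := by
  constructor
  · rintro ⟨φ, x⟩ ⟨ψ, y⟩ h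
    obtain rfl := eq_of_toTy_eq h
    exact congrArg (Sigma.mk φ) (label_ext (label_eq_of_toTy_eq h) fun m i => i.down.2.1.elim)
  · intro w
    obtain ⟨φ, lab, h₀, h₁, h⟩ := exists_toTy w
    obtain ⟨x, hx, -⟩ := exists_hom_of_labels (S := ∅) lab h₀ h₁ (fun i hi => hi.elim)
      (fun i hi => hi.elim)
    refine ⟨⟨φ, x⟩, toTy_eq fun i => ?_⟩
    rw [h, hx]

/-- The term-element which labels the term adjoined to a heap. -/
noncomputable def termLabel (x : φ.shape {Fin.last (n + 1)} ⟶ X) : TmEl X :=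
  ⟨φ.depth (Fin.last _) - 1, x.app (op ((Paths.of _).obj (.tm (φ.depth (Fin.last _) - 1))))
    ⟨⟨Fin.last _, rfl, last_ne_zero, by
      obtain ⟨m, hm⟩ := φ.exists_depth (Fin.last _)
      omega⟩⟩⟩

theorem termLabel_eq (x : φ.shape {Fin.last (n + 1)} ⟶ X) {m : ℕ} (h : φ.depth (Fin.last _) = m + 1) :
    termLabel x = ⟨m, x.app (op ((Paths.of _).obj (.tm m)))
      ⟨⟨Fin.last _, rfl, last_ne_zero, h⟩⟩⟩ := by
  obtain rfl : m = φ.depth (Fin.last _) - 1 := by omega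
  rfl

theorem bd_termLabel (x : φ.shape {Fin.last (n + 1)} ⟶ X) :
    (termLabel x).bd = φ.label x (Fin.last _) last_ne_zero := by
  obtain ⟨m, hm⟩ := φ.exists_depth (Fin.last _)
  rw [label_eq x _ hm, termLabel_eq x hm]
  exact congrArg (Sigma.mk m) (bdTm_app x m _).symm

theorem headExpr_toTy (x : φ.shape S ⟶ X) : WGAT.headExpr (judg (toTy x)) =
    .appVars (.inl (φ.label x (Fin.last _) last_ne_zero)) (φ.anc (Fin.last _)) :=
  Option.some_injective _ ((declAt_full_self _).symm.trans (declAt_toTy x (Fin.last n)))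

theorem okTm_termLabel (x : φ.shape {Fin.last (n + 1)} ⟶ X) :
    OkTm (.appVars (.inr (termLabel x)) (φ.anc (Fin.last _))) (WGAT.headExpr (judg (toTy x))) :=
  ⟨_, _, rfl, by rw [headExpr_toTy, bd_termLabel]⟩

/-- The derived term judgement described by a labelled heap with a term adjoined. -/
noncomputable def toTm (x : φ.shape {Fin.last (n + 1)} ⟶ X) : (weak X).obj (op ((Paths.of _).obj (.tm n))) :=
  (exists_tm (toTy x) (okTm_termLabel x)).choose

theorem bdTm_toTm (x : φ.shape {Fin.last (n + 1)} ⟶ X) : (weak X).bdTm n (toTm x) = toTy x :=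
  (exists_tm (toTy x) (okTm_termLabel x)).choose_spec.1

theorem term_toTm (x : φ.shape {Fin.last (n + 1)} ⟶ X) :
    term (toTm x) = .appVars (.inr (termLabel x)) (φ.anc (Fin.last _)) :=
  (exists_tm (toTy x) (okTm_termLabel x)).choose_spec.2

theorem toTm_comp (x : φ.shape {Fin.last (n + 1)} ⟶ X) (g : X ⟶ Y) :
    toTm (x ≫ g) = (relabel g).app _ (toTm x) := by
  apply tm_ext
  · rw [bdTm_toTm, ← bdTm_app, bdTm_toTm]
    exact toTy_comp x g
  · rw [term_toTm, term_ext, term_toTm, interp_relabel_tm]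
    · rfl
    · have := ((okCtx_full (toTy x)).arity _ (declAt_toTy x (Fin.last n))).1
      exact this.trans (congrArg Sigma.fst (bd_termLabel x).symm)

/-- The arguments of a term are those of its type. Beyond the boundary, the only further datum is a
term-element over the label of the last node. -/
theorem bijective_toTm : Function.Bijective fun p : Σ φ : Heap (n + 1), (φ.tmShape ⟶ X) =>
    toTm p.2 := by
  constructor
  · rintro ⟨φ, x⟩ ⟨ψ, y⟩ h
    change toTm x = toTm y at h
    have h' : toTy (φ := φ) x = toTy (φ := ψ) y :=
      (bdTm_toTm x).symm.trans ((congrArg ((weak X).bdTm n) h).trans (bdTm_toTm y))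
    obtain rfl := eq_of_toTy_eq h'
    refine congrArg (Sigma.mk φ) (label_ext (label_eq_of_toTy_eq h') fun m i => ?_)
    have h'' := (term_toTm x).symm.trans ((congrArg term h).trans (term_toTm y))
    have := Sum.inr_injective (Expr.appVars_injective h'').1
    obtain ⟨⟨i, rfl, hi, hd⟩⟩ := i
    rw [termLabel_eq (φ := φ) x hd, termLabel_eq (φ := φ) y hd] at this
    exact eq_of_heq (Sigma.mk.inj_iff.1 this).2
  · intro w
    obtain ⟨φ, lab, h₀, h₁, h⟩ := exists_toTy ((weak X).bdTm n w)
    obtain ⟨f, l, h₂, h₃⟩ := okTm_term w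
    have h₄ := Option.some_injective _ ((h (Fin.last n)).symm.trans
      ((declAt_full_self _).trans (congrArg some h₃)))
    obtain ⟨h₄, h₅⟩ := Expr.appVars_injective h₄
    obtain ⟨x, hx, hx'⟩ := exists_hom_of_labels (S := {Fin.last (n + 1)}) lab h₀ h₁
      (fun i hi => f) (by
        rintro i rfl
        exact (Sum.inl_injective h₄).symm)
    have hw : toTy x = (weak X).bdTm n w := toTy_eq fun i => by rw [h, hx]
    refine ⟨⟨φ, x⟩, tm_ext ((bdTm_toTm _).trans hw) ?_⟩
    refine (term_toTm (φ := φ) x).trans ?_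
    obtain ⟨m, hm⟩ := φ.exists_depth (Fin.last (n + 1))
    rw [h₂, termLabel_eq (φ := φ) x hm, hx' _ rfl m ⟨last_ne_zero, hm⟩, ← h₅]
    rfl

/-- The type judgements of the free theory in context of given length, as a coproduct of
representables. -/
noncomputable def tyIso (n : ℕ) : sumRepresentable (fun φ : Heap (n + 1) => φ.tyShape) ≅
    (freeFunctor ⋙ WGAT.forget.{u}) ⋙
      (evaluation HCatᵒᵖ (Type u)).obj (op ((Paths.of _).obj (HVertex.ty n))) :=
  NatIso.ofComponents (fun X => (Equiv.ofBijective _ (bijective_toTy (X := X))).toIso)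
    fun g => by
      ext p
      exact (toTy_comp p.2 g).trans (forget_map_freeFunctor_map_apply g _ _).symm

/-- The term judgements of the free theory in context of given length, as a coproduct of
representables. -/
noncomputable def tmIso (n : ℕ) : sumRepresentable (fun φ : Heap (n + 1) => φ.tmShape) ≅
    (freeFunctor ⋙ WGAT.forget.{u}) ⋙
      (evaluation HCatᵒᵖ (Type u)).obj (op ((Paths.of _).obj (HVertex.tm n))) :=
  NatIso.ofComponents (fun X => (Equiv.ofBijective _ (bijective_toTm (X := X))).toIso)
    fun g => by
      ext p
      exact (toTm_comp p.2 g).trans (forget_map_freeFunctor_map_apply g _ _).symm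

end Heap

namespace TTStr

open WGAT

variable {X Y : TTStr.{u}}

/-! ### The unit is cartesian -/

/-- When all variables are arguments, the last argument is the last declared variable. Its type must
be the boundary of `A` applied to all earlier variables, and the argument repeats. -/
theorem ctx_eq_declCtx : ∀ (n : ℕ) (A : X.obj (op ((Paths.of _).obj (.ty n)))) {Γ : Ctx (Sym X)},
    Γ.length = n → OkCtx (.appVars (.inl ⟨n, A⟩) (List.range n) :: Γ) → Γ = declCtx n A
  | 0, _, _, h, _ => List.length_eq_zero_iff.1 h
  | n + 1, A, [], h, _ => by simp at h
  | n + 1, A, T :: Γ, h, hΓ => by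
    obtain ⟨hΓ, a, l, e, h'⟩ := hΓ
    obtain ⟨e', rfl⟩ := Expr.appVars_injective e
    obtain rfl := Sum.inl_injective e'
    obtain ⟨h', -⟩ | ⟨j, a', l', h₁, h₂, h₃⟩ := h'
    · simp [TyEl.bd] at h'
    · rw [List.range_succ] at h₃
      obtain ⟨rfl, h₄⟩ := List.append_inj' h₃ rfl
      simp only [List.cons.injEq, and_true] at h₄
      subst h₄
      have hl : Γ.length = n := Nat.succ_injective h
      rw [declAt_cons, if_pos hl.symm] at h₁
      obtain rfl := Option.some_injective _ h₁
      simp only [TyEl.bd, Option.some.injEq] at h₂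
      subst h₂
      rw [declCtx, ctx_eq_declCtx n _ hl hΓ]

theorem gen_ty_injective {n : ℕ} {A B : X.obj (op ((Paths.of _).obj (.ty n)))}
    (h : (gen X).app _ A = (gen X).app _ B) : A = B := by
  have h₁ : TyEl.decl (X := X) ⟨n, A⟩ = TyEl.decl ⟨n, B⟩ := congrArg (fun w => headExpr (judg w)) h
  have := Sum.inl_injective (Expr.appVars_injective h₁).1
  exact eq_of_heq (Sigma.mk.inj_iff.1 this).2

theorem gen_tm_injective {n : ℕ} {f g : X.obj (op ((Paths.of _).obj (.tm n)))}
    (h : (gen X).app _ f = (gen X).app _ g) : f = g := by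
  have h₁ : TmEl.decl (X := X) ⟨n, f⟩ = TmEl.decl ⟨n, g⟩ := congrArg term h
  have := Sum.inr_injective (Expr.appVars_injective h₁).1
  exact eq_of_heq (Sigma.mk.inj_iff.1 this).2

theorem eq_gen_of_headExpr {n : ℕ} {w : (weak X).obj (op ((Paths.of _).obj (.ty n)))}
    {A : X.obj (op ((Paths.of _).obj (.ty n)))}
    (h : headExpr (judg w) = TyEl.decl (X := X) ⟨n, A⟩) : (gen X).app _ A = w := by
  have hw := okCtx_full w
  rw [full, h] at hw
  refine full_injective ?_
  change TyEl.decl (X := X) ⟨n, A⟩ :: declCtx n A = headExpr (judg w) :: (judg w).ctx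
  rw [h, ctx_eq_declCtx n A (judg_spec w).2.2 hw]

theorem exists_headExpr {n : ℕ} (w : (weak X).obj (op ((Paths.of _).obj (.ty n)))) :
    ∃ (a : TyEl X) (l : List ℕ), headExpr (judg w) = .appVars (.inl a) l ∧ l.length = a.1 := by
  obtain ⟨a, l, h⟩ := declAt_full w (Nat.lt_succ_self n)
  refine ⟨a, l, ?_, ((okCtx_full w).arity _ h).1⟩
  rw [declAt_full_self] at h
  exact Option.some_injective _ h

theorem headExpr_ext (g : X ⟶ weak Y) {n : ℕ} (w : (weak X).obj (op ((Paths.of _).obj (.ty n)))) :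
    headExpr (judg ((ext g).app _ w)) = (headExpr (judg w)).interp (repSym g) :=
  (List.cons.inj (full_ext g w)).1

theorem headExpr_relabel (g : X ⟶ Y) {n : ℕ} {w : (weak X).obj (op ((Paths.of _).obj (.ty n)))}
    {a : TyEl X} {l : List ℕ} (h : headExpr (judg w) = .appVars (.inl a) l) :
    headExpr (judg ((relabel g).app _ w)) = .appVars (.inl (a.map g)) l := by
  obtain ⟨b, m, h', hl⟩ := exists_headExpr w
  obtain ⟨e, rfl⟩ := Expr.appVars_injective (h.symm.trans h')
  obtain rfl := Sum.inl_injective e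
  rw [headExpr_ext, h, interp_relabel_ty g hl]

theorem exists_term {n : ℕ} (w : (weak X).obj (op ((Paths.of _).obj (.tm n)))) :
    ∃ (f : TmEl X) (l : List ℕ), term w = .appVars (.inr f) l ∧
      headExpr (judg ((weak X).bdTm n w)) = .appVars (.inl f.bd) l ∧ l.length = f.1 := by
  obtain ⟨f, l, h₁, h₂⟩ := okTm_term w
  obtain ⟨b, m, h', hl⟩ := exists_headExpr ((weak X).bdTm n w)
  obtain ⟨e, rfl⟩ := Expr.appVars_injective (h₂.symm.trans h')
  obtain rfl := Sum.inl_injective e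
  exact ⟨f, l, h₁, h₂, hl⟩

theorem term_relabel (g : X ⟶ Y) {n : ℕ} {w : (weak X).obj (op ((Paths.of _).obj (.tm n)))}
    {f : TmEl X} {l : List ℕ} (h : term w = .appVars (.inr f) l) :
    term ((relabel g).app _ w) = .appVars (.inr (f.map g)) l := by
  obtain ⟨b, m, h', -, hl⟩ := exists_term w
  obtain ⟨e, rfl⟩ := Expr.appVars_injective (h.symm.trans h')
  obtain rfl := Sum.inr_injective e
  rw [term_ext, h, interp_relabel_tm g hl]

theorem gen_naturality (g : X ⟶ Y) : gen X ≫ relabel g = g ≫ gen Y := gen_comp_lift _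

/-- Relabelling keeps the variables, so the type in `w` is already applied to all variables of its
context, which makes `w` generic. -/
theorem exists_gen_ty (g : X ⟶ Y) {n : ℕ} {w : (weak X).obj (op ((Paths.of _).obj (.ty n)))}
    {B : Y.obj (op ((Paths.of _).obj (.ty n)))} (h : (relabel g).app _ w = (gen Y).app _ B) :
    ∃ A, (gen X).app _ A = w ∧ g.app _ A = B := by
  obtain ⟨a, l, hl, -⟩ := exists_headExpr w
  have h₁ := headExpr_relabel g hl
  rw [h] at h₁
  obtain ⟨e, rfl⟩ := Expr.appVars_injective (h₁.symm.trans (rfl : _ = TyEl.decl (X := Y) ⟨n, B⟩))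
  have e := Sum.inl_injective e
  obtain ⟨m, A⟩ := a
  obtain ⟨rfl, e⟩ := Sigma.mk.inj_iff.1 e
  exact ⟨A, eq_gen_of_headExpr hl, eq_of_heq e⟩

theorem exists_gen_tm (g : X ⟶ Y) {n : ℕ} {w : (weak X).obj (op ((Paths.of _).obj (.tm n)))}
    {b : Y.obj (op ((Paths.of _).obj (.tm n)))} (h : (relabel g).app _ w = (gen Y).app _ b) :
    ∃ f, (gen X).app _ f = w ∧ g.app _ f = b := by
  obtain ⟨f, l, h₁, h₂, -⟩ := exists_term w
  have h₃ := term_relabel g h₁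
  rw [h] at h₃
  obtain ⟨e, rfl⟩ := Expr.appVars_injective (h₃.symm.trans (rfl : _ = TmEl.decl (X := Y) ⟨n, b⟩))
  have e := Sum.inr_injective e
  obtain ⟨m, f⟩ := f
  obtain ⟨rfl, e⟩ := Sigma.mk.inj_iff.1 e
  refine ⟨f, tm_ext ?_ h₁.symm, eq_of_heq e⟩
  rw [← bdTm_app]
  exact eq_gen_of_headExpr h₂

theorem isPullback_gen (g : X ⟶ Y) : IsPullback (gen X) g (relabel g) (gen Y) := by
  refine IsPullback.of_forall_isPullback_app fun ⟨v⟩ => (Types.isPullback_iff _ _ _ _).2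
    ⟨NatTrans.congr_app (gen_naturality g) _, ?_, ?_⟩
  · rintro x y ⟨h, -⟩
    cases v with
    | ty n => exact gen_ty_injective h
    | tm n => exact gen_tm_injective h
  · intro w b h
    cases v with
    | ty n => exact exists_gen_ty g h
    | tm n => exact exists_gen_tm g h

/-! ### The multiplication is cartesian -/

/-- The context `Γ` is the restriction of `Θ` to the levels in the list `a`. -/
def Along (Γ Θ : Ctx (Sym X)) (a : List ℕ) : Prop :=
  ∀ k T, declAt Γ k = some T → ∃ q, a[k]? = some q ∧
    declAt Θ q = some (T.rename fun i => a.getD i 0)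

theorem OkCtx.scoped {Γ : Ctx (Sym X)} (hΓ : OkCtx Γ) {i : ℕ} {T : Expr (Sym X)}
    (h : declAt Γ i = some T) : T.Scoped i := by
  obtain ⟨a, l, rfl, -⟩ := hΓ.okTy_of_declAt h
  exact Expr.scoped_appVars (hΓ.arity i h).2

theorem OkCtx.scoped_head {Γ : Ctx (Sym X)} {T : Expr (Sym X)} (h : OkCtx (T :: Γ)) :
    T.Scoped Γ.length := h.scoped (declAt_cons_length _ _)

theorem rename_getD_append {T : Expr (Sym X)} {n : ℕ} (h : T.Scoped n) {a : List ℕ}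
    (hn : n ≤ a.length) (b : List ℕ) :
    T.rename (fun i => (a ++ b).getD i 0) = T.rename fun i => a.getD i 0 :=
  Expr.rename_congr (fun i hi => by
    rw [List.getD_append _ _ _ _ (hi.trans_le hn)]) h

/-- Makes `Along` recursive along boundaries. The new level does not disturb earlier types, because
by scoping they never look it up. -/
theorem along_cons_iff {Γ Θ : Ctx (Sym X)} {a : List ℕ} {i : ℕ} {T : Expr (Sym X)}
    (hT : OkCtx (T :: Γ)) (hl : Γ.length = a.length) : Along (T :: Γ) Θ (a ++ [i]) ↔
      Along Γ Θ a ∧ declAt Θ i = some (T.rename fun i => a.getD i 0) := by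
  constructor
  · intro h
    constructor
    · intro k S hS
      have hk := lt_of_declAt hS
      obtain ⟨q, h₁, h₂⟩ := h k S (by rwa [declAt_cons_of_lt hk])
      rw [rename_getD_append (hT.1.scoped hS) (by omega)] at h₂
      rw [List.getElem?_append_left (by omega)] at h₁
      exact ⟨q, h₁, h₂⟩
    · obtain ⟨q, h₁, h₂⟩ := h _ T (declAt_cons_length Γ T)
      rw [rename_getD_append hT.scoped_head hl.le] at h₂
      rw [hl, List.getElem?_concat_length] at h₁
      obtain rfl := Option.some_injective _ h₁
      exact h₂
  · rintro ⟨h, h'⟩ k S hS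
    rw [declAt_cons] at hS
    split_ifs at hS with hk
    · obtain rfl := Option.some_injective _ hS
      refine ⟨i, by rw [hk, hl, List.getElem?_concat_length], ?_⟩
      rw [rename_getD_append hT.scoped_head hl.le, h']
    · have hk' := lt_of_declAt hS
      obtain ⟨q, h₁, h₂⟩ := h k S hS
      refine ⟨q, by rwa [List.getElem?_append_left (by omega)], ?_⟩
      rwa [rename_getD_append (hT.1.scoped hS) (by omega)]

/-- The extended context of a type-element of the free theory. -/
def TyEl.full (b : TyEl (weak X)) : Ctx (Sym X) := TTStr.full b.2

/-- The type of a type-element of the free theory. -/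
def TyEl.head (b : TyEl (weak X)) : Expr (Sym X) := headExpr (judg b.2)

theorem TyEl.length_full (b : TyEl (weak X)) : b.full.length = b.1 + 1 := TTStr.length_full _

theorem TyEl.full_injective {b b' : TyEl (weak X)} (h : b.full = b'.full) : b = b' := by
  have hl := congrArg List.length h
  rw [TyEl.length_full, TyEl.length_full] at hl
  obtain ⟨n, b⟩ := b
  obtain ⟨n', b'⟩ := b'
  obtain rfl : n = n' := Nat.succ_injective hl
  exact congrArg (Sigma.mk n) (TTStr.full_injective h)

theorem TyEl.exists_full {Γ : Ctx (Sym X)} {T : Expr (Sym X)} (h : OkCtx (T :: Γ)) :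
    ∃ b : TyEl (weak X), b.full = T :: Γ := by
  obtain ⟨w, hw⟩ := TTStr.exists_full h rfl
  exact ⟨⟨_, w⟩, hw⟩

theorem TyEl.okCtx_full (b : TyEl (weak X)) : OkCtx b.full := TTStr.okCtx_full _

theorem TyEl.full_of_bd {b b' : TyEl (weak X)} (h : b.bd = some b') :
    b.full = b.head :: b'.full := by
  obtain ⟨_ | n, b⟩ := b
  · simp [TyEl.bd] at h
  · simp only [TyEl.bd, Option.some.injEq] at h
    subst h
    exact full_bdTy b

theorem TyEl.full_of_bd_none {b : TyEl (weak X)} (h : b.bd = none) : b.full = [b.head] := by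
  have hl := b.length_full
  rw [TyEl.fst_of_bd_none h] at hl
  obtain ⟨T, hT⟩ := List.length_eq_one_iff.1 hl
  rw [hT]
  exact congrArg (fun S => [S]) (List.cons.inj hT).1.symm

theorem TyEl.full_map (g : X ⟶ Y) (b : TyEl (weak X)) :
    (b.map (relabel g)).full = b.full.map (Expr.interp (repSym (g ≫ gen Y))) := full_ext _ _

theorem TyEl.declAt_map (g : X ⟶ Y) {b : TyEl (weak X)} {i : ℕ} {a : TyEl X} {l : List ℕ}
    (h : declAt b.full i = some (.appVars (.inl a) l)) :
    declAt (b.map (relabel g)).full i = some (.appVars (.inl (a.map g)) l) :=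
  declAt_relabel g b.2 h

/-- A type-element of the free theory is determined by its relabelling and by its restriction
property. -/
theorem TyEl.eq_of_along {g : X ⟶ Y} {b b' : TyEl (weak X)} {Θ : Ctx (Sym X)} {a : List ℕ}
    (h : b.map (relabel g) = b'.map (relabel g)) (hb : Along b.full Θ a)
    (hb' : Along b'.full Θ a) : b = b' := by
  have hl : b.1 = b'.1 := congrArg (fun c : TyEl (weak Y) => c.1) h
  refine TyEl.full_injective (ext_declAt fun i => ?_)
  by_cases hi : i < b.1 + 1
  · obtain ⟨c, l, h₁⟩ := declAt_full b.2 hi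
    obtain ⟨c', l', h₁'⟩ := declAt_full b'.2 (hl ▸ hi)
    have h₂ := TyEl.declAt_map g (b := b) h₁
    rw [h, TyEl.declAt_map g (b := b') h₁'] at h₂
    -- The common relabelling gives equal arguments; the labels are then read off `Θ` at the level
    -- prescribed by `a`.
    obtain ⟨-, rfl⟩ := Expr.appVars_injective (Option.some_injective _ h₂)
    obtain ⟨q, hq, h₃⟩ := hb _ _ h₁
    obtain ⟨q', hq', h₃'⟩ := hb' _ _ h₁'
    obtain rfl := Option.some_injective _ (hq.symm.trans hq')
    rw [h₃, Expr.rename_appVars, Expr.rename_appVars] at h₃'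
    obtain ⟨e, -⟩ := Expr.appVars_injective (Option.some_injective _ h₃')
    obtain rfl := Sum.inl_injective e
    exact h₁.trans h₁'.symm
  · rw [declAt, declAt, List.getElem?_eq_none, List.getElem?_eq_none] <;>
      rw [List.length_reverse, TyEl.length_full] <;> omega

/-- The multiplication. -/
noncomputable abbrev mult (X : TTStr.{u}) : weak (weak X) ⟶ weak X := ext (𝟙 (weak X))

theorem interp_mult_ty (b : TyEl (weak X)) (l : List ℕ) :
    (Expr.appVars (.inl b) l).interp (repSym (𝟙 (weak X))) =
      b.head.rename fun i => l.getD i 0 := by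
  have e : repSym (𝟙 (weak X)) (.inl b) = b.head := repSym_ty _ b
  rw [Expr.interp_appVars, e]

theorem interp_mult_tm (f : TmEl (weak X)) (l : List ℕ) :
    (Expr.appVars (.inr f) l).interp (repSym (𝟙 (weak X))) =
      (term f.2).rename fun i => l.getD i 0 := by
  have e : repSym (𝟙 (weak X)) (.inr f) = term f.2 := repSym_tm _ f
  rw [Expr.interp_appVars, e]

theorem declAt_mult {n : ℕ} {P : (weak (weak X)).obj (op ((Paths.of _).obj (.ty n)))} {i : ℕ}
    {b : TyEl (weak X)} {l : List ℕ} (h : declAt (full P) i = some (.appVars (.inl b) l)) :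
    declAt (full ((mult X).app _ P)) i = some (b.head.rename fun i => l.getD i 0) := by
  rw [full_ext, declAt_map, h, Option.map_some, interp_mult_ty]

/-- Flattening a single level only records the last type of `b`. The earlier types of `b` form its
boundary, which labels the parent of `i`, so they appear at the levels in `l` by induction. -/
theorem along_mult {n : ℕ} (P : (weak (weak X)).obj (op ((Paths.of _).obj (.ty n)))) (i : ℕ) :
    ∀ {b : TyEl (weak X)} {l : List ℕ}, declAt (full P) i = some (.appVars (.inl b) l) →
      Along b.full (full ((mult X).app _ P)) (l ++ [i]) := by
  induction i using Nat.strong_induction_on with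
  | _ i ih =>
    intro b l h
    have hl := (okCtx_full P).arity i h
    have hb := b.okCtx_full
    have hlen := b.length_full
    obtain ⟨b', l', e, h'⟩ := (okCtx_full P).okTy_of_declAt h
    obtain ⟨e', rfl⟩ := Expr.appVars_injective e
    obtain rfl := Sum.inl_injective e'
    obtain ⟨h₁, rfl⟩ | ⟨j, hj, b', l', h₁, h₂, rfl⟩ := h'
    · rw [TyEl.full_of_bd_none h₁] at hb ⊢
      exact (along_cons_iff hb rfl).2 ⟨fun k T hk => by simp [declAt] at hk, declAt_mult h⟩
    · rw [TyEl.full_of_bd h₂] at hb hlen ⊢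
      exact (along_cons_iff hb (by rw [hl.1]; exact Nat.succ_injective hlen)).2
        ⟨ih j hj h₁, declAt_mult h⟩

/-- Both sides come from morphisms out of `free (weak X)`, and on generators both reduce to `relabel
g`. -/
theorem mult_naturality (g : X ⟶ Y) :
    mult X ≫ relabel g = relabel (relabel g) ≫ mult Y := by
  have h (Z : TTStr.{u}) : gen (weak Z) ≫ mult Z = 𝟙 _ := gen_comp_lift _
  have h' : (Quotient.mk _ (lift (𝟙 (weak X))) ≫ Quotient.mk _ (lift (g ≫ gen Y)) :
        free (weak X) ⟶ free Y) =
      Quotient.mk _ (lift (relabel g ≫ gen (weak Y))) ≫ Quotient.mk _ (lift (𝟙 (weak Y))) := by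
    refine hom_free_ext ?_
    rw [Functor.map_comp, Functor.map_comp]
    calc gen (weak X) ≫ mult X ≫ relabel g = relabel g := by rw [reassoc_of% h]
      _ = gen (weak X) ≫ relabel (relabel g) ≫ mult Y := by
        rw [← Category.assoc, gen_naturality, Category.assoc, h, Category.comp_id]
  have := congrArg forget.map h'
  rwa [Functor.map_comp, Functor.map_comp] at this

/-- The relabelled judgement determines the arguments. Each label is then determined by its
relabelling together with the common flattening. -/
theorem mult_ty_injective (g : X ⟶ Y) {n : ℕ}
    {P P' : (weak (weak X)).obj (op ((Paths.of _).obj (.ty n)))}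
    (h : (mult X).app _ P = (mult X).app _ P')
    (h' : (relabel (relabel g)).app _ P = (relabel (relabel g)).app _ P') : P = P' := by
  refine full_ext_declAt fun i hi => ?_
  obtain ⟨b, l, h₁⟩ := declAt_full P hi
  obtain ⟨b', l', h₁'⟩ := declAt_full P' hi
  have h₂ := declAt_relabel (relabel g) P h₁
  rw [h', declAt_relabel (relabel g) P' h₁'] at h₂
  obtain ⟨e, rfl⟩ := Expr.appVars_injective (Option.some_injective _ h₂)
  have h₃ := along_mult P i h₁
  rw [h] at h₃
  obtain rfl := TyEl.eq_of_along (Sum.inl_injective e).symm h₃ (along_mult P' i h₁')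
  rw [h₁, h₁']

/-- Lifts a label of `P` from Y to X. The lift of the parent's label exists by induction; it is
extended by the constant `c` found at level `i` of `w`, with the arguments `m` found in `b`. It
remains to see that `c` has the right boundary, which is checked in `w`. -/
theorem exists_along (g : X ⟶ Y) {n : ℕ} {w : (weak X).obj (op ((Paths.of _).obj (.ty n)))}
    {P : (weak (weak Y)).obj (op ((Paths.of _).obj (.ty n)))}
    (h : (relabel g).app _ w = (mult Y).app _ P) (i : ℕ) :
    ∀ {b : TyEl (weak Y)} {l : List ℕ}, declAt (full P) i = some (.appVars (.inl b) l) →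
      ∃ b' : TyEl (weak X), b'.map (relabel g) = b ∧ Along b'.full (full w) (l ++ [i]) := by
  induction i using Nat.strong_induction_on with
  | _ i ih =>
    intro b l hb
    have hi := lt_of_declAt hb
    rw [length_full] at hi
    have hl := ((okCtx_full P).arity i hb).1
    obtain ⟨c, s, hc⟩ := declAt_full w hi
    obtain ⟨e, m, he, hm⟩ := exists_headExpr b.2
    change b.head = _ at he
    -- Comparing level `i` of both sides of `h` shows that the last type of `b` has constant `c.map
    -- g`, and that the arguments of `c` in `w` are `m` renamed along `l`.
    have h₁ := declAt_relabel g w hc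
    rw [h, declAt_mult hb, he, Expr.rename_appVars] at h₁
    obtain ⟨h₂, rfl⟩ := Expr.appVars_injective (Option.some_injective _ h₁)
    obtain rfl := Sum.inl_injective h₂
    have hc' : declAt (full w) i =
        some ((Expr.appVars (.inl c) m).rename fun i => l.getD i 0) := by
      rw [hc, Expr.rename_appVars]
    have hmap : (Expr.appVars (.inl c) m).interp (repSym (g ≫ gen Y)) = b.head := by
      rw [he, interp_relabel_ty g hm]
    have hbok := b.okCtx_full
    have hlen := b.length_full
    obtain ⟨b₀, l₀, e₀, h'⟩ := (okCtx_full P).okTy_of_declAt hb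
    obtain ⟨e₀', rfl⟩ := Expr.appVars_injective e₀
    obtain rfl := Sum.inl_injective e₀'
    obtain ⟨hbd, rfl⟩ | ⟨j, hj, b₁, l₁, hj₁, hj₂, rfl⟩ := h'
    · rw [TyEl.full_of_bd_none hbd, he] at hbok
      obtain ⟨-, a, m', e₁, h₃⟩ := hbok
      obtain ⟨e₂, rfl⟩ := Expr.appVars_injective e₁
      obtain rfl := Sum.inl_injective e₂
      obtain ⟨h₃, rfl⟩ | ⟨k, _, _, hk, _⟩ := h₃
      · rw [TyEl.bd_map, Option.map_eq_none_iff] at h₃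
        have hok : OkCtx [Expr.appVars (.inl c) []] := ⟨trivial, c, [], rfl, .inl ⟨h₃, rfl⟩⟩
        obtain ⟨b', hb'⟩ := TyEl.exists_full hok
        refine ⟨b', TyEl.full_injective ?_, ?_⟩
        · rw [TyEl.full_map, hb', TyEl.full_of_bd_none hbd, ← hmap]
          rfl
        · rw [hb']
          exact (along_cons_iff hok rfl).2 ⟨fun k T hk => by simp [declAt] at hk, hc'⟩
      · simp [declAt] at hk
    · obtain ⟨b₁', hb₁', hal⟩ := ih j hj hj₁
      rw [TyEl.full_of_bd hj₂, he] at hbok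
      rw [TyEl.full_of_bd hj₂, List.length_cons] at hlen
      have hlen₁ : b₁.1 = b₁'.1 := (congrArg Sigma.fst hb₁').symm
      have hok : OkCtx (Expr.appVars (.inl c) m :: b₁'.full) := by
        refine ⟨b₁'.okCtx_full, c, m, rfl, ?_⟩
        obtain ⟨-, a, m', e₁, h₃⟩ := hbok
        obtain ⟨e₂, rfl⟩ := Expr.appVars_injective e₁
        obtain rfl := Sum.inl_injective e₂
        obtain ⟨h₃, rfl⟩ | ⟨k, e', m'', hk, h₃, rfl⟩ := h₃
        · rw [TyEl.bd_map, Option.map_eq_none_iff] at h₃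
          exact .inl ⟨h₃, rfl⟩
        · have hk' := lt_of_declAt hk
          rw [TyEl.length_full, hlen₁] at hk'
          obtain ⟨c', m₃, hk₂⟩ := declAt_full b₁'.2 hk'
          have hk₃ := TyEl.declAt_map g (b := b₁') hk₂
          rw [hb₁', hk] at hk₃
          obtain ⟨-, rfl⟩ := Expr.appVars_injective (Option.some_injective _ hk₃)
          obtain ⟨q, hq, hq'⟩ := hal _ _ hk₂
          refine .inr ⟨k, c', m'', hk₂, ?_, rfl⟩
          -- In `w` the boundary of `c` labels its last argument. This is the level `q`
          -- corresponding to `k`, where `Along` locates the label `c'`.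
          obtain ⟨c₀, s₀, e₃, h₄⟩ := (okCtx_full w).okTy_of_declAt hc
          obtain ⟨e₄, rfl⟩ := Expr.appVars_injective e₃
          obtain rfl := Sum.inl_injective e₄
          obtain ⟨-, h₄⟩ | ⟨p, hp, c₁, s₁, h₄, h₅, h₆⟩ := h₄
          · simp at h₄
          · rw [List.map_append] at h₆
            obtain ⟨rfl, h₇⟩ := List.append_inj' h₆ rfl
            rw [List.map_singleton, List.getD_eq_getElem?_getD, hq, Option.getD_some] at h₇
            simp only [List.cons.injEq, and_true] at h₇
            subst h₇
            rw [hq', Expr.rename_appVars] at h₄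
            rw [h₅, Sum.inl_injective (Expr.appVars_injective (Option.some_injective _ h₄)).1]
      obtain ⟨b', hb'⟩ := TyEl.exists_full hok
      refine ⟨b', TyEl.full_injective ?_, ?_⟩
      · rw [TyEl.full_map, hb', TyEl.full_of_bd hj₂, ← hmap, ← hb₁', TyEl.full_map]
        rfl
      · rw [hb']
        refine (along_cons_iff hok ?_).2 ⟨hal, hc'⟩
        rw [TyEl.length_full] at hlen ⊢
        omega

/-- The preimage keeps the arguments of `P` and uses the labels lifted by `exists_along`. -/
theorem exists_mult_ty (g : X ⟶ Y) {n : ℕ} {w : (weak X).obj (op ((Paths.of _).obj (.ty n)))}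
    {P : (weak (weak Y)).obj (op ((Paths.of _).obj (.ty n)))}
    (h : (relabel g).app _ w = (mult Y).app _ P) :
    ∃ P' : (weak (weak X)).obj (op ((Paths.of _).obj (.ty n))),
      (mult X).app _ P' = w ∧ (relabel (relabel g)).app _ P' = P := by
  choose b l hb using fun i : Fin (n + 1) => declAt_full P i.2
  choose b' hb' hal using fun i : Fin (n + 1) => exists_along g h i (hb i)
  have hl (i) : (l i).length = (b i).1 := ((okCtx_full P).arity i (hb i)).1
  have hdeg (i) : (b' i).1 = (b i).1 := congrArg Sigma.fst (hb' i)
  let Γ : Ctx (Sym (weak X)) :=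
    (List.ofFn fun i : Fin (n + 1) => Expr.appVars (.inl (b' i)) (l i)).reverse
  have hΓ (i : Fin (n + 1)) : declAt Γ i = some (.appVars (.inl (b' i)) (l i)) := by
    rw [declAt, List.reverse_reverse, List.getElem?_ofFn, dif_pos i.2]
  have hlen : Γ.length = n + 1 := by simp [Γ]
  have hok : OkCtx Γ := by
    refine okCtx_of_declAt fun i T hT => ?_
    have hi := lt_of_declAt hT
    rw [hlen] at hi
    obtain ⟨i, rfl⟩ : ∃ j : Fin (n + 1), j.val = i := ⟨⟨i, hi⟩, rfl⟩
    rw [hΓ] at hT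
    obtain rfl := Option.some_injective _ hT
    refine ⟨_, _, rfl, ?_⟩
    obtain ⟨b₀, l₀, e₀, h'⟩ := (okCtx_full P).okTy_of_declAt (hb i)
    obtain ⟨e₀, e₁⟩ := Expr.appVars_injective e₀
    rw [← Sum.inl_injective e₀, ← e₁] at h'
    rw [← hb' i, TyEl.bd_map] at h'
    obtain ⟨h₁, h₂⟩ | ⟨j, hj, b₁, l₁, h₁, h₂, h₃⟩ := h'
    · exact .inl ⟨Option.map_eq_none_iff.1 h₁, h₂⟩
    · obtain ⟨j, rfl⟩ : ∃ k : Fin (n + 1), k.val = j := ⟨⟨j, hj.trans hi⟩, rfl⟩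
      rw [hb j] at h₁
      obtain ⟨e₂, rfl⟩ := Expr.appVars_injective (Option.some_injective _ h₁)
      obtain rfl := Sum.inl_injective e₂
      obtain ⟨b₂, h₄, h₅⟩ := Option.map_eq_some_iff.1 h₂
      refine .inr ⟨j, hj, b' j, l j, hΓ j, ?_, h₃⟩
      rw [h₄]
      congr 1
      -- The lifts were chosen independently at each level. The boundary of the lift at `i` and the
      -- lift at `j` agree because both lie over the same label and restrict `w` along the same
      -- list.
      refine TyEl.eq_of_along (h₅.trans (hb' j).symm) ?_ (hal j)
      have h₆ := hal i
      have h₇ := (b' i).okCtx_full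
      have h₈ := (b' i).length_full
      rw [TyEl.full_of_bd h₄] at h₆ h₇ h₈
      rw [← h₃]
      refine ((along_cons_iff h₇ ?_).1 h₆).1
      rw [hl, ← hdeg]
      exact Nat.succ_injective h₈
  obtain ⟨P', hP'⟩ := exists_full hok hlen
  rw [← hP'] at hΓ
  refine ⟨P', full_ext_declAt fun i hi => ?_, full_ext_declAt fun i hi => ?_⟩
  · obtain ⟨i, rfl⟩ : ∃ j : Fin (n + 1), j.val = i := ⟨⟨i, hi⟩, rfl⟩
    rw [declAt_mult (hΓ i)]
    have h₆ := hal i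
    have h₇ := (b' i).okCtx_full
    have h₈ : (judg (b' i).2).ctx.length = (b' i).1 := (judg_spec (b' i).2).2.2
    exact ((along_cons_iff h₇ (by rw [hl, ← hdeg, h₈])).1 h₆).2.symm
  · obtain ⟨i, rfl⟩ : ∃ j : Fin (n + 1), j.val = i := ⟨⟨i, hi⟩, rfl⟩
    rw [declAt_relabel (relabel g) P' (hΓ i), hb', hb]

theorem term_mult {n : ℕ} {P : (weak (weak X)).obj (op ((Paths.of _).obj (.tm n)))}
    {f : TmEl (weak X)} {l : List ℕ} (h : term P = .appVars (.inr f) l) :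
    term ((mult X).app _ P) = (term f.2).rename fun i => l.getD i 0 := by
  rw [term_ext, h, interp_mult_tm]

theorem TmEl.eq_of_term {f f' : TmEl (weak X)} (h : f.bd = f'.bd) (h' : term f.2 = term f'.2) :
    f = f' := by
  obtain ⟨n, f⟩ := f
  obtain ⟨m, f'⟩ := f'
  obtain ⟨rfl, h⟩ := Sigma.mk.inj_iff.1 h
  exact congrArg _ (tm_ext (eq_of_heq h) h')

/-- The boundaries agree by the case of types, and fix all arguments, those of the outer term and
those inside its label. The remaining term-element is visible after flattening. -/
theorem mult_tm_injective (g : X ⟶ Y) {n : ℕ}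
    {P P' : (weak (weak X)).obj (op ((Paths.of _).obj (.tm n)))}
    (h : (mult X).app _ P = (mult X).app _ P')
    (h' : (relabel (relabel g)).app _ P = (relabel (relabel g)).app _ P') : P = P' := by
  have hbd : (weak (weak X)).bdTm n P = (weak (weak X)).bdTm n P' := by
    refine mult_ty_injective g ?_ ?_
    · rw [bdTm_app, bdTm_app, h]
    · rw [bdTm_app, bdTm_app, h']
  obtain ⟨f, l, h₁, h₂, -⟩ := exists_term P
  obtain ⟨f', l', h₁', h₂', -⟩ := exists_term P'
  rw [hbd, h₂'] at h₂
  obtain ⟨e, rfl⟩ := Expr.appVars_injective h₂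
  have hf : f'.bd = f.bd := Sum.inl_injective e
  refine tm_ext hbd ?_
  obtain ⟨c, s, h₃, h₃'⟩ := exists_term f.2
  obtain ⟨c', s', h₄, h₄'⟩ := exists_term f'.2
  have h₅ : Expr.appVars (Sum.inl c'.bd : Sym X) s' = .appVars (.inl c.bd) s :=
    h₄'.1.symm.trans ((congrArg TyEl.head hf).trans h₃'.1)
  obtain ⟨-, rfl⟩ := Expr.appVars_injective h₅
  have h₆ := term_mult h₁
  rw [h, term_mult h₁', h₃, h₄, Expr.rename_appVars, Expr.rename_appVars] at h₆
  obtain ⟨e', -⟩ := Expr.appVars_injective h₆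
  obtain rfl := Sum.inr_injective e'
  rw [h₁, h₁', TmEl.eq_of_term hf (h₄.trans h₃.symm)]

/-- The boundary lifts to `Q` by the case of types. The label of the lifted term is the term-element
`c` of `w` applied to the arguments `m` of the label in `P`, and is well-typed since the boundary of
`c` is the constant in the label of the type of `Q`. -/
theorem exists_mult_tm (g : X ⟶ Y) {n : ℕ} {w : (weak X).obj (op ((Paths.of _).obj (.tm n)))}
    {P : (weak (weak Y)).obj (op ((Paths.of _).obj (.tm n)))}
    (h : (relabel g).app _ w = (mult Y).app _ P) :
    ∃ P' : (weak (weak X)).obj (op ((Paths.of _).obj (.tm n))),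
      (mult X).app _ P' = w ∧ (relabel (relabel g)).app _ P' = P := by
  have hbd : (relabel g).app _ ((weak X).bdTm n w) = (mult Y).app _ ((weak (weak Y)).bdTm n P) := by
    rw [bdTm_app, bdTm_app, h]
  obtain ⟨Q, hQ, hQ'⟩ := exists_mult_ty g hbd
  obtain ⟨f, l, h₁, h₂, -⟩ := exists_term P
  obtain ⟨b, l', h₃, hl⟩ := exists_headExpr Q
  have h₄ := headExpr_relabel (relabel g) h₃
  rw [hQ', h₂] at h₄
  obtain ⟨e, rfl⟩ := Expr.appVars_injective h₄
  have hf : f.bd = b.map (relabel g) := Sum.inl_injective e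
  obtain ⟨c, s, h₅, h₆, -⟩ := exists_term w
  obtain ⟨d, m, h₇, h₈, -⟩ := exists_term f.2
  obtain ⟨a, m', h₉, -⟩ := exists_headExpr b.2
  have h₁₀ : Expr.appVars (Sum.inl d.bd : Sym Y) m = .appVars (.inl (a.map g)) m' :=
    h₈.symm.trans ((congrArg TyEl.head hf).trans (headExpr_relabel g h₉))
  obtain ⟨-, rfl⟩ := Expr.appVars_injective h₁₀
  have h₁₁ := term_relabel g h₅
  rw [h, term_mult h₁, h₇, Expr.rename_appVars] at h₁₁
  obtain ⟨e₁, rfl⟩ := Expr.appVars_injective h₁₁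
  obtain rfl := Sum.inr_injective e₁
  rw [← hQ, headExpr_ext, h₃, interp_mult_ty] at h₆
  change (headExpr (judg b.2)).rename _ = _ at h₆
  rw [h₉, Expr.rename_appVars] at h₆
  obtain rfl := Sum.inl_injective (Expr.appVars_injective h₆).1
  obtain ⟨f', hf', hf''⟩ := exists_tm b.2 ⟨c, m, rfl, h₉⟩
  have hb : TmEl.bd (⟨b.1, f'⟩ : TmEl (weak X)) = b := congrArg (Sigma.mk b.1) hf'
  have hmap : TmEl.map (relabel g) (⟨b.1, f'⟩ : TmEl (weak X)) = f := by
    refine TmEl.eq_of_term ?_ ?_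
    · rw [TmEl.bd_map, hb, hf]
    · exact (term_relabel g hf'').trans h₇.symm
  obtain ⟨P', hP, hP'⟩ := exists_tm Q (t := .appVars (.inr ⟨b.1, f'⟩) l)
    ⟨_, l, rfl, by rw [h₃, hb]⟩
  refine ⟨P', tm_ext ?_ ?_, tm_ext ?_ ?_⟩
  · rw [← bdTm_app, hP, hQ]
  · rw [term_mult hP', hf'', h₅, Expr.rename_appVars]
  · rw [← bdTm_app, hP, hQ']
  · rw [term_relabel _ hP', hmap, h₁]

theorem isPullback_mult (g : X ⟶ Y) :
    IsPullback (mult X) (relabel (relabel g)) (relabel g) (mult Y) := by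
  refine IsPullback.of_forall_isPullback_app fun ⟨v⟩ => (Types.isPullback_iff _ _ _ _).2
    ⟨NatTrans.congr_app (mult_naturality g) _, ?_, ?_⟩
  · rintro x y ⟨h, h'⟩
    cases v with
    | ty n => exact mult_ty_injective g h h'
    | tm n => exact mult_tm_injective g h h'
  · intro w b h
    cases v with
    | ty n => exact exists_mult_ty g h
    | tm n => exact exists_mult_tm g h

end TTStr

/-! ### Unit, multiplication and components for the constructed adjunction -/

namespace TTStr

open WGAT

theorem freeAdj_unit_app (X : TTStr.{u}) : freeAdj.unit.app X = gen X := by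
  have : gen X ≫ forget.map (𝟙 (free X)) = gen X := by
    rw [CategoryTheory.Functor.map_id, Category.comp_id]
  exact this

theorem forget_map_freeAdj_counit_app (X : TTStr.{u}) :
    forget.map (freeAdj.counit.app (freeFunctor.obj X)) = mult X := rfl

theorem isPullback_freeAdj_unit {X Y : TTStr.{u}} (g : X ⟶ Y) :
    IsPullback (freeAdj.unit.app X) g (forget.map (freeFunctor.map g)) (freeAdj.unit.app Y) := by
  rw [freeAdj_unit_app, freeAdj_unit_app, forget_map_freeFunctor_map]
  exact isPullback_gen g

theorem isPullback_freeAdj_mult {X Y : TTStr.{u}} (g : X ⟶ Y) :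
    IsPullback (forget.map (freeAdj.counit.app (freeFunctor.obj X)))
      (forget.map (freeFunctor.map (forget.map (freeFunctor.map g))))
      (forget.map (freeFunctor.map g)) (forget.map (freeAdj.counit.app (freeFunctor.obj Y))) := by
  rw [forget_map_freeAdj_counit_app, forget_map_freeAdj_counit_app, forget_map_freeFunctor_map,
    forget_map_freeFunctor_map]
  exact isPullback_mult g

theorem familiallyRepresentable_of_iso {F : TTStr.{u} ⥤ TTStr.{u}} (e : F ≅ freeFunctor ⋙ forget) :
    FamiliallyRepresentable F := by
  rintro ⟨v⟩
  cases v with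
  | ty n => exact ⟨_, _, ⟨Functor.isoWhiskerRight e _ ≪≫ (Heap.tyIso n).symm⟩⟩
  | tm n => exact ⟨_, _, ⟨Functor.isoWhiskerRight e _ ≪≫ (Heap.tmIso n).symm⟩⟩

end TTStr

/-! ### Transport of cartesianness between two left adjoints of one functor -/

section Transport

variable {C : Type u₁} [Category.{v₁} C] {D : Type u₂} [Category.{v₂} D] {R : D ⥤ C}
  {L L' : C ⥤ D}

theorem isPullback_unit_of_adjunction (adj : L ⊣ R) (adj' : L' ⊣ R) {X Y : C} {g : X ⟶ Y}
    (h : IsPullback (adj.unit.app X) g (R.map (L.map g)) (adj.unit.app Y)) :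
    IsPullback (adj'.unit.app X) g (R.map (L'.map g)) (adj'.unit.app Y) := by
  let e := adj.leftAdjointUniq adj'
  refine IsPullback.of_iso h (Iso.refl _) (R.mapIso (e.app X)) (Iso.refl _) (R.mapIso (e.app Y))
    ?_ ?_ ?_ ?_
  · simp [e]
  · simp
  · simp [← Functor.map_comp]
  · simp [e]

theorem isPullback_mult_of_adjunction (adj : L ⊣ R) (adj' : L' ⊣ R) {X Y : C} {g : X ⟶ Y}
    (h : IsPullback (R.map (adj.counit.app (L.obj X))) (R.map (L.map (R.map (L.map g))))
      (R.map (L.map g)) (R.map (adj.counit.app (L.obj Y)))) :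
    IsPullback (R.map (adj'.counit.app (L'.obj X))) (R.map (L'.map (R.map (L'.map g))))
      (R.map (L'.map g)) (R.map (adj'.counit.app (L'.obj Y))) := by
  let e := adj.leftAdjointUniq adj'
  have hc (Z : D) : e.hom.app (R.obj Z) ≫ adj'.counit.app Z = adj.counit.app Z :=
    adj.leftAdjointUniq_hom_app_counit adj' Z
  let i (Z : C) : R.obj (L.obj (R.obj (L.obj Z))) ≅ R.obj (L'.obj (R.obj (L'.obj Z))) :=
    R.mapIso (L.mapIso (R.mapIso (e.app Z)) ≪≫ e.app _)
  refine IsPullback.of_iso h (i X) (R.mapIso (e.app X)) (i Y) (R.mapIso (e.app Y))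
    ?_ ?_ ?_ ?_
  · simp only [i, Functor.mapIso_hom, Iso.trans_hom, Iso.app_hom, ← Functor.map_comp]
    rw [Category.assoc, hc]
    exact congrArg R.map (adj.counit_naturality _).symm
  · simp only [i, Functor.mapIso_hom, Iso.trans_hom, Iso.app_hom, ← Functor.map_comp]
    congr 1
    rw [Category.assoc]
    refine Eq.trans ?_ (congrArg _ (e.hom.naturality _))
    rw [← Category.assoc, ← Category.assoc, ← Functor.map_comp, ← Functor.map_comp,
      ← Functor.map_comp, ← Functor.map_comp]
    exact congrArg (fun k => L.map (R.map k) ≫ _) (e.hom.naturality g)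
  · simp [← Functor.map_comp]
  · simp only [i, Functor.mapIso_hom, Iso.trans_hom, Iso.app_hom, ← Functor.map_comp]
    rw [Category.assoc, hc]
    exact congrArg R.map (adj.counit_naturality _).symm

end Transport

end WeakeningMonad

theorem mainTheorem4 :
    -- the forgetful functor has a left adjoint, so that the weakening monad exists
    WeakeningMonad.WGAT.forget.{u}.IsRightAdjoint ∧
    -- for the weakening monad `W = adj.toMonad`
    ∀ (G : WeakeningMonad.TTStr.{u} ⥤ WeakeningMonad.WGAT.{u})
      (adj : G ⊣ WeakeningMonad.WGAT.forget.{u}),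
      WeakeningMonad.IsStronglyCartesianMonad adj.toMonad ∧
      (∀ n : ℕ, Nonempty (adj.toMonad.toFunctor ⋙
          (evaluation WeakeningMonad.HCatᵒᵖ (Type u)).obj
            (op ((Paths.of _).obj (WeakeningMonad.HVertex.ty n))) ≅
        WeakeningMonad.sumRepresentable
          fun φ : WeakeningMonad.Heap (n + 1) => φ.tyShape)) ∧
      (∀ n : ℕ, Nonempty (adj.toMonad.toFunctor ⋙
          (evaluation WeakeningMonad.HCatᵒᵖ (Type u)).obj
            (op ((Paths.of _).obj (WeakeningMonad.HVertex.tm n))) ≅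
        WeakeningMonad.sumRepresentable
          fun φ : WeakeningMonad.Heap (n + 1) => φ.tmShape)) := by
  refine ⟨WeakeningMonad.TTStr.freeAdj.isRightAdjoint, fun G adj => ?_⟩
  -- The adjunction `adj` is arbitrary; uniqueness of left adjoints reduces every claim to
  -- `freeFunctor`.
  have e : adj.toMonad.toFunctor ≅ WeakeningMonad.TTStr.freeFunctor ⋙ WeakeningMonad.WGAT.forget :=
    Functor.isoWhiskerRight (adj.leftAdjointUniq WeakeningMonad.TTStr.freeAdj) _
  have hF := WeakeningMonad.TTStr.familiallyRepresentable_of_iso e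
  exact ⟨⟨⟨hF.preservesPullbacks,
      fun g => WeakeningMonad.isPullback_unit_of_adjunction _ adj
        (WeakeningMonad.TTStr.isPullback_freeAdj_unit g),
      fun g => WeakeningMonad.isPullback_mult_of_adjunction _ adj
        (WeakeningMonad.TTStr.isPullback_freeAdj_mult g)⟩, hF.isLocalRightAdjoint⟩,
    fun n => ⟨Functor.isoWhiskerRight e _ ≪≫ (WeakeningMonad.Heap.tyIso n).symm⟩,
    fun n => ⟨Functor.isoWhiskerRight e _ ≪≫ (WeakeningMonad.Heap.tmIso n).symm⟩⟩
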